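/- For $c\in\mathbb N$ let $\tau=\{E,P_1,\dots,P_c\}$ with $E$ binary and the $P_i$ unary. A $\tau$-coloured graph is a nonempty finite $\tau$-structure $G$ in which $E$ is symmetric and irreflexive. Let $L,Q\colon\mathbb N^3\to\mathbb N$ be computable functions with $L(\ell,k,q)\ge \ell$ and $Q(q,k,\ell)\ge q$ for all $k,\ell,q$. The parameterized search problem $\mathrm{FO\text{-}Learn}[L,Q]$ is the following. Input: a vocabulary $\tau$ as above, a $\tau$-coloured graph $G$, numbers $k,\ell,q\in\mathbb N$, and disjoint sets $\Lambda^+,\Lambda^-\subseteq V(G)^k$ of positive and negative training examples. Parameter: $k+\ell+q+|\tau|$. Task: return a first-order formula $\varphi(\bar x;\bar y)$ over $\tau$ of quantifier rank at most $Q(q,k,\ell)$, with $|\bar x|=k$ and $|\bar y|=L(\ell,k,q)$, and a tuple $\bar w\in V(G)^{L(\ell,k,q)}$ with training error $0$, that is, $G\models\varphi(\bar v;\bar w)$ for all $\bar v\in\Lambda^+$ and $G\not\models\varphi(\bar v;\bar w)$ for all $\bar v\in\Lambda^-$. The algorithm may reject if there are no formula $\varphi^*(\bar x;\bar y)$ of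 quantifier rank at most $q$ with $|\bar y|=\ell$ and tuple $\bar w^*\in V(G)^\ell$ with training error $0$. The class $\mathrm{AW}[*]$ is the union over $t\ge1$ of the classes $\mathrm{AW}[t]$ of all parameterized problems that are fpt many-one reducible to alternating weighted satisfiability of $t$-normalized formulas: given disjoint sets $X_1,\dots,X_r$ of Boolean variables, numbers $k_1,\dots,k_r$ and a formula $\chi$ over $X_1\cup\dots\cup X_r$ that is a conjunction of disjunctions of conjunctions $\dots$ ($t$ alternating levels) of literals, with parameter $r+k_1+\dots+k_r$, decide whether there is $U_1\subseteq X_1$ with $|U_1|=k_1$ such that for all $U_2\subseteq X_2$ with $|U_2|=k_2$ there is $U_3\subseteq X_3$ with $|U_3|=k_3$ $\dots$ such that $\chi$ is true when exactly the variables in $U_1\cup\dots\cup U_r$ are true. **Theorem.** For all such $L$ and $Q$, $\mathrm{FO\text{-}Learn}[L,Q]$ is hard for $\mathrm{AW}[*]$ under parameterized Turing reductions. That is, for every $(A,\kappa)\in\mathrm{AW}[*]$ there are a deterministic oracle algorithm, computable functions $f,g\colon\mathbb N\to\mathbb N$ and a polynomial $p$ such that, with any oracle function that answers every input of $\mathrm{FO\text{-}Learn}[L,Q]$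 correctly, the algorithm decides on each word $x$ whether $x\in A$ in at most $f(\kappa(x))\cdot p(|x|)$ steps, and all its oracle queries have parameter at most $g(\kappa(x))$. -/

import Mathlib

namespace FOLearning

/-! ### Words and binary trees -/

/-- Words over the alphabet `{0, 1}`. -/
abbrev Word := List Bool

/-- Binary trees (S-expressions), the values that programs manipulate. -/
inductive Val where
  | nil : Val
  | cons : Val → Val → Val

namespace Val

/-- A bit as a tree. -/
def ofBool : Bool → Val
  | false => nil
  | true => cons nil nil

/-- A list of trees as a tree. -/
def ofList : List Val → Val
  | [] => nil
  | v :: l => cons v (ofList l)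

/-- A natural number in unary. -/
def ofNat (n : ℕ) : Val := ofList (List.replicate n nil)

/-- A word as a tree: the list of its letters. -/
def ofWord (w : Word) : Val := ofList (w.map ofBool)

/-- The prefix-order description of a tree as a word (a prefix-free binary code). -/
def toWord : Val → Word
  | nil => [false]
  | cons a b => true :: (a.toWord ++ b.toWord)

end Val

/-! ### Machine model: while-programs on binary trees, with a step count and oracle queries

The machine has finitely many registers in use, each of which holds a pointer to a binary tree;
an elementary operation (create a cell, follow a pointer, test for `nil`, assign) takes one step.
Inputs, outputs, oracle queries and oracle answers are words, and writing a query costs its length.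
Polynomial time on this model is polynomial time on Turing machines. -/

/-- Contents of the registers. -/
abbrev Store := ℕ → Val

inductive Expr where
  | reg : ℕ → Expr
  | nil : Expr
  | cons : Expr → Expr → Expr
  | head : Expr → Expr
  | tail : Expr → Expr

namespace Expr

def eval (s : Store) : Expr → Val
  | reg i => s i
  | nil => Val.nil
  | cons a b => Val.cons (a.eval s) (b.eval s)
  | head a => match a.eval s with
    | Val.nil => Val.nil
    | Val.cons u _ => u
  | tail a => match a.eval s with
    | Val.nil => Val.nil
    | Val.cons _ v => v

/-- Number of elementary operations in the evaluation of an expression. -/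
def cost : Expr → ℕ
  | reg _ => 1
  | nil => 1
  | cons a b => a.cost + b.cost + 1
  | head a => a.cost + 1
  | tail a => a.cost + 1

end Expr

inductive Prog where
  | assign : ℕ → Expr → Prog
  | seq : Prog → Prog → Prog
  | cond : Expr → Prog → Prog → Prog
  | loop : Expr → Prog → Prog
  /-- `query i j` asks the oracle the word in register `i` and puts the answer into `j`. -/
  | query : ℕ → ℕ → Prog

/-- `Run ask p s s' t`: started in `s`, the program `p` halts in `s'` after `t` steps, where
every query `w` that it asks and the answer `a` that it gets satisfy `ask w a`. -/
inductive Run (ask : Word → Word → Prop) : Prog → Store → Store → ℕ → Prop where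
  | assign (i : ℕ) (e : Expr) (s : Store) :
      Run ask (Prog.assign i e) s (Function.update s i (e.eval s)) (e.cost + 1)
  | seq {p₁ p₂ : Prog} {s₁ s₂ s₃ : Store} {t₁ t₂ : ℕ} :
      Run ask p₁ s₁ s₂ t₁ → Run ask p₂ s₂ s₃ t₂ → Run ask (Prog.seq p₁ p₂) s₁ s₃ (t₁ + t₂)
  | condTrue {e : Expr} {p₁ p₂ : Prog} {s s' : Store} {t : ℕ} :
      e.eval s ≠ Val.nil → Run ask p₁ s s' t → Run ask (Prog.cond e p₁ p₂) s s' (e.cost + 1 + t)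
  | condFalse {e : Expr} {p₁ p₂ : Prog} {s s' : Store} {t : ℕ} :
      e.eval s = Val.nil → Run ask p₂ s s' t → Run ask (Prog.cond e p₁ p₂) s s' (e.cost + 1 + t)
  | loopDone {e : Expr} {p : Prog} {s : Store} :
      e.eval s = Val.nil → Run ask (Prog.loop e p) s s (e.cost + 1)
  | loopStep {e : Expr} {p : Prog} {s₁ s₂ s₃ : Store} {t₁ t₂ : ℕ} :
      e.eval s₁ ≠ Val.nil → Run ask p s₁ s₂ t₁ → Run ask (Prog.loop e p) s₂ s₃ t₂ →
      Run ask (Prog.loop e p) s₁ s₃ (e.cost + 1 + t₁ + t₂)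
  | query {i j : ℕ} {s : Store} {w a : Word} :
      s i = Val.ofWord w → ask w a →
      Run ask (Prog.query i j) s (Function.update s j (Val.ofWord a)) (w.length + 1)

/-- Initially register `0` holds the input word, all other registers are `nil`. -/
def initStore (x : Word) : Store := Function.update (fun _ => Val.nil) 0 (Val.ofWord x)

/-- On input `x`, the program halts within `T` steps, with its result, the final content of
register `0`, satisfying `post`. -/
def HaltsWithin (ask : Word → Word → Prop) (p : Prog) (x : Word) (T : ℕ) (post : Val → Prop) :
    Prop :=
  ∃ (s : Store) (t : ℕ), Run ask p (initStore x) s t ∧ t ≤ T ∧ post (s 0)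

/-- No queries are possible. -/
def noOracle : Word → Word → Prop := fun _ _ => False

/-! ### Parameterized problems and reductions -/

/-- A language with a parametrization; that the parametrization is computable in polynomial time
is the separate predicate `PolyTimeParam`. -/
structure ParamProblem where
  lang : Set Word
  param : Word → ℕ

/-- The parametrization is computable (in binary) in polynomial time. -/
def ParamProblem.PolyTimeParam (A : ParamProblem) : Prop :=
  ∃ (p : Prog) (P : Polynomial ℕ), ∀ x : Word,
    HaltsWithin noOracle p x (P.eval x.length) (fun v => v = Val.ofWord (A.param x).bits)

/-- Many-one fpt-reducibility. -/
def FptReducible (A B : ParamProblem) : Prop :=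
  ∃ (R : Word → Word) (p : Prog) (f g : ℕ → ℕ) (P : Polynomial ℕ),
    Computable f ∧ Computable g ∧ ∀ x : Word,
      HaltsWithin noOracle p x (f (A.param x) * P.eval x.length) (fun v => v = Val.ofWord (R x)) ∧
      (x ∈ A.lang ↔ R x ∈ B.lang) ∧ B.param (R x) ≤ g (A.param x)

/-- A parameterized search problem: `sol w` is the set of correct answers on input `w`. -/
structure ParamSearchProblem where
  sol : Word → Set Word
  param : Word → ℕ

/-- The oracle `O` solves the search problem `B`. -/
def ParamSearchProblem.Solves (B : ParamSearchProblem) (O : Word → Word) : Prop :=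
  ∀ w : Word, O w ∈ B.sol w

/-- Parameterized Turing reducibility: a single oracle program that, with every oracle solving
`B`, decides `A` in fpt time and only asks queries whose parameter is bounded in terms of the
parameter of the input. -/
def FptTuringReducible (A : ParamProblem) (B : ParamSearchProblem) : Prop :=
  ∃ (p : Prog) (f g : ℕ → ℕ) (P : Polynomial ℕ),
    Computable f ∧ Computable g ∧ ∀ O : Word → Word, B.Solves O → ∀ x : Word,
      HaltsWithin (fun w a => B.param w ≤ g (A.param x) ∧ a = O w) p x
        (f (A.param x) * P.eval x.length) (fun v => v ≠ Val.nil ↔ x ∈ A.lang)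

/-- `B` is hard for the class `C` under parameterized Turing reductions. -/
def TuringHard (C : Set ParamProblem) (B : ParamSearchProblem) : Prop :=
  ∀ A ∈ C, FptTuringReducible A B

/-- The parametrization on words given by a parameter of the encoded objects, for an injective
encoding; words that encode nothing get the value `0`. -/
noncomputable def codedParam {ι : Type} (code : ι → Word) (param : ι → ℕ) (w : Word) : ℕ :=
  sInf {m | ∃ I : ι, code I = w ∧ param I = m}

/-! ### Alternating weighted satisfiability and the class `AW[*]` -/

/-- A literal: variable number `idx` of block number `block`, negated if `sign` is `false`. -/
structure Literal where
  block : ℕ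
  idx : ℕ
  sign : Bool

/-- Normalized formulas: a big conjunction of big disjunctions of big conjunctions ..., with `t`
alternating levels, of literals. The same data is also read dually, with an outermost
disjunction. -/
def NForm : ℕ → Type
  | 0 => Literal
  | t + 1 => List (NForm t)

namespace NForm

/-- Truth under the assignment that makes exactly the variables `(i, j)` with `j ∈ α i` true;
the outermost connective is a conjunction for `true` and a disjunction for `false`. -/
def Holds (α : ℕ → Finset ℕ) : Bool → (t : ℕ) → NForm t → Prop
  | _, 0, (l : Literal) => (l.idx ∈ α l.block ↔ l.sign = true)
  | true, t + 1, (φ : List (NForm t)) => ∀ ψ ∈ φ, Holds α false t ψ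
  | false, t + 1, (φ : List (NForm t)) => ∃ ψ ∈ φ, Holds α true t ψ

/-- All literals of the formula satisfy `P`. -/
def All (P : Literal → Prop) : (t : ℕ) → NForm t → Prop
  | 0, (l : Literal) => P l
  | t + 1, (φ : List (NForm t)) => ∀ ψ ∈ φ, All P t ψ

def code : (t : ℕ) → NForm t → Val
  | 0, (l : Literal) => Val.ofList [Val.ofNat l.block, Val.ofNat l.idx, Val.ofBool l.sign]
  | t + 1, (φ : List (NForm t)) => Val.ofList (φ.map (code t))

end NForm

/-- Truth of a sequence of weighted quantifiers in front of `φ`. The `i`-th block `(n, k)` has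
variables `0, ..., n - 1`, from which a set of exactly `k` true variables is chosen, existentially
if the flag is `true`, universally otherwise; the quantifiers alternate. -/
def AltHolds (φ : (ℕ → Finset ℕ) → Prop) : List (ℕ × ℕ) → Bool → ℕ → (ℕ → Finset ℕ) → Prop
  | [], _, _, α => φ α
  | (n, k) :: bs, true, i, α =>
      ∃ S ⊆ Finset.range n, S.card = k ∧ AltHolds φ bs false (i + 1) (Function.update α i S)
  | (n, k) :: bs, false, i, α =>
      ∀ S ⊆ Finset.range n, S.card = k → AltHolds φ bs true (i + 1) (Function.update α i S)

/-- An instance of alternating weighted satisfiability for `t`-normalized formulas: blocks of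
variables with their sizes and weights, and a formula over these variables. -/
structure AWInstance (t : ℕ) where
  blocks : List (ℕ × ℕ)
  formula : NForm t
  wf : formula.All (fun l => ∃ b, blocks[l.block]? = some b ∧ l.idx < b.1) t

namespace AWInstance

variable {t : ℕ}

def Yes (I : AWInstance t) : Prop :=
  AltHolds (fun α => I.formula.Holds α true t) I.blocks true 0 (fun _ => ∅)

/-- The number of blocks plus the sum of the weights. -/
def param (I : AWInstance t) : ℕ := I.blocks.length + (I.blocks.map Prod.snd).sum

def code (I : AWInstance t) : Word :=
  (Val.cons (Val.ofList (I.blocks.map fun b => Val.cons (Val.ofNat b.1) (Val.ofNat b.2)))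
    (I.formula.code t)).toWord

end AWInstance

/-- Alternating weighted satisfiability (parameterized quantified Boolean satisfiability) for
`t`-normalized formulas. -/
noncomputable def AWSat (t : ℕ) : ParamProblem where
  lang := {w | ∃ I : AWInstance t, I.code = w ∧ I.Yes}
  param := codedParam (ι := AWInstance t) AWInstance.code AWInstance.param

/-- The class `AW[*]`, the union over `t ≥ 1` of the classes `AW[t]` of all parameterized problems
that are fpt-reducible to alternating weighted satisfiability for `t`-normalized formulas. -/
def AWStar : Set ParamProblem :=
  {A | A.PolyTimeParam ∧ ∃ t : ℕ, 1 ≤ t ∧ FptReducible A (AWSat t)}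

/-! ### Coloured graphs and first-order formulas -/

/-- Relation symbols of the vocabulary with one binary symbol and `c` unary symbols. -/
inductive ColRel (c : ℕ) : ℕ → Type where
  | adj : ColRel c 2
  | col : Fin c → ColRel c 1

/-- The vocabulary `{E, P₁, ..., P_c}` of graphs with `c` colours. -/
def colLang (c : ℕ) : FirstOrder.Language.{0, 0} where
  Functions := fun _ => Empty
  Relations := ColRel c

/-- A nonempty finite graph with vertices `0, ..., n - 1` and `c` colours. -/
structure ColGraph (c : ℕ) where
  n : ℕ
  n_pos : 0 < n
  graph : SimpleGraph (Fin n)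
  col : Fin c → Set (Fin n)

/-- The relational structure of a coloured graph. -/
@[reducible]
def ColGraph.str {c : ℕ} (G : ColGraph c) : (colLang c).Structure (Fin G.n) where
  funMap := fun f => Empty.elim f
  RelMap := fun R x => match R, x with
    | ColRel.adj, x => G.graph.Adj (x 0) (x 1)
    | ColRel.col i, x => x 0 ∈ G.col i

/-- A formula `φ(x₁, ..., x_k ; y₁, ..., y_m)` over graphs with `c` colours. -/
abbrev FOFormula (c k m : ℕ) := (colLang c).Formula (Fin k ⊕ Fin m)

/-- `G ⊨ φ(u ; w)`. -/
def ColGraph.Sat {c k m : ℕ} (G : ColGraph c) (φ : FOFormula c k m) (u : Fin k → Fin G.n)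
    (w : Fin m → Fin G.n) : Prop :=
  @FirstOrder.Language.Formula.Realize (colLang c) (Fin G.n) G.str (Fin k ⊕ Fin m) φ (Sum.elim u w)

/-- Quantifier rank. -/
def qrank {c : ℕ} {α : Type} : {n : ℕ} → (colLang c).BoundedFormula α n → ℕ
  | _, .falsum => 0
  | _, .equal _ _ => 0
  | _, .rel _ _ => 0
  | _, .imp φ ψ => max (qrank φ) (qrank ψ)
  | _, .all φ => qrank φ + 1

/-- Encoding of a variable: `xᵢ`, `yᵢ`, or a quantified variable. -/
def termCode {c k m n : ℕ} : (colLang c).Term ((Fin k ⊕ Fin m) ⊕ Fin n) → Val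
  | .var (.inl (.inl i)) => Val.ofList [Val.ofNat 0, Val.ofNat i]
  | .var (.inl (.inr i)) => Val.ofList [Val.ofNat 1, Val.ofNat i]
  | .var (.inr i) => Val.ofList [Val.ofNat 2, Val.ofNat i]
  | .func f _ => Empty.elim f

/-- Encoding of an atomic formula with a relation symbol. -/
def relCode {c k m n l : ℕ} (R : ColRel c l)
    (ts : Fin l → (colLang c).Term ((Fin k ⊕ Fin m) ⊕ Fin n)) : Val :=
  match R, ts with
  | ColRel.adj, ts => Val.ofList [Val.ofNat 2, termCode (ts 0), termCode (ts 1)]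
  | ColRel.col i, ts => Val.ofList [Val.ofNat 3, Val.ofNat i, termCode (ts 0)]

/-- Encoding of a formula. -/
def formulaCode {c k m : ℕ} : {n : ℕ} → (colLang c).BoundedFormula (Fin k ⊕ Fin m) n → Val
  | _, .falsum => Val.ofList [Val.ofNat 0]
  | _, .equal t₁ t₂ => Val.ofList [Val.ofNat 1, termCode t₁, termCode t₂]
  | _, .rel R ts => relCode R ts
  | _, .imp φ ψ => Val.ofList [Val.ofNat 4, formulaCode φ, formulaCode ψ]
  | _, .all φ => Val.ofList [Val.ofNat 5, formulaCode φ]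

/-- Encoding of a tuple of vertices. -/
def tupleCode {k n : ℕ} (u : Fin k → Fin n) : Val :=
  Val.ofList (List.ofFn fun i => Val.ofNat (u i))

open Classical in
/-- Encoding of a coloured graph by its adjacency matrix and the characteristic vectors of its
colours. -/
noncomputable def ColGraph.code {c : ℕ} (G : ColGraph c) : Val :=
  Val.cons
    (Val.ofList (List.ofFn fun i => Val.ofList (List.ofFn fun j =>
      Val.ofBool (decide (G.graph.Adj i j)))))
    (Val.ofList (List.ofFn fun a => Val.ofList (List.ofFn fun i =>
      Val.ofBool (decide (i ∈ G.col a)))))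

/-! ### The learning problem -/

/-- An input of the learning problem: a coloured graph, the numbers `k`, `l`, `q`, and distinct
positive and negative training examples. -/
structure LearnInstance where
  c : ℕ
  G : ColGraph c
  k : ℕ
  l : ℕ
  q : ℕ
  pos : List (Fin k → Fin G.n)
  neg : List (Fin k → Fin G.n)
  nodup : (pos ++ neg).Nodup

namespace LearnInstance

/-- `k + l + q + |τ|`, where the vocabulary `τ` consists of `E` and the `c` colours. -/
def param (I : LearnInstance) : ℕ := I.k + I.l + I.q + (I.c + 1)

noncomputable def code (I : LearnInstance) : Word :=
  (Val.ofList [I.G.code, Val.ofNat I.k, Val.ofNat I.l, Val.ofNat I.q,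
    Val.ofList (I.pos.map tupleCode), Val.ofList (I.neg.map tupleCode)]).toWord

open Classical in
/-- The training error: the fraction of misclassified examples. -/
noncomputable def err (I : LearnInstance) {m : ℕ} (φ : FOFormula I.c I.k m)
    (w : Fin m → Fin I.G.n) : ℚ :=
  ((I.pos.toFinset.filter (fun v => ¬ I.G.Sat φ v w) ∪
    I.neg.toFinset.filter (fun v => I.G.Sat φ v w)).card : ℚ) /
      ((I.pos.length + I.neg.length : ℕ) : ℚ)

/-- `φ` has quantifier rank at most `r` and, with the parameters `w`, training error `0`. -/
def Consistent (I : LearnInstance) (r : ℕ) {m : ℕ} (φ : FOFormula I.c I.k m)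
    (w : Fin m → Fin I.G.n) : Prop :=
  qrank φ ≤ r ∧ I.err φ w = 0

/-- The correct answers: either a code of a consistent pair of a formula of quantifier rank at most
`Q(q, k, l)` and a tuple of `L(l, k, q)` parameters, or, provided that there is no consistent pair
of a formula of quantifier rank at most `q` and a tuple of `l` parameters, a rejection, which is
expressed by the code of the empty tree. -/
def Correct (L Q : ℕ → ℕ → ℕ → ℕ) (I : LearnInstance) (a : Word) : Prop :=
  (∃ (φ : FOFormula I.c I.k (L I.l I.k I.q)) (w : Fin (L I.l I.k I.q) → Fin I.G.n),
      I.Consistent (Q I.q I.k I.l) φ w ∧ a = (Val.cons (formulaCode φ) (tupleCode w)).toWord) ∨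
  ((¬ ∃ (φ : FOFormula I.c I.k I.l) (w : Fin I.l → Fin I.G.n), I.Consistent I.q φ w) ∧
      a = Val.nil.toWord)

end LearnInstance

/-- The learning problem with the bounds `L` and `Q`, as a parameterized search problem; on words
that do not encode an input every answer is correct. -/
noncomputable def FOLearn (L Q : ℕ → ℕ → ℕ → ℕ) : ParamSearchProblem where
  sol := fun w => {a | ∀ I : LearnInstance, I.code = w → I.Correct L Q a}
  param := codedParam LearnInstance.code LearnInstance.param

end FOLearning

/-!
The hardness proof evaluates an instance of alternating weighted satisfiability as a game in which
single variables are chosen one after the other, and uses the learner as an oracle to keep the game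
tree small.

*The graph.* The formula, its subformulas and its variables are the vertices of a coloured graph
(`vertexList`, `graphOf`). The colours record depths, signs and blocks, the edges join subformulas
to their immediate subformulas and literals to their variables, and the root is adjacent to
everything. Evaluating the formula, of depth `T`, after `m` more choices is a game that follows
edges and colours, so partial choices from which Duplicator wins the Ehrenfeucht–Fraïssé game with
`T + m` rounds have the same value (`IsVertexList.gameHolds_iff`). The game with all choices still
open has the truth value of the instance (`AWInstance.gameHolds_iff`).

*The queries.* Going down the game tree, the algorithm asks for each partial choice `w` whether it
can be separated from the siblings of `w` that have been accepted before; `w` is the only positive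
example, the siblings are the negative ones, and `l = 0`. A rejection means that no formula of small
quantifier rank separates them, so `w` is equivalent to a sibling and can be dropped
(`exists_ef_of_reject`). Otherwise `w` is accepted and its successors are examined later. In the
end, the values of the accepted partial choices are computed bottom-up
(`SearchInv.verdict_iff`). Only the first letter of an answer is read, because the answers may be
long.

*Few accepted choices.* The parameters of an answer could separate siblings that have the same
type. Therefore each query is about `n` disjoint copies of the graph, where `n` is its number of
vertices, and about all copies of the tuples. If the learner may use fewer than `n` parameters, then
one of the copies contains none of them, so accepted siblings have pairwise different types of
bounded quantifier rank (`not_ef_of_accept`), and the number of these types is bounded in terms of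
the parameter (`card_rankType`). Otherwise `n` itself is bounded in terms of the parameter. The
program is the same in both cases and need not compute `L` and `Q`. The tuples of a query have the
root, which is adjacent to all other vertices, as a common entry, which is why indistinguishability
in the union of the copies implies indistinguishability in a single graph (`EF.of_copy`).

*Programs.* `PT f` says that a program without queries computes `f` in polynomial time, with respect
to encodings of the types as trees. Such functions are closed under composition, pairing, folding
and so on, and `fun_prop` proves that the parts of the algorithm are of this kind. The search loop,
the only place with queries, is `exists_search_program`. The number of its iterations and the size
of its states are bounded by `SearchInv.length_done_le` and `SearchInv.sz_le`.
-/

namespace FOLearning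

/-! ### Executions of programs -/

/-- The size of a tree, which is the length of its code `Val.toWord`. -/
def Val.size : Val → ℕ
  | nil => 1
  | cons a b => a.size + b.size + 1

/-- Every tree is a list of trees; this is the inverse of `Val.ofList`. -/
def Val.toList : Val → List Val
  | nil => []
  | cons a b => a :: b.toList

@[simp] theorem Val.ofList_toList (v : Val) : Val.ofList v.toList = v := by
  induction v with
  | nil => rfl
  | cons a b _ ih => simp [Val.toList, Val.ofList, ih]

@[simp] theorem Val.toList_ofList (l : List Val) : (Val.ofList l).toList = l := by
  induction l with
  | nil => rfl
  | cons a b ih => simp [Val.toList, Val.ofList, ih]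

theorem Val.ofList_injective : Function.Injective Val.ofList :=
  Function.LeftInverse.injective Val.toList_ofList

theorem Val.one_le_size (v : Val) : 1 ≤ v.size := by
  cases v <;> simp [Val.size]

/-- The expression with all register numbers increased by `b`. -/
def Expr.shift (b : ℕ) : Expr → Expr
  | reg i => reg (i + b)
  | nil => nil
  | cons x y => cons (x.shift b) (y.shift b)
  | head x => head (x.shift b)
  | tail x => tail (x.shift b)

/-- The program with all register numbers increased by `b`, used as a subroutine that leaves the
registers below `b` alone. -/
def Prog.shift (b : ℕ) : Prog → Prog
  | assign i e => assign (i + b) (e.shift b)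
  | seq p q => seq (p.shift b) (q.shift b)
  | cond e p q => cond (e.shift b) (p.shift b) (q.shift b)
  | loop e p => loop (e.shift b) (p.shift b)
  | query i j => query (i + b) (j + b)

theorem Expr.eval_shift {b : ℕ} {s S : Store} (h : ∀ i, S (i + b) = s i) (e : Expr) :
    (e.shift b).eval S = e.eval s := by
  induction e with
  | reg i => exact h i
  | nil => rfl
  | cons x y hx hy => simp [Expr.shift, Expr.eval, hx, hy]
  | head x hx => simp [Expr.shift, Expr.eval, hx]
  | tail x hx => simp [Expr.shift, Expr.eval, hx]

theorem Expr.cost_shift (b : ℕ) (e : Expr) : (e.shift b).cost = e.cost := by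
  induction e with
  | reg i => rfl
  | nil => rfl
  | cons x y hx hy => simp [Expr.shift, Expr.cost, hx, hy]
  | head x hx => simp [Expr.shift, Expr.cost, hx]
  | tail x hx => simp [Expr.shift, Expr.cost, hx]

theorem Run.shift {ask : Word → Word → Prop} {b : ℕ} {p : Prog} {s s' : Store} {t : ℕ}
    (h : Run ask p s s' t) : ∀ S : Store, (∀ i, S (i + b) = s i) →
      ∃ S', Run ask (p.shift b) S S' t ∧ (∀ i, S' (i + b) = s' i) ∧ ∀ i < b, S' i = S i := by
  induction h with
  | assign i e s =>
    intro S hS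
    have hrun := Run.assign (ask := ask) (i + b) (e.shift b) S
    rw [Expr.cost_shift] at hrun
    refine ⟨_, hrun, fun j => ?_, fun j hj => ?_⟩
    · by_cases hji : j = i
      · subst hji; simp [Expr.eval_shift hS]
      · simp [Function.update, hji, hS]
    · simp [Function.update, show j ≠ i + b by omega]
  | seq _ _ ih₁ ih₂ =>
    intro S hS
    obtain ⟨S₁, r₁, h₁, l₁⟩ := ih₁ S hS
    obtain ⟨S₂, r₂, h₂, l₂⟩ := ih₂ S₁ h₁
    exact ⟨S₂, Run.seq r₁ r₂, h₂, fun i hi => (l₂ i hi).trans (l₁ i hi)⟩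
  | condTrue he _ ih =>
    intro S hS
    obtain ⟨S₁, r₁, h₁, l₁⟩ := ih S hS
    rw [← Expr.cost_shift b]
    exact ⟨S₁, Run.condTrue (by rwa [Expr.eval_shift hS]) r₁, h₁, l₁⟩
  | condFalse he _ ih =>
    intro S hS
    obtain ⟨S₁, r₁, h₁, l₁⟩ := ih S hS
    rw [← Expr.cost_shift b]
    exact ⟨S₁, Run.condFalse (by rwa [Expr.eval_shift hS]) r₁, h₁, l₁⟩
  | loopDone he =>
    intro S hS
    rw [← Expr.cost_shift b]
    exact ⟨S, Run.loopDone (by rwa [Expr.eval_shift hS]), hS, fun _ _ => rfl⟩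
  | loopStep he _ _ ih₁ ih₂ =>
    intro S hS
    obtain ⟨S₁, r₁, h₁, l₁⟩ := ih₁ S hS
    obtain ⟨S₂, r₂, h₂, l₂⟩ := ih₂ S₁ h₁
    rw [← Expr.cost_shift b]
    exact ⟨S₂, Run.loopStep (by rwa [Expr.eval_shift hS]) r₁ r₂, h₂,
      fun i hi => (l₂ i hi).trans (l₁ i hi)⟩
  | query hw ha =>
    rename_i i j s w a
    intro S hS
    refine ⟨_, Run.query (j := j + b) (by rw [hS, hw]) ha, fun k => ?_, fun k hk => ?_⟩
    · by_cases hkj : k = j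
      · subst hkj; simp
      · simp [Function.update, hkj, hS]
    · simp [Function.update, show k ≠ j + b by omega]

theorem Run.mono {ask ask' : Word → Word → Prop} (hask : ∀ w a, ask w a → ask' w a) {p : Prog}
    {s s' : Store} {t : ℕ} (h : Run ask p s s' t) : Run ask' p s s' t := by
  induction h with
  | assign i e s => exact Run.assign i e s
  | seq _ _ ih₁ ih₂ => exact Run.seq ih₁ ih₂
  | condTrue he _ ih => exact Run.condTrue he ih
  | condFalse he _ ih => exact Run.condFalse he ih
  | loopDone he => exact Run.loopDone he
  | loopStep he _ _ ih₁ ih₂ => exact Run.loopStep he ih₁ ih₂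
  | query hw ha => exact Run.query hw (hask _ _ ha)

/-- Started in the store `s`, the program halts within `T` steps in a store satisfying `post`. -/
def Exec (ask : Word → Word → Prop) (p : Prog) (s : Store) (T : ℕ) (post : Store → Prop) : Prop :=
  ∃ s' t, Run ask p s s' t ∧ t ≤ T ∧ post s'

namespace Exec

variable {ask : Word → Word → Prop} {p q : Prog} {s : Store} {T T' : ℕ} {post mid : Store → Prop}

theorem mono (h : Exec ask p s T mid) (hT : T ≤ T') (hp : ∀ s', mid s' → post s') :
    Exec ask p s T' post := by
  obtain ⟨s', t, r, ht, hm⟩ := h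
  exact ⟨s', t, r, ht.trans hT, hp _ hm⟩

theorem seq (h : Exec ask p s T mid) (h' : ∀ s', mid s' → Exec ask q s' T' post) :
    Exec ask (Prog.seq p q) s (T + T') post := by
  obtain ⟨s₁, t₁, r₁, ht₁, hm⟩ := h
  obtain ⟨s₂, t₂, r₂, ht₂, hp⟩ := h' s₁ hm
  exact ⟨s₂, _, Run.seq r₁ r₂, by omega, hp⟩

theorem assign {i : ℕ} {e : Expr} (h : post (Function.update s i (e.eval s))) :
    Exec ask (Prog.assign i e) s (e.cost + 1) post :=
  ⟨_, _, Run.assign i e s, le_rfl, h⟩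

theorem cond {e : Expr} (h₁ : e.eval s ≠ Val.nil → Exec ask p s T post)
    (h₂ : e.eval s = Val.nil → Exec ask q s T post) :
    Exec ask (Prog.cond e p q) s (e.cost + 1 + T) post := by
  by_cases h : e.eval s = Val.nil
  · obtain ⟨s', t, r, ht, hp⟩ := h₂ h
    exact ⟨s', _, Run.condFalse h r, by omega, hp⟩
  · obtain ⟨s', t, r, ht, hp⟩ := h₁ h
    exact ⟨s', _, Run.condTrue h r, by omega, hp⟩

end Exec

/-- Started with `v` in register `0` and anything in the other registers, the program halts within
`T` steps with `v'` in register `0`. -/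
def Calc (ask : Word → Word → Prop) (p : Prog) (v v' : Val) (T : ℕ) : Prop :=
  ∀ s : Store, s 0 = v → Exec ask p s T (fun s' => s' 0 = v')

namespace Calc

variable {ask : Word → Word → Prop} {p q : Prog} {u v w : Val} {T T' : ℕ}

theorem mono (h : Calc ask p u v T) (hT : T ≤ T') : Calc ask p u v T' :=
  fun s hs => (h s hs).mono hT fun _ h => h

theorem seq (h : Calc ask p u v T) (h' : Calc ask q v w T') :
    Calc ask (Prog.seq p q) u w (T + T') :=
  fun s hs => (h s hs).seq fun s' hs' => h' s' hs'

/-- The shifted program as a subroutine with argument and result in register `b`. -/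
theorem call (h : Calc ask p u v T) {s : Store} (b : ℕ) (hs : s b = u) :
    Exec ask (p.shift b) s T (fun s' => s' b = v ∧ ∀ i < b, s' i = s i) := by
  obtain ⟨s', t, r, ht, hv⟩ := h (fun i => s (i + b)) (by simpa using hs)
  obtain ⟨S', R, hS', hl⟩ := r.shift (b := b) s (fun _ => rfl)
  exact ⟨S', t, R, ht, by simpa [hv] using hS' 0, hl⟩

theorem expr {e : Expr} (h : ∀ s : Store, s 0 = u → e.eval s = v) :
    Calc ask (Prog.assign 0 e) u v (e.cost + 1) :=
  fun s hs => Exec.assign (by simp [h s hs])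

/-- Two subroutines with the same argument. -/
theorem pair (h : Calc ask p u v T) (h' : Calc ask q u w T') :
    Calc ask (Prog.seq (Prog.assign 1 (Expr.reg 0)) (Prog.seq (p.shift 1)
      (Prog.seq (Prog.assign 2 (Expr.reg 0)) (Prog.seq (q.shift 2)
        (Prog.assign 0 (Expr.cons (Expr.reg 1) (Expr.reg 2))))))) u (Val.cons v w)
      (T + T' + 8) := by
  intro s hs
  refine Exec.mono (Exec.seq (mid := fun s => s 0 = u ∧ s 1 = u) (Exec.assign ?_) fun s₁ h₁ =>
    Exec.seq (mid := fun s => s 0 = u ∧ s 1 = v) ((h.call 1 h₁.2).mono le_rfl ?_) fun s₂ h₂ =>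
    Exec.seq (mid := fun s => s 1 = v ∧ s 2 = u) (Exec.assign ?_) fun s₃ h₃ =>
    Exec.seq (mid := fun s => s 1 = v ∧ s 2 = w) ((h'.call 2 h₃.2).mono le_rfl ?_) fun s₄ h₄ =>
    Exec.assign (post := fun s => s 0 = Val.cons v w) ?_) ?_ fun _ h => h
  · simp [Expr.eval, hs]
  · rintro s' ⟨h1, h2⟩
    exact ⟨(h2 0 (by omega)).trans h₁.1, h1⟩
  · simp [Expr.eval, h₂]
  · rintro s' ⟨h1, h2⟩
    exact ⟨(h2 1 (by omega)).trans h₃.1, h1⟩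
  · simp [Expr.eval, h₄]
  · simp [Expr.cost]; omega

/-- Case distinction on the value of a subroutine `r`. -/
theorem cases {r p q : Prog} {x : Val} {T₁ T₂ : ℕ} (hr : Calc ask r u x T₁)
    (hp : ∀ a b, x = Val.cons a b → Calc ask p (Val.cons u (Val.cons a b)) v T₂)
    (hq : x = Val.nil → Calc ask q u v T₂) :
    Calc ask (Prog.seq (Prog.assign 1 (Expr.reg 0)) (Prog.seq (r.shift 1)
      (Prog.cond (Expr.reg 1)
        (Prog.seq (Prog.assign 0 (Expr.cons (Expr.reg 0) (Expr.reg 1))) p) q))) u v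
      (T₁ + T₂ + 8) := by
  intro s hs
  refine Exec.mono (Exec.seq (mid := fun s => s 0 = u ∧ s 1 = u) (Exec.assign ?_) fun s₁ h₁ =>
    Exec.seq (mid := fun s => s 0 = u ∧ s 1 = x) ((hr.call 1 h₁.2).mono le_rfl ?_) fun s₂ h₂ =>
    Exec.cond (T := T₂ + 4) (post := fun s => s 0 = v) (fun he => ?_) (fun he => ?_)) ?_
    fun _ h => h
  · simp [Expr.eval, hs]
  · rintro s' ⟨h1, h2⟩
    exact ⟨(h2 0 (by omega)).trans h₁.1, h1⟩
  · cases hx : x with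
    | nil => exact absurd (h₂.2.trans hx) he
    | cons a b =>
      refine Exec.mono (Exec.seq (mid := fun s => s 0 = Val.cons u (Val.cons a b))
        (Exec.assign ?_) fun s₃ h₃ => hp a b hx s₃ h₃) ?_ fun _ h => h
      · simp [Expr.eval, h₂, hx]
      · simp [Expr.cost]; omega
  · exact (hq (h₂.2.symm.trans he) s₂ h₂.1).mono (by omega) fun _ h => h
  · simp [Expr.cost]; omega

/-- A loop that runs as long as the head of register `0` is not `nil`. -/
theorem loop {N : ℕ} : ∀ {S : ℕ → Val},
    (∀ i < N, (∃ a b c, S i = Val.cons (Val.cons a b) c) ∧ Calc ask p (S i) (S (i + 1)) T) →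
    (∃ c, S N = Val.cons Val.nil c) →
    Calc ask (Prog.loop (Expr.head (Expr.reg 0)) p) (S 0) (S N) (N * (T + 3) + 3) := by
  induction N with
  | zero =>
    rintro S - ⟨c, hc⟩ s hs
    exact ⟨s, _, Run.loopDone (by simp [Expr.eval, hs, hc]), by simp [Expr.cost], hs⟩
  | succ N ih =>
    intro S h₁ h₂ s hs
    obtain ⟨⟨a, b, c, h₀⟩, hp⟩ := h₁ 0 (by omega)
    obtain ⟨s₁, t₁, r₁, ht₁, hs₁⟩ := hp s hs
    obtain ⟨s₂, t₂, r₂, ht₂, hs₂⟩ := ih (S := fun i => S (i + 1))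
      (fun i hi => h₁ (i + 1) (by omega)) h₂ s₁ hs₁
    refine ⟨s₂, _, Run.loopStep (by simp [Expr.eval, hs, h₀]) r₁ r₂, ?_, hs₂⟩
    simp only [Expr.cost]
    rw [Nat.succ_mul]
    omega

end Calc

/-! ### Polynomial-time functions on encoded types -/

/-- An encoding of the elements of a type as trees. -/
class Enc (α : Type) where
  enc : α → Val

open Enc (enc)

instance : Enc Val := ⟨id⟩
instance : Enc Bool := ⟨Val.ofBool⟩
instance : Enc ℕ := ⟨Val.ofNat⟩
instance {α β : Type} [Enc α] [Enc β] : Enc (α × β) := ⟨fun p => Val.cons (enc p.1) (enc p.2)⟩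
instance {α : Type} [Enc α] : Enc (List α) := ⟨fun l => Val.ofList (l.map enc)⟩

/-- The size of the encoding. -/
def sz {α : Type} [Enc α] (a : α) : ℕ := (enc a).size

section sizes

variable {α β : Type} [Enc α] [Enc β]

@[simp] theorem enc_val (v : Val) : enc v = v := rfl
theorem enc_pair (a : α) (b : β) : enc (a, b) = Val.cons (enc a) (enc b) := rfl
theorem enc_nil : enc ([] : List α) = Val.nil := rfl
theorem enc_cons (a : α) (l : List α) : enc (a :: l) = Val.cons (enc a) (enc l) := rfl
theorem enc_list (l : List α) : enc l = Val.ofList (l.map enc) := rfl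
theorem enc_word (w : Word) : enc w = Val.ofWord w := rfl
theorem enc_nat (n : ℕ) : enc n = Val.ofNat n := rfl
theorem enc_succ (n : ℕ) : enc (n + 1) = Val.cons Val.nil (enc n) := by
  simp [enc_nat, Val.ofNat, List.replicate_succ, Val.ofList]
theorem enc_false : enc false = Val.nil := rfl
theorem enc_true : enc true = Val.cons Val.nil Val.nil := rfl

theorem sz_pair (p : α × β) : sz p = sz p.1 + sz p.2 + 1 := rfl
theorem sz_nil : sz ([] : List α) = 1 := rfl
theorem sz_cons (a : α) (l : List α) : sz (a :: l) = sz a + sz l + 1 := rfl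
theorem sz_nat (n : ℕ) : sz n = 2 * n + 1 := by
  induction n with
  | zero => rfl
  | succ n ih =>
    have : sz (n + 1) = 1 + sz n + 1 := by
      simp only [sz, enc_succ, Val.size]
    omega
theorem sz_bool (b : Bool) : sz b ≤ 3 := by cases b <;> decide
theorem sz_val (v : Val) : sz v = v.size := rfl

theorem sz_list (l : List α) : sz l = (l.map fun a => sz a + 1).sum + 1 := by
  induction l with
  | nil => rfl
  | cons a l ih => simp [sz_cons, ih]; omega

theorem length_le_sz (l : List α) : l.length ≤ sz l := by
  induction l with
  | nil => simp
  | cons a l ih => simp [sz_cons]; omega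

theorem sz_le_of_mem {a : α} {l : List α} (h : a ∈ l) : sz a ≤ sz l := by
  induction l with
  | nil => simp at h
  | cons b l ih =>
    rcases List.mem_cons.1 h with rfl | h
    · simp [sz_cons]; omega
    · have := ih h
      simp [sz_cons]; omega

theorem sz_append (l l' : List α) : sz (l ++ l') + 1 = sz l + sz l' := by
  simp [sz_list]; omega

theorem sz_reverse (l : List α) : sz l.reverse = sz l := by
  simp [sz_list]

theorem sz_sublist {l l' : List α} (h : l.Sublist l') : sz l ≤ sz l' := by
  induction h with
  | slnil => exact le_rfl
  | cons a _ ih => simp [sz_cons]; omega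
  | cons_cons a _ ih => simp [sz_cons]; omega

theorem sz_list_le {l : List α} {m : ℕ} (h : ∀ a ∈ l, sz a ≤ m) :
    sz l ≤ l.length * (m + 1) + 1 := by
  induction l with
  | nil => simp [sz_nil]
  | cons a l ih =>
    have h1 := h a (by simp)
    have h2 := ih fun b hb => h b (by simp [hb])
    simp only [sz_cons, List.length_cons, Nat.succ_mul]
    omega

end sizes

/-- The function `g` is bounded by a polynomial in the size of the argument. -/
def PolyBound {α : Type} [Enc α] (g : α → ℕ) : Prop := ∃ d, ∀ a, g a ≤ (sz a + 2) ^ d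

namespace PolyBound

variable {α β : Type} [Enc α] [Enc β]

theorem mono {g h : α → ℕ} (hh : PolyBound h) (hg : ∀ a, g a ≤ h a) : PolyBound g := by
  obtain ⟨d, hd⟩ := hh
  exact ⟨d, fun a => (hg a).trans (hd a)⟩

theorem sz : PolyBound (sz : α → ℕ) := ⟨1, fun a => by simp⟩

theorem const (n : ℕ) : PolyBound (fun _ : α => n) :=
  ⟨n, fun a => (Nat.lt_two_pow_self).le.trans (Nat.pow_le_pow_left (by omega) n)⟩

theorem add {g h : α → ℕ} (hg : PolyBound g) (hh : PolyBound h) :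
    PolyBound (fun a => g a + h a) := by
  obtain ⟨d, hd⟩ := hg
  obtain ⟨e, he⟩ := hh
  refine ⟨d + e + 1, fun a => ?_⟩
  have h2 : 2 ≤ FOLearning.sz a + 2 := by omega
  have h1 := Nat.pow_le_pow_right (show 0 < FOLearning.sz a + 2 by omega) (show d ≤ d + e by omega)
  have h3 := Nat.pow_le_pow_right (show 0 < FOLearning.sz a + 2 by omega) (show e ≤ d + e by omega)
  calc g a + h a ≤ (FOLearning.sz a + 2) ^ (d + e) * 2 := by
        have := hd a; have := he a; omega
    _ ≤ _ := by rw [pow_succ]; exact Nat.mul_le_mul_left _ h2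

theorem mul {g h : α → ℕ} (hg : PolyBound g) (hh : PolyBound h) :
    PolyBound (fun a => g a * h a) := by
  obtain ⟨d, hd⟩ := hg
  obtain ⟨e, he⟩ := hh
  exact ⟨d + e, fun a => by rw [pow_add]; exact Nat.mul_le_mul (hd a) (he a)⟩

theorem comp {g : β → ℕ} {f : α → β} (hg : PolyBound g)
    (hf : PolyBound fun a => FOLearning.sz (f a)) :
    PolyBound (fun a => g (f a)) := by
  obtain ⟨d, hd⟩ := hg
  obtain ⟨e, he⟩ := hf.add (const 2)
  refine ⟨e * d, fun a => (hd _).trans ?_⟩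
  rw [pow_mul]
  exact Nat.pow_le_pow_left (he a) d

end PolyBound

/-- The function is computed in polynomial time by a program that asks no queries, and the size of
its values is polynomially bounded. -/
def PT {α β : Type} [Enc α] [Enc β] (f : α → β) : Prop :=
  ∃ (p : Prog) (T : α → ℕ), PolyBound T ∧ PolyBound (fun a => sz (f a)) ∧
    ∀ ask a, Calc ask p (enc a) (enc (f a)) (T a)

namespace PT

variable {α β γ δ : Type} [Enc α] [Enc β] [Enc γ] [Enc δ]

theorem polyBound {f : α → β} (hf : PT f) : PolyBound (fun a => sz (f a)) :=
  hf.choose_spec.choose_spec.2.1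

theorem of_expr {f : α → β} (e : Expr)
    (h : ∀ a, ∀ s : Store, s 0 = enc a → e.eval s = enc (f a))
    (hs : PolyBound (fun a => sz (f a))) : PT f :=
  ⟨_, fun _ => e.cost + 1, .const _, hs, fun _ a => Calc.expr (h a)⟩

/-- Functions with the same effect on codes as a polynomial-time function. -/
theorem of_enc {f : α → β} {α' β' : Type} [Enc α'] [Enc β'] {f' : α' → β'} (hf' : PT f')
    (i : α → α') (hi : ∀ a, enc (i a) = enc a) (hf : ∀ a, enc (f a) = enc (f' (i a))) : PT f := by
  obtain ⟨p, T, hT, hs, h⟩ := hf'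
  have hz : PolyBound fun a => sz (i a) := PolyBound.sz.mono fun a => by simp [sz, hi]
  refine ⟨p, fun a => T (i a), hT.comp hz, (hs.comp hz).mono fun a => by simp [sz, hf],
    fun ask a => ?_⟩
  rw [hf, ← hi]
  exact h ask (i a)

theorem of_enc_eq {f : α → β} {β' : Type} [Enc β'] {f' : α → β'} (hf' : PT f')
    (hf : ∀ a, enc (f a) = enc (f' a)) : PT f :=
  of_enc hf' id (fun _ => rfl) hf

theorem id : PT (fun a : α => a) := of_expr (.reg 0) (fun _ _ h => h) .sz

theorem comp {g : β → γ} {f : α → β} (hg : PT g) (hf : PT f) : PT (fun a => g (f a)) := by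
  obtain ⟨p, T, hT, hs, h⟩ := hf
  obtain ⟨p', T', hT', hs', h'⟩ := hg
  exact ⟨_, _, hT.add (hT'.comp hs), hs'.comp hs, fun ask a => (h ask a).seq (h' ask (f a))⟩

theorem pair {f : α → β} {g : α → γ} (hf : PT f) (hg : PT g) : PT (fun a => (f a, g a)) := by
  obtain ⟨p, T, hT, hs, h⟩ := hf
  obtain ⟨p', T', hT', hs', h'⟩ := hg
  exact ⟨_, _, (hT.add hT').add (.const 8), (hs.add hs').add (.const 1),
    fun ask a => (h ask a).pair (h' ask a)⟩

theorem fst : PT (fun p : α × β => p.1) :=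
  of_expr (.head (.reg 0)) (fun ⟨x, y⟩ s h => by simp [Expr.eval, h, enc_pair])
    (PolyBound.sz.mono fun a => by rw [sz_pair]; omega)

theorem snd : PT (fun p : α × β => p.2) :=
  of_expr (.tail (.reg 0)) (fun ⟨x, y⟩ s h => by simp [Expr.eval, h, enc_pair])
    (PolyBound.sz.mono fun a => by rw [sz_pair]; omega)

theorem const (b : β) : PT (fun _ : α => b) := by
  have h : ∀ v : Val, ∃ e : Expr, ∀ s, e.eval s = v := by
    intro v
    induction v with
    | nil => exact ⟨.nil, fun _ => rfl⟩
    | cons a b ha hb =>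
      obtain ⟨e, he⟩ := ha
      obtain ⟨e', he'⟩ := hb
      exact ⟨.cons e e', fun s => by simp [Expr.eval, he, he']⟩
  obtain ⟨e, he⟩ := h (enc b)
  exact of_expr e (fun _ s _ => he s) (.const _)

/-- Case distinction on a list. -/
theorem listCases {l : α → List β} {f : α → γ} {g : α → β → List β → γ} (hl : PT l) (hf : PT f)
    (hg : PT (fun x : α × β × List β => g x.1 x.2.1 x.2.2)) :
    PT (fun a => match l a with | [] => f a | b :: bs => g a b bs) := by
  obtain ⟨r, T₀, hT₀, hs₀, h₀⟩ := hl
  obtain ⟨q, T₁, hT₁, hs₁, h₁⟩ := hf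
  obtain ⟨p, T₂, hT₂, hs₂, h₂⟩ := hg
  obtain ⟨d, hd⟩ := hT₂
  obtain ⟨e, he⟩ := hs₂
  have hb := (PolyBound.sz (α := α)).add hs₀ |>.add (.const 3)
  have hpow : ∀ n : ℕ, PolyBound (fun a : α => (sz a + sz (l a) + 3) ^ n) := by
    intro n
    induction n with
    | zero => exact (PolyBound.const 1).mono fun a => by simp
    | succ n ih => exact (ih.mul hb).mono fun a => by rw [pow_succ]
  have hle : ∀ a b bs, l a = b :: bs → sz (a, b, bs) + 2 = sz a + sz (l a) + 3 := by
    intro a b bs h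
    rw [h, sz_pair, sz_pair, sz_cons]
  have hsize : PolyBound (fun a => sz (f a) + (sz a + sz (l a) + 3) ^ e) := hs₁.add (hpow e)
  refine ⟨_, fun a => T₀ a + (T₁ a + (sz a + sz (l a) + 3) ^ d) + 8,
    (hT₀.add (hT₁.add (hpow d))).add (.const 8), hsize.mono fun a => ?_,
    fun ask a => Calc.cases (p := p) (q := q) (h₀ ask a) (fun x y hx => ?_) (fun hx => ?_)⟩
  · dsimp only
    cases h : l a with
    | nil => exact Nat.le_add_right _ _
    | cons b bs =>
      have := he (a, b, bs)
      rw [hle a b bs h, h] at this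
      exact this.trans (Nat.le_add_left _ _)
  · dsimp only
    cases h : l a with
    | nil => rw [h, enc_nil] at hx; cases hx
    | cons b bs =>
      rw [h, enc_cons] at hx
      cases hx
      have := hd (a, b, bs)
      rw [hle a b bs h, h] at this
      exact (h₂ ask (a, b, bs)).mono (this.trans (Nat.le_add_left _ _))
  · dsimp only
    cases h : l a with
    | nil => exact (h₁ ask a).mono (Nat.le_add_right _ _)
    | cons b bs => rw [h, enc_cons] at hx; cases hx

/-- Folding over a list, if each step increases the size only by a bounded amount. -/
theorem foldl {l : α → List β} {f : α → γ} {g : α → γ → β → γ} (hl : PT l) (hf : PT f)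
    (hg : PT (fun x : α × γ × β => g x.1 x.2.1 x.2.2)) {G : α → ℕ} (hG : PolyBound G)
    (hsz : ∀ a c, ∀ b ∈ l a, sz (g a c b) ≤ sz c + G a) :
    PT (fun a => (l a).foldl (g a) (f a)) := by
  obtain ⟨p, T, ⟨d, hT⟩, -, h⟩ := hg
  have hstart := (hl.pair (id.pair hf))
  have hbound : ∀ a, ∀ l' : List β, (∀ b ∈ l', b ∈ l a) → ∀ c,
      sz (l'.foldl (g a) c) ≤ sz c + l'.length * G a := by
    intro a l'
    induction l' with
    | nil => intro _ c; simp
    | cons b l' ih =>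
      intro hm c
      have h1 := ih (fun b hb => hm b (by simp [hb])) (g a c b)
      have h2 := hsz a c b (hm b (by simp))
      simp only [List.foldl_cons, List.length_cons, Nat.succ_mul]
      omega
  let B : α → ℕ := fun a => sz a + (sz (f a) + sz (l a) * G a) + sz (l a) + 4
  have hB : PolyBound B := by
    exact ((PolyBound.sz.add (hf.polyBound.add (hl.polyBound.mul hG))).add hl.polyBound).add
      (.const 4)
  have hBpow : PolyBound (fun a : α => B a ^ d) := by
    generalize d = n
    induction n with
    | zero => exact (PolyBound.const 1).mono fun a => by simp
    | succ n ih => exact (ih.mul hB).mono fun a => by rw [pow_succ]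
  have hlast : PT (fun x : List β × α × γ => x.2.2) := snd.comp snd
  obtain ⟨p₀, T₀, hT₀, hs₀, h₀⟩ := hstart
  -- in the loop, register `0` holds the rest of the list, the argument and the accumulator.
  let body : Prog := .seq (.assign 1 (.cons (.head (.tail (.reg 0)))
      (.cons (.tail (.tail (.reg 0))) (.head (.head (.reg 0))))))
    (.seq (p.shift 1) (.assign 0 (.cons (.tail (.head (.reg 0)))
      (.cons (.head (.tail (.reg 0))) (.reg 1)))))
  refine ⟨.seq p₀ (.seq (.loop (.head (.reg 0)) body) (.assign 0 (.tail (.tail (.reg 0))))),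
    fun a => T₀ a + (((l a).length * (B a ^ d + 22 + 3) + 3) + 4),
    hT₀.add ((((hl.polyBound.mono fun a => length_le_sz _).mul
      ((hBpow.add (.const 22)).add (.const 3))).add (.const 3)).add (.const 4)),
    (hf.polyBound.add (hl.polyBound.mul hG)).mono fun a =>
      (hbound a (l a) (fun _ h => h) (f a)).trans (by
        gcongr; exact length_le_sz _), fun ask a => ?_⟩
  refine (h₀ ask a).seq (Calc.seq (v := enc (([] : List β), a, (l a).foldl (g a) (f a))) ?_
    (Calc.expr fun s hs => ?_))
  · have := Calc.loop (ask := ask) (p := body) (N := (l a).length) (T := B a ^ d + 22)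
      (S := fun i => enc ((l a).drop i, a, ((l a).take i).foldl (g a) (f a)))
      (fun i hi => ⟨?_, ?_⟩) ⟨enc (a, (l a).foldl (g a) (f a)), by simp [enc_pair, enc_nil]⟩
    · simpa using this
    · rw [List.drop_eq_getElem_cons hi]
      exact ⟨_, _, _, rfl⟩
    · have hd := List.drop_eq_getElem_cons hi
      have ht : ((l a).take (i + 1)).foldl (g a) (f a) =
          g a (((l a).take i).foldl (g a) (f a)) (l a)[i] := by
        rw [List.take_add_one, List.foldl_append]; simp [hi]
      set c := ((l a).take i).foldl (g a) (f a) with hc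
      rw [hd, ht]
      intro s hs
      have hcall := h ask (a, c, (l a)[i])
      refine Exec.mono (Exec.seq (mid := fun s => s 0 = enc ((l a)[i] :: (l a).drop (i + 1), a, c) ∧
          s 1 = enc (a, c, (l a)[i])) (Exec.assign ?_) fun s₁ h₁ =>
        Exec.seq (mid := fun s => s 0 = enc ((l a)[i] :: (l a).drop (i + 1), a, c) ∧
          s 1 = enc (g a c (l a)[i])) ((hcall.call 1 h₁.2).mono le_rfl ?_) fun s₂ h₂ =>
        Exec.assign ?_) ?_ fun _ h => h
      · simp [Expr.eval, hs, enc_pair, enc_cons, -List.getElem_cons_drop]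
      · rintro s' ⟨h1, h2⟩
        exact ⟨(h2 0 (by omega)).trans h₁.1, h1⟩
      · simp [Expr.eval, h₂, enc_pair, enc_cons, -List.getElem_cons_drop]
      · have h1 := hT (a, c, (l a)[i])
        have h2 : sz (a, c, (l a)[i]) + 2 ≤ B a := by
          have h3 := hbound a ((l a).take i) (fun b hb => List.mem_of_mem_take hb) (f a)
          have h4 := sz_le_of_mem (List.getElem_mem hi)
          have h5 : ((l a).take i).length * G a ≤ sz (l a) * G a := by
            gcongr
            exact (List.length_take_le' _ _).trans (length_le_sz _)
          simp only [sz_pair, B]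
          simp only [← hc] at h3
          omega
        have h3 := h1.trans (Nat.pow_le_pow_left h2 d)
        simp [Expr.cost]
        omega
  · simp [Expr.eval, hs, enc_pair]

end PT

/-! ### A library of polynomial-time functions -/

attribute [fun_prop] PT PT.id PT.const PT.comp PT.pair PT.fst PT.snd

/-- The first component of a tree, `nil` for `nil`. -/
def Val.head : Val → Val
  | nil => nil
  | cons a _ => a

/-- The second component of a tree, `nil` for `nil`. -/
def Val.tail : Val → Val
  | nil => nil
  | cons _ b => b

theorem enc_list_val (l : List Val) : enc l = Val.ofList l := by
  change Val.ofList (l.map id) = _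
  rw [List.map_id]

namespace PT

variable {α β γ δ : Type} [Enc α] [Enc β] [Enc γ] [Enc δ]

@[fun_prop]
theorem valHead : PT Val.head :=
  of_expr (.head (.reg 0)) (fun v s h => by cases v <;> simp [Expr.eval, h, Val.head])
    (PolyBound.sz.mono fun v => by cases v <;> simp [sz_val, Val.head, Val.size]; omega)

@[fun_prop]
theorem valTail : PT Val.tail :=
  of_expr (.tail (.reg 0)) (fun v s h => by cases v <;> simp [Expr.eval, h, Val.tail])
    (PolyBound.sz.mono fun v => by cases v <;> simp [sz_val, Val.tail, Val.size]; omega)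

@[fun_prop]
theorem valCons {f g : α → Val} (hf : PT f) (hg : PT g) : PT (fun a => Val.cons (f a) (g a)) :=
  of_enc_eq (hf.pair hg) fun _ => rfl

@[fun_prop]
theorem encode : PT (enc : α → Val) := of_enc_eq PT.id fun _ => rfl

@[fun_prop]
theorem valToList : PT Val.toList :=
  of_enc_eq PT.id fun v => by simp [enc_list_val]

@[fun_prop]
theorem valOfList : PT Val.ofList :=
  of_enc_eq PT.id fun v => by simp [enc_list_val]

@[fun_prop]
theorem cons {f : α → β} {g : α → List β} (hf : PT f) (hg : PT g) : PT (fun a => f a :: g a) :=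
  of_enc_eq (hf.pair hg) fun _ => rfl

@[fun_prop]
theorem cond {c : α → Bool} {f g : α → β} (hc : PT c) (hf : PT f) (hg : PT g) :
    PT (fun a => cond (c a) (f a) (g a)) := by
  have h : PT (fun a => if c a then [Val.nil] else []) :=
    of_enc_eq hc fun a => by cases h : c a <;> rfl
  have := listCases (f := g) (g := fun a _ _ => f a) h hg (by fun_prop)
  refine of_enc_eq this fun a => ?_
  cases c a <;> rfl

@[fun_prop]
theorem and {c d : α → Bool} (hc : PT c) (hd : PT d) : PT (fun a => c a && d a) :=
  of_enc_eq (PT.cond hc hd (PT.const false)) fun a => by cases c a <;> rfl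

@[fun_prop]
theorem or {c d : α → Bool} (hc : PT c) (hd : PT d) : PT (fun a => c a || d a) :=
  of_enc_eq (PT.cond hc (PT.const true) hd) fun a => by cases c a <;> rfl

@[fun_prop]
theorem not {c : α → Bool} (hc : PT c) : PT (fun a => !(c a)) :=
  of_enc_eq (PT.cond hc (PT.const false) (PT.const true)) fun a => by cases c a <;> rfl

@[fun_prop]
theorem boolBEq {c d : α → Bool} (hc : PT c) (hd : PT d) : PT (fun a => c a == d a) :=
  of_enc_eq (PT.cond hc hd hd.not) fun a => by cases c a <;> cases d a <;> rfl

@[fun_prop]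
theorem listTail {l : α → List β} (hl : PT l) : PT (fun a => (l a).tail) :=
  of_enc_eq (f' := fun a => (enc (l a)).tail) (by fun_prop) fun a => by cases l a <;> rfl

@[fun_prop]
theorem isEmpty {l : α → List β} (hl : PT l) : PT (fun a => (l a).isEmpty) := by
  have := listCases (f := fun _ => true) (g := fun _ _ _ => false) hl (by fun_prop) (by fun_prop)
  exact of_enc_eq this fun a => by cases l a <;> rfl

@[fun_prop]
theorem headD {l : α → List β} {d : α → β} (hl : PT l) (hd : PT d) :
    PT (fun a => (l a).headD (d a)) := by
  have := listCases (g := fun _ b _ => b) hl hd (by fun_prop)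
  exact of_enc_eq this fun a => by cases l a <;> rfl

@[fun_prop]
theorem reverse {l : α → List β} (hl : PT l) : PT (fun a => (l a).reverse) := by
  have h := foldl (f := fun _ => ([] : List β)) (g := fun _ c b => b :: c) hl (by fun_prop)
    (by fun_prop) (G := fun a => sz (l a) + 1) (hl.polyBound.add (.const 1)) fun a c b hb => by
      have := sz_le_of_mem hb
      rw [sz_cons]; omega
  refine of_enc_eq h fun a => ?_
  congr 1
  simp

@[fun_prop]
theorem map {l : α → List β} {g : α → β → γ} (hl : PT l) (hg : PT (fun x : α × β => g x.1 x.2)) :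
    PT (fun a => (l a).map (g a)) := by
  obtain ⟨d, hd⟩ := hg.polyBound
  have hB : PolyBound fun a => sz a + sz (l a) + 3 :=
    (PolyBound.sz.add hl.polyBound).add (.const 3)
  have hBpow : PolyBound (fun a : α => (sz a + sz (l a) + 3) ^ d) := by
    generalize d = n
    induction n with
    | zero => exact (PolyBound.const 1).mono fun a => by simp
    | succ n ih => exact (ih.mul hB).mono fun a => by rw [pow_succ]
  have h := foldl (f := fun _ => ([] : List γ)) (g := fun a c b => g a b :: c) hl (by fun_prop)
    (cons (hg.comp (by fun_prop : PT fun x : α × List γ × β => (x.1, x.2.2))) (by fun_prop))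
    (G := fun a => (sz a + sz (l a) + 3) ^ d + 1) (hBpow.add (.const 1)) fun a c b hb => by
      have h1 := sz_le_of_mem hb
      have h2 := hd (a, b)
      have h3 := Nat.pow_le_pow_left (show sz (a, b) + 2 ≤ sz a + sz (l a) + 3 by
        rw [sz_pair]; simp only; omega) d
      rw [sz_cons]
      simp only at h2
      omega
  refine of_enc_eq h.reverse fun a => ?_
  congr 1
  have : ∀ l' : List β, ∀ c, l'.foldl (fun c b => g a b :: c) c = (l'.map (g a)).reverse ++ c := by
    intro l'
    induction l' with
    | nil => simp
    | cons b l' ih => intro c; simp [ih]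
  simp [this]

@[fun_prop]
theorem append {l l' : α → List β} (hl : PT l) (hl' : PT l') : PT (fun a => l a ++ l' a) := by
  have h := foldl (g := fun _ c b => b :: c) hl.reverse hl'
    (by fun_prop) (G := fun a => sz (l a) + 1) (hl.polyBound.add (.const 1)) fun a c b hb => by
      have := sz_le_of_mem hb
      rw [sz_reverse] at this
      rw [sz_cons]; omega
  refine of_enc_eq h fun a => ?_
  congr 1
  have : ∀ l' : List β, ∀ c, l'.foldl (fun c b => b :: c) c = l'.reverse ++ c := by
    intro l'
    induction l' with
    | nil => simp
    | cons b l' ih => intro c; simp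
  simp [this]

@[fun_prop]
theorem filter {l : α → List β} {g : α → β → Bool} (hl : PT l)
    (hg : PT (fun x : α × β => g x.1 x.2)) : PT (fun a => (l a).filter (g a)) := by
  have h := foldl (f := fun _ => ([] : List β)) (g := fun a c b => bif g a b then b :: c else c)
    hl (by fun_prop)
    (cond (hg.comp (by fun_prop : PT fun x : α × List β × β => (x.1, x.2.2))) (by fun_prop)
      (by fun_prop))
    (G := fun a => sz (l a) + 1) (hl.polyBound.add (.const 1)) fun a c b hb => by
      have := sz_le_of_mem hb
      cases g a b <;> simp [sz_cons]; omega
  refine of_enc_eq h.reverse fun a => ?_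
  congr 1
  have : ∀ l' : List β, ∀ c, l'.foldl (fun c b => bif g a b then b :: c else c) c =
      (l'.filter (g a)).reverse ++ c := by
    intro l'
    induction l' with
    | nil => simp
    | cons b l' ih => intro c; cases h : g a b <;> simp [ih, h]
  simp [this]

@[fun_prop]
theorem any {l : α → List β} {g : α → β → Bool} (hl : PT l)
    (hg : PT (fun x : α × β => g x.1 x.2)) : PT (fun a => (l a).any (g a)) := by
  have : PT (fun a => !((l a).filter (g a)).isEmpty) := by fun_prop
  refine of_enc_eq this fun a => ?_
  congr 1
  rw [Bool.eq_iff_iff]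
  simp

@[fun_prop]
theorem all {l : α → List β} {g : α → β → Bool} (hl : PT l)
    (hg : PT (fun x : α × β => g x.1 x.2)) : PT (fun a => (l a).all (g a)) := by
  have : PT (fun a => !(l a).any fun b => !(g a b)) := by fun_prop
  refine of_enc_eq this fun a => ?_
  congr 1
  rw [Bool.eq_iff_iff]
  simp

@[fun_prop]
theorem flatten {l : α → List (List β)} (hl : PT l) : PT (fun a => (l a).flatten) := by
  have h := foldl (f := fun _ => ([] : List β)) (g := fun _ c b => c ++ b) hl (by fun_prop)
    (by fun_prop) (G := fun a => sz (l a)) hl.polyBound fun a c b hb => by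
      have h1 := sz_le_of_mem hb
      have h2 := sz_append c b
      omega
  refine of_enc_eq h fun a => ?_
  congr 1
  have : ∀ l' : List (List β), ∀ c, l'.foldl (fun c b => c ++ b) c = c ++ l'.flatten := by
    intro l'
    induction l' with
    | nil => simp
    | cons b l' ih => intro c; simp [ih]
  simp [this]

@[fun_prop]
theorem flatMap {l : α → List β} {g : α → β → List γ} (hl : PT l)
    (hg : PT (fun x : α × β => g x.1 x.2)) : PT (fun a => (l a).flatMap (g a)) := by
  have : PT (fun a => ((l a).map (g a)).flatten) := by fun_prop
  exact of_enc_eq this fun a => by rw [List.flatMap_def]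

@[fun_prop]
theorem length {l : α → List β} (hl : PT l) : PT (fun a => (l a).length) := by
  have : PT (fun a => (l a).map fun _ => Val.nil) := by fun_prop
  refine of_enc_eq this fun a => ?_
  simp [enc_nat, enc_list, Val.ofNat, List.map_const']

@[fun_prop]
theorem replicate {n : α → ℕ} {f : α → β} (hn : PT n) (hf : PT f) :
    PT (fun a => List.replicate (n a) (f a)) := by
  have h1 : PT (fun a => List.replicate (n a) Val.nil) :=
    of_enc_eq hn fun a => by simp [enc_nat, enc_list, Val.ofNat]
  have : PT (fun a => (List.replicate (n a) Val.nil).map fun _ => f a) := by fun_prop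
  exact of_enc_eq this fun a => by simp

@[fun_prop]
theorem add {f g : α → ℕ} (hf : PT f) (hg : PT g) : PT (fun a => f a + g a) := by
  have : PT (fun a => (List.replicate (f a) Val.nil ++ List.replicate (g a) Val.nil).length) := by
    fun_prop
  exact of_enc_eq this fun a => by simp

@[fun_prop]
theorem mul {f g : α → ℕ} (hf : PT f) (hg : PT g) : PT (fun a => f a * g a) := by
  have : PT (fun a => ((List.replicate (f a) Val.nil).flatMap fun _ =>
      List.replicate (g a) Val.nil).length) := by fun_prop
  refine of_enc_eq this fun a => ?_
  simp [List.length_flatMap]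

@[fun_prop]
theorem drop {n : α → ℕ} {l : α → List β} (hn : PT n) (hl : PT l) :
    PT (fun a => (l a).drop (n a)) := by
  have h1 : PT (fun a => List.replicate (n a) Val.nil) := by fun_prop
  have h := foldl (g := fun _ c _ => c.tail) h1 hl (by fun_prop) (G := fun _ => 0) (.const 0)
    fun a c b hb => (sz_sublist (List.tail_sublist c)).trans (by simp)
  refine of_enc_eq h fun a => ?_
  congr 1
  have : ∀ n : ℕ, ∀ c : List β, (List.replicate n Val.nil).foldl (fun c _ => c.tail) c =
      c.drop n := by
    intro n
    induction n with
    | zero => simp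
    | succ n ih => intro c; simp [List.replicate_succ, ih]
  rw [this]

@[fun_prop]
theorem getD {n : α → ℕ} {l : α → List β} {d : α → β} (hl : PT l) (hn : PT n) (hd : PT d) :
    PT (fun a => (l a).getD (n a) (d a)) := by
  have : PT (fun a => ((l a).drop (n a)).headD (d a)) := by fun_prop
  refine of_enc_eq this fun a => ?_
  congr 1
  rw [List.getD_eq_getElem?_getD, List.headD_eq_head?_getD, List.head?_drop]

@[fun_prop]
theorem sub {f g : α → ℕ} (hf : PT f) (hg : PT g) : PT (fun a => f a - g a) := by
  have : PT (fun a => ((List.replicate (f a) Val.nil).drop (g a)).length) := by fun_prop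
  exact of_enc_eq this fun a => by simp

@[fun_prop]
theorem natBeqZero {f : α → ℕ} (hf : PT f) : PT (fun a => decide (f a = 0)) := by
  have : PT (fun a => (List.replicate (f a) Val.nil).isEmpty) := by fun_prop
  exact of_enc_eq this fun a => by simp

@[fun_prop]
theorem natLt {f g : α → ℕ} (hf : PT f) (hg : PT g) : PT (fun a => decide (f a < g a)) := by
  have : PT (fun a => !decide (g a - f a = 0)) := by fun_prop
  refine of_enc_eq this fun a => ?_
  congr 1
  rw [Bool.eq_iff_iff]
  simp; omega

@[fun_prop]
theorem range {f : α → ℕ} (hf : PT f) : PT (fun a => List.range (f a)) := by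
  have h1 : PT (fun a => List.replicate (f a) Val.nil) := by fun_prop
  have h := foldl (f := fun _ => ([] : List ℕ))
    (g := fun a c _ => bif decide (c.length < f a) then c.length :: c else c)
    h1 (by fun_prop) (by fun_prop) (G := fun a => 2 * f a + 2)
    (((PolyBound.const 1).add hf.polyBound).mono fun a => by rw [sz_nat]; omega)
    fun a c _ _ => by
      by_cases h : c.length < f a
      · simp [h, sz_cons, sz_nat]; omega
      · simp [h]
  refine of_enc_eq h.reverse fun a => ?_
  congr 1
  have : ∀ n ≤ f a, (List.replicate n Val.nil).foldl
      (fun c _ => bif decide (c.length < f a) then c.length :: c else c) [] =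
        (List.range n).reverse := by
    intro n
    induction n with
    | zero => simp
    | succ n ih =>
      intro hn
      rw [List.replicate_succ', List.foldl_append, ih (by omega)]
      simp [List.range_succ, Nat.lt_of_succ_le hn]
  rw [this _ le_rfl, List.reverse_reverse]

/-- Running a step function on a worklist until the worklist is empty. -/
theorem loop {step : List β × γ → List β × γ} (hs : PT step) {f : α → List β × γ} (hf : PT f)
    {N B : α → ℕ} (hN : PolyBound N) (hB : PolyBound B)
    (hlt : ∀ a, ∀ i < N a, (step^[i] (f a)).1 ≠ []) (hend : ∀ a, (step^[N a] (f a)).1 = [])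
    (hsz : ∀ a, ∀ i ≤ N a, sz (step^[i] (f a)) ≤ B a) :
    PT (fun a => (step^[N a] (f a)).2) := by
  obtain ⟨p, T, ⟨d, hT⟩, -, h⟩ := hs
  obtain ⟨p₀, T₀, hT₀, hs₀, h₀⟩ := hf
  have hBpow : PolyBound (fun a : α => (B a + 2) ^ d) := by
    generalize d = n
    induction n with
    | zero => exact (PolyBound.const 1).mono fun a => by simp
    | succ n ih => exact (ih.mul (hB.add (.const 2))).mono fun a => by rw [pow_succ]
  refine ⟨.seq p₀ (.seq (.loop (.head (.reg 0)) p) (.assign 0 (.tail (.reg 0)))),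
    fun a => T₀ a + ((N a * ((B a + 2) ^ d + 3) + 3) + 3),
    hT₀.add (((hN.mul (hBpow.add (.const 3))).add (.const 3)).add (.const 3)),
    hB.mono fun a => (show sz (step^[N a] (f a)).2 ≤ sz (step^[N a] (f a)) by
      rw [sz_pair (step^[N a] (f a))]; omega).trans (hsz a _ le_rfl),
    fun ask a => (h₀ ask a).seq (Calc.seq (v := enc (step^[N a] (f a))) ?_
      (Calc.expr fun s hs => ?_))⟩
  · have := Calc.loop (ask := ask) (p := p) (N := N a) (T := (B a + 2) ^ d)
      (S := fun i => enc (step^[i] (f a))) (fun i hi => ⟨?_, ?_⟩) ?_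
    · simpa using this
    · have := hlt a i hi
      rcases h : step^[i] (f a) with ⟨l, c⟩
      rw [h] at this
      rcases l with - | ⟨b, l⟩
      · exact absurd rfl this
      · exact ⟨_, _, _, rfl⟩
    · simp only [Function.iterate_succ_apply']
      exact (h ask _).mono ((hT _).trans (Nat.pow_le_pow_left (by
        have := hsz a i hi.le; omega) d))
    · have := hend a
      rcases h : step^[N a] (f a) with ⟨l, c⟩
      rw [h] at this
      subst this
      exact ⟨enc c, by simp [enc_pair, enc_nil]⟩
  · rcases h : step^[N a] (f a) with ⟨l, c⟩
    rw [h] at hs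
    simp [Expr.eval, hs, h, enc_pair]

end PT

/-! ### Parsing and comparing trees -/

namespace Val

/-- One step of the parser, which reads a word from right to left and keeps a stack, represented
as a tree, of the trees read so far. -/
def parseStep (st : Val) (b : Bool) : Val :=
  bif b then cons (cons st.head st.tail.head) st.tail.tail else cons nil st

/-- The tree with a given code. Words that are not a code give arbitrary trees. -/
def parse (w : Word) : Val := (w.reverse.foldl parseStep nil).head

theorem foldl_parseStep (v st : Val) : v.toWord.reverse.foldl parseStep st = cons v st := by
  induction v generalizing st with
  | nil => rfl
  | cons a b ha hb => simp [toWord, List.foldl_append, ha, hb, parseStep, head, tail]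

@[simp] theorem parse_toWord (v : Val) : parse v.toWord = v := by
  simp only [parse, foldl_parseStep, head]

theorem toWord_injective : Function.Injective toWord :=
  Function.LeftInverse.injective parse_toWord

theorem ofNat_injective : Function.Injective ofNat := fun m n h => by
  have := congrArg List.length (ofList_injective h)
  simpa using this

theorem ofBool_injective : Function.Injective ofBool := fun a b h => by
  cases a <;> cases b <;> simp [ofBool] at h ⊢

theorem ofWord_injective : Function.Injective ofWord :=
  ofList_injective.comp (List.map_injective_iff.2 ofBool_injective)

/-- One step of the computation of the code of a tree: a stack of trees that are still to be
written, and the reverse of the word written so far. -/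
def toWordStep (s : List Val × Word) : List Val × Word :=
  match s.1 with
  | [] => ([], s.2)
  | v :: st => bif decide (v.toList.length = 0) then (st, false :: s.2)
      else (v.head :: v.tail :: st, true :: s.2)

theorem toWordStep_nil (st : List Val) (w : Word) :
    toWordStep (nil :: st, w) = (st, false :: w) := rfl

theorem toWordStep_cons (a b : Val) (st : List Val) (w : Word) :
    toWordStep (cons a b :: st, w) = (a :: b :: st, true :: w) := rfl

theorem iterate_toWordStep (v : Val) : ∀ (st : List Val) (w : Word),
    toWordStep^[v.size] (v :: st, w) = (st, v.toWord.reverse ++ w) := by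
  induction v with
  | nil => intro st w; rfl
  | cons a b ha hb =>
    intro st w
    have : (cons a b).size = b.size + (a.size + 1) := by simp [size]; omega
    rw [this, Function.iterate_add_apply, Function.iterate_add_apply]
    simp [toWordStep_cons, ha, hb, toWord]

/-- Bounds for the size of the stack and the length of the output after `i` steps. -/
theorem toWordStep_invariant (v : Val) (i : ℕ) (hi : i ≤ v.size) :
    ((toWordStep^[i] ([v], [])).1.map size).sum + i = v.size ∧
      (toWordStep^[i] ([v], [])).2.length = i := by
  induction i with
  | zero => simp
  | succ i ih =>
    obtain ⟨h1, h2⟩ := ih (by omega)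
    rw [Function.iterate_succ_apply']
    rcases h : toWordStep^[i] ([v], []) with ⟨st, w⟩
    rw [h] at h1 h2
    rcases st with - | ⟨u, st⟩
    · simp at h1; omega
    · cases u with
      | nil => simp [toWordStep_nil, size] at h1 h2 ⊢; omega
      | cons a b => simp [toWordStep_cons, size] at h1 h2 ⊢; omega

end Val

namespace PT

variable {α β γ δ : Type} [Enc α] [Enc β] [Enc γ] [Enc δ]

@[fun_prop]
theorem parse : PT Val.parse := by
  have := foldl (l := fun w : Word => w.reverse) (f := fun _ => Val.nil)
    (g := fun _ => Val.parseStep) (by fun_prop) (by fun_prop)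
    (by unfold Val.parseStep; fun_prop) (G := fun _ => 4) (.const 4) fun _ c b _ => by
      simp only [sz_val]
      cases b
      · simp [Val.parseStep, Val.size]; omega
      · rcases c with - | ⟨c, - | ⟨d, e⟩⟩ <;>
          simp [Val.parseStep, Val.size, Val.head, Val.tail]
        omega
  exact valHead.comp this

theorem sz_word (w : Word) : sz w ≤ 4 * w.length + 1 := by
  have := sz_list_le (l := w) (m := 3) fun b _ => sz_bool b
  omega

@[fun_prop]
theorem toWord : PT Val.toWord := by
  have hstep : PT Val.toWordStep := by
    have := listCases (l := fun s : List Val × Word => s.1) (f := fun s => (([] : List Val), s.2))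
      (g := fun s v st => bif decide (v.toList.length = 0) then (st, false :: s.2)
        else (v.head :: v.tail :: st, true :: s.2)) (by fun_prop) (by fun_prop) (by fun_prop)
    refine of_enc_eq this fun s => ?_
    rcases s with ⟨- | ⟨v, st⟩, w⟩ <;> rfl
  have h := loop hstep (f := fun v : Val => ([v], ([] : Word))) (by fun_prop) (N := Val.size)
    (B := fun v => 6 * v.size + 3) PolyBound.sz
    (((PolyBound.const 6).mul PolyBound.sz).add (.const 3)) ?_ ?_ ?_
  · refine of_enc_eq h.reverse fun v => ?_
    rw [Val.iterate_toWordStep]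
    simp
  · intro v i hi h0
    have := (Val.toWordStep_invariant v i hi.le).1
    rw [h0] at this
    simp at this
    omega
  · intro v
    rw [Val.iterate_toWordStep]
  · intro v i hi
    obtain ⟨h1, h2⟩ := Val.toWordStep_invariant v i hi
    rcases h : Val.toWordStep^[i] ([v], []) with ⟨st, w⟩
    rw [h] at h1 h2
    simp only at h1 h2
    have h3 := sz_word w
    have h4 : ∀ st : List Val, sz st ≤ 2 * (st.map Val.size).sum + 1 := by
      intro st
      induction st with
      | nil => simp [sz_nil]
      | cons a st ih =>
        have := a.one_le_size
        simp only [sz_cons, sz_val, List.map_cons, List.sum_cons]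
        omega
    have h5 := h4 st
    have h6 := sz_pair (st, w)
    simp only at h6
    omega

end PT

open Classical in
/-- The test whether two elements have the same code. -/
noncomputable def encEq {α β : Type} [Enc α] [Enc β] (a : α) (b : β) : Bool :=
  decide (enc a = enc b)

theorem encEq_iff {α β : Type} [Enc α] [Enc β] {a : α} {b : β} :
    encEq a b = true ↔ enc a = enc b := by
  simp [encEq]

theorem enc_nat_inj {m n : ℕ} : enc m = enc n ↔ m = n := Val.ofNat_injective.eq_iff

theorem enc_word_inj {m n : Word} : enc m = enc n ↔ m = n := Val.ofWord_injective.eq_iff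

theorem enc_list_inj {α : Type} [Enc α] (h : Function.Injective (enc : α → Val)) {l l' : List α} :
    enc l = enc l' ↔ l = l' :=
  (Val.ofList_injective.comp (List.map_injective_iff.2 h)).eq_iff

theorem enc_pair_inj {α β : Type} [Enc α] [Enc β] {p q : α × β} :
    enc p = enc q ↔ enc p.1 = enc q.1 ∧ enc p.2 = enc q.2 := by
  change Val.cons _ _ = Val.cons _ _ ↔ _
  simp

namespace PT

variable {α β γ δ : Type} [Enc α] [Enc β] [Enc γ] [Enc δ]

/-- Comparison of a word with the rest of another one, letter by letter. -/
theorem foldl_compare (u : Word) : ∀ (v : Word) (c : Bool),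
    (let s := u.foldl (fun (s : Word × Bool) b =>
      (s.1.tail, s.2 && (!s.1.isEmpty && (b == s.1.headD false)))) (v, c)
     s.2 && s.1.isEmpty) = true ↔ c = true ∧ u = v := by
  induction u with
  | nil => intro v c; cases v <;> simp
  | cons b u ih =>
    intro v c
    rw [List.foldl_cons]
    rw [ih]
    cases v with
    | nil => simp
    | cons d v => simp [and_assoc]

@[fun_prop]
theorem encEq {f : α → β} {g : α → γ} (hf : PT f) (hg : PT g) :
    PT (fun a => encEq (f a) (g a)) := by
  have := foldl (l := fun a : α => (enc (f a)).toWord)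
    (f := fun a => ((enc (g a)).toWord, true))
    (g := fun _ s b => (s.1.tail, s.2 && (!s.1.isEmpty && (b == s.1.headD false))))
    (by fun_prop) (by fun_prop) (by fun_prop) (G := fun _ => 3) (.const 3) fun _ c b _ => by
      have h1 := sz_sublist (List.tail_sublist c.1)
      rw [sz_pair, sz_pair c]
      have h2 := sz_bool (c.2 && (!c.1.isEmpty && (b == c.1.headD false)))
      simp only
      omega
  have h2 := (snd.comp this).and (fst.comp this).isEmpty
  refine of_enc_eq h2 fun a => ?_
  congr 1
  rw [Bool.eq_iff_iff, encEq_iff, foldl_compare]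
  simp [Val.toWord_injective.eq_iff]

end PT

/-! ### The algorithm -/

/-- The number encoded by a tree, by its length. -/
def Val.natOf (v : Val) : ℕ := v.toList.length

/-- The bit encoded by a tree. -/
def Val.boolOf (v : Val) : Bool := !v.toList.isEmpty

/-- The code of the formula of depth `t` that is obtained by reading a tree as the code of such a
formula. Codes of formulas are exactly the fixed points. -/
def normForm : ℕ → Val → Val
  | 0, v => Val.ofList [Val.ofNat v.head.natOf, Val.ofNat v.tail.head.natOf,
      Val.ofBool v.tail.tail.head.boolOf]
  | t + 1, v => Val.ofList (v.toList.map (normForm t))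

/-- All variables of the encoded formula occur in the blocks. -/
def wfForm (bs : List (ℕ × ℕ)) : ℕ → Val → Bool
  | 0, v => decide (v.tail.head.natOf < (bs.getD v.head.natOf (0, 0)).1)
  | t + 1, v => v.toList.all (wfForm bs t)

/-- The coloured vertex that represents the variable number `j` of block number `i`. Vertices are
pairs of a colour and a content. The colours up to `T + 1` belong to subformulas. -/
def varVertex (T : ℕ) (i j : Val) : ℕ × Val := (T + 2 + i.natOf, Val.cons i j)

/-- The truth value of an encoded formula, when the variables represented by the vertices in `ch`
are true. The outermost connective is a conjunction for `true` and a disjunction for `false`. -/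
noncomputable def evalForm (T : ℕ) (ch : List (ℕ × Val)) : ℕ → Bool → Val → Bool
  | 0, _, v => (ch.any fun u => encEq u (varVertex T v.head v.tail.head)) == v.tail.tail.head.boolOf
  | t + 1, true, v => v.toList.all (evalForm T ch t false)
  | t + 1, false, v => v.toList.any (evalForm T ch t true)

/-- The vertices that represent the subformulas of an encoded formula. Literals have colour `0` or
`1` according to their sign, and subformulas of depth `s + 1` have colour `s + 2`. -/
def nodes : ℕ → Val → List (ℕ × Val)
  | 0, v => [(bif v.tail.tail.head.boolOf then 0 else 1, v)]
  | s + 1, v => (s + 2, v) :: v.toList.flatMap (nodes s)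

/-- The vertices that represent the variables. -/
def varList (T : ℕ) (bs : List (ℕ × ℕ)) : List (ℕ × Val) :=
  (List.range bs.length).flatMap fun i => (List.range (bs.getD i (0, 0)).1).map fun j =>
    varVertex T (enc i) (enc j)

/-- The list of all vertices. The root of the formula is the first one. -/
def vertexList (T : ℕ) (bs : List (ℕ × ℕ)) (φ : Val) : List (ℕ × Val) :=
  nodes T φ ++ varList T bs

/-- The directed version of the adjacency relation. The root, which is the only vertex of colour
`T + 1`, is adjacent to all other vertices, every other subformula to its immediate subformulas, and
every literal to its variable. -/
noncomputable def dadj (T : ℕ) (u v : ℕ × Val) : Bool :=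
  (encEq v.1 (T + 1) && !encEq u.1 (T + 1)) ||
    ((encEq (u.1 - 1 + 2) v.1 && decide (v.1 < T + 1) && v.2.toList.any fun z => encEq u.2 z) ||
      (decide (T + 1 < u.1) && decide (v.1 < 2) && encEq u.2 (Val.cons v.2.head v.2.tail.head)))

/-- The adjacency relation. -/
noncomputable def vadj (T : ℕ) (u v : ℕ × Val) : Bool := dadj T u v || dadj T v u

/-- The code of the disjoint union of `n` copies of a graph with vertex list `vl` of length `n`. -/
noncomputable def copiesCode (T c : ℕ) (vl : List (ℕ × Val)) : Val :=
  enc ((List.range vl.length).flatMap fun e => vl.map fun u =>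
      (List.range vl.length).flatMap fun e' => vl.map fun v => encEq e e' && vadj T u v,
    (List.range c).map fun a => (List.range vl.length).flatMap fun _ => vl.map fun u => encEq u.1 a)

/-- The copies of a tuple in the `n` copies of a graph with `n` vertices. -/
def copies (n : ℕ) (w : List ℕ) : List (List ℕ) :=
  (List.range n).map fun e => w.map fun b => e * n + b

/-- Whether the `i`-th quantifier block is existential. -/
def flag (i : ℕ) : Bool := (List.replicate i Val.nil).foldl (fun c _ => !c) true

/-- The sequence of single choices that make up the weighted quantifiers: the number of a block and
whether the choice is existential. -/
def schedule (bs : List (ℕ × ℕ)) : List (ℕ × Bool) :=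
  (List.range bs.length).flatMap fun i => List.replicate (bs.getD i (0, 0)).2 (i, flag i)

/-- The data that do not change during the search: the vertices, the schedule, the code of the graph
of the queries, and the quantifier rank of the queries. -/
abbrev Ctx := List (ℕ × Val) × List (ℕ × Bool) × Val × ℕ

/-- A state of the search: the partial choices that are still to be examined, the partial choices
that have been accepted, and the fixed data. A partial choice is the list of the positions of the
chosen vertices in the vertex list, the most recent choice first, and the root `0` last. -/
abbrev SearchState := List (List ℕ) × List (List ℕ) × Ctx

/-- The variables of block `i` that have not been chosen. -/
noncomputable def avail (T : ℕ) (vl : List (ℕ × Val)) (w : List ℕ) (i : ℕ) : List ℕ :=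
  (List.range vl.length).filter fun b =>
    encEq (vl.getD b (0, Val.nil)).1 (T + 2 + i) && !w.any fun b' => encEq b b'

/-- The extensions of a partial choice by one more choice. -/
noncomputable def children (T : ℕ) (x : Ctx) (w : List ℕ) : List (List ℕ) :=
  bif decide (w.tail.length < x.2.1.length) then
    (avail T x.1 w (x.2.1.getD w.tail.length (0, true)).1).map fun b => b :: w
  else []

/-- The accepted partial choices that differ from `w` only in the last choice. -/
noncomputable def siblings (done : List (List ℕ)) (w : List ℕ) : List (List ℕ) :=
  done.filter fun v => encEq v.tail w.tail

/-- The query whether `w` is distinguishable from the choices in `vs`. -/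
def queryWord (x : Ctx) (vs : List (List ℕ)) (w : List ℕ) : Word :=
  (Val.ofList [x.2.2.1, enc w.length, enc 0, enc x.2.2.2, enc (copies x.1.length w),
    enc (vs.flatMap (copies x.1.length))]).toWord

/-- The state together with the next query. -/
noncomputable def prepare (σ : SearchState) : SearchState × Word :=
  (σ, queryWord σ.2.2 (siblings σ.2.1 (σ.1.headD [])) (σ.1.headD []))

/-- The state after a query with answer `b`. -/
noncomputable def advance (T : ℕ) (σ : SearchState) (b : Bool) : SearchState :=
  (bif b then children T σ.2.2 (σ.1.headD []) ++ σ.1.tail else σ.1.tail,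
    (bif b then σ.1.headD [] :: σ.2.1 else σ.2.1, σ.2.2))

/-- The blocks of an instance. -/
def blocksOf (v : Val) : List (ℕ × ℕ) := v.head.toList.map fun b => (b.head.natOf, b.tail.natOf)

/-- Whether a word is the code of an instance. -/
noncomputable def validWord (T : ℕ) (y : Word) : Bool :=
  encEq (Val.cons (Val.parse y).head (Val.parse y).tail).toWord y &&
    (encEq (blocksOf (Val.parse y)) (Val.parse y).head &&
      (encEq (normForm T (Val.parse y).tail) (Val.parse y).tail &&
        wfForm (blocksOf (Val.parse y)) T (Val.parse y).tail))

/-- The fixed data for an instance. -/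
noncomputable def mkCtx (T : ℕ) (v : Val) : Ctx :=
  (vertexList T (blocksOf v) v.tail, schedule (blocksOf v),
    copiesCode T (T + 2 + (blocksOf v).length) (vertexList T (blocksOf v) v.tail),
    T + (schedule (blocksOf v)).length)

/-- The initial state of the search. On words that are not the code of an instance, the search is
over immediately. -/
noncomputable def initial (T : ℕ) (y : Word) : SearchState :=
  bif validWord T y then
    (children T (mkCtx T (Val.parse y)) [0], [[0]], mkCtx T (Val.parse y))
  else ([], [], mkCtx T (Val.parse y))

/-- The accepted complete choices that make the formula true. -/
noncomputable def winningLeaves (T : ℕ) (done : List (List ℕ)) (x : Ctx) : List (List ℕ) :=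
  done.filter fun w => encEq w.tail.length x.2.1.length &&
    evalForm T (w.map fun b => x.1.getD b (0, Val.nil)) T true (x.1.headD (0, Val.nil)).2

/-- The accepted partial choices of length `j` that are winning, given those of length `j + 1`. -/
noncomputable def winningStep (done : List (List ℕ)) (x : Ctx) (win : List (List ℕ)) (j : ℕ) :
    List (List ℕ) :=
  done.filter fun u => encEq u.length (j + 1) &&
    bif (x.2.1.getD j (0, true)).2 then win.any fun w => encEq w.tail u
    else done.all fun w => !encEq w.tail u || win.any fun w' => encEq w w'

/-- The truth value of the instance, computed from the final state of the search. -/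
noncomputable def verdict (T : ℕ) (σ : SearchState) : Bool :=
  !((List.range σ.2.2.2.1.length).reverse.foldl (winningStep σ.2.1 σ.2.2)
    (winningLeaves T σ.2.1 σ.2.2)).isEmpty

/-! ### The parts of the algorithm take polynomial time -/

namespace PT

variable {α β γ δ : Type} [Enc α] [Enc β] [Enc γ] [Enc δ]

@[fun_prop]
theorem natOf : PT Val.natOf := by unfold Val.natOf; fun_prop

@[fun_prop]
theorem boolOf : PT Val.boolOf := by unfold Val.boolOf; fun_prop

/-- A binary function that takes polynomial time as a function of pairs, applied to arguments. -/
theorem eta_uncurry {f : α → β → γ} (h : PT fun x : α × β => f x.1 x.2) {g : δ → α} {g' : δ → β}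
    (hg : PT g) (hg' : PT g') : PT fun x => f (g x) (g' x) :=
  h.comp (hg.pair hg')

theorem ofNat : PT Val.ofNat := of_enc_eq PT.id fun _ => rfl

theorem ofBool : PT Val.ofBool := of_enc_eq PT.id fun _ => rfl

@[fun_prop]
theorem normForm (t : ℕ) : PT (normForm t) := by
  induction t with
  | zero =>
    have h1 := ofNat
    have h2 := ofBool
    change PT fun v => FOLearning.normForm 0 v
    unfold FOLearning.normForm
    fun_prop
  | succ t ih =>
    change PT fun v => FOLearning.normForm (t + 1) v
    unfold FOLearning.normForm
    fun_prop

@[fun_prop]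
theorem wfForm (t : ℕ) {b : α → List (ℕ × ℕ)} {v : α → Val} (hb : PT b) (hv : PT v) :
    PT fun x => wfForm (b x) t (v x) := by
  refine eta_uncurry (f := fun b v => FOLearning.wfForm b t v) ?_ hb hv
  induction t with
  | zero => unfold FOLearning.wfForm; fun_prop
  | succ t ih =>
    unfold FOLearning.wfForm
    have : PT fun x : (List (ℕ × ℕ) × Val) × Val => FOLearning.wfForm x.1.1 t x.2 :=
      ih.comp (by fun_prop : PT fun x : (List (ℕ × ℕ) × Val) × Val => (x.1.1, x.2))
    fun_prop

@[fun_prop]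
theorem varVertex (T : ℕ) {i j : α → Val} (hi : PT i) (hj : PT j) :
    PT fun x => varVertex T (i x) (j x) := by
  unfold FOLearning.varVertex
  fun_prop

@[fun_prop]
theorem evalForm (T t : ℕ) (p : Bool) {b : α → List (ℕ × Val)} {v : α → Val} (hb : PT b)
    (hv : PT v) : PT fun x => evalForm T (b x) t p (v x) := by
  refine eta_uncurry (f := fun b v => FOLearning.evalForm T b t p v) ?_ hb hv
  induction t generalizing p with
  | zero => unfold FOLearning.evalForm; fun_prop
  | succ t ih =>
    have : ∀ p, PT fun x : (List (ℕ × Val) × Val) × Val => FOLearning.evalForm T x.1.1 t p x.2 :=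
      fun p => (ih p).comp (by fun_prop : PT fun x : (List (ℕ × Val) × Val) × Val => (x.1.1, x.2))
    have h1 := this true
    have h2 := this false
    cases p
    · unfold FOLearning.evalForm; fun_prop
    · unfold FOLearning.evalForm; fun_prop

@[fun_prop]
theorem nodes (t : ℕ) : PT (nodes t) := by
  induction t with
  | zero => change PT fun v => FOLearning.nodes 0 v; unfold FOLearning.nodes; fun_prop
  | succ t ih => change PT fun v => FOLearning.nodes (t + 1) v; unfold FOLearning.nodes; fun_prop

@[fun_prop]
theorem vertexList (T : ℕ) {b : α → List (ℕ × ℕ)} {v : α → Val} (hb : PT b) (hv : PT v) :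
    PT fun x => vertexList T (b x) (v x) := by
  unfold FOLearning.vertexList varList
  fun_prop

@[fun_prop]
theorem vadj (T : ℕ) {u v : α → ℕ × Val} (hu : PT u) (hv : PT v) :
    PT fun x => vadj T (u x) (v x) := by
  unfold FOLearning.vadj dadj
  fun_prop

@[fun_prop]
theorem copiesCode (T : ℕ) {c : α → ℕ} {v : α → List (ℕ × Val)} (hc : PT c) (hv : PT v) :
    PT fun x => copiesCode T (c x) (v x) := by
  unfold FOLearning.copiesCode
  fun_prop

@[fun_prop]
theorem copies {n : α → ℕ} {w : α → List ℕ} (hn : PT n) (hw : PT w) :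
    PT fun x => copies (n x) (w x) := by
  unfold FOLearning.copies
  fun_prop

@[fun_prop]
theorem flag : PT flag := by
  have := foldl (l := fun n : ℕ => List.replicate n Val.nil) (f := fun _ => true)
    (g := fun _ c _ => !c) (by fun_prop) (by fun_prop) (by fun_prop) (G := fun _ => 3) (.const 3)
    fun _ c _ _ => by
      have := sz_bool (!c)
      omega
  exact this

@[fun_prop]
theorem schedule : PT schedule := by
  unfold FOLearning.schedule
  fun_prop

@[fun_prop]
theorem avail (T : ℕ) {v : α → List (ℕ × Val)} {w : α → List ℕ} {i : α → ℕ} (hv : PT v) (hw : PT w)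
    (hi : PT i) : PT fun x => avail T (v x) (w x) (i x) := by
  unfold FOLearning.avail
  fun_prop

@[fun_prop]
theorem children (T : ℕ) {c : α → Ctx} {w : α → List ℕ} (hc : PT c) (hw : PT w) :
    PT fun x => children T (c x) (w x) := by
  unfold FOLearning.children
  fun_prop

@[fun_prop]
theorem queryWord {c : α → Ctx} {v : α → List (List ℕ)} {w : α → List ℕ} (hc : PT c) (hv : PT v)
    (hw : PT w) : PT fun x => queryWord (c x) (v x) (w x) := by
  unfold FOLearning.queryWord
  fun_prop

theorem prepare : PT prepare := by
  unfold FOLearning.prepare siblings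
  fun_prop

theorem advance (T : ℕ) : PT fun x : SearchState × Bool => advance T x.1 x.2 := by
  unfold FOLearning.advance
  fun_prop

@[fun_prop]
theorem blocksOf : PT blocksOf := by
  unfold FOLearning.blocksOf
  fun_prop

theorem initial (T : ℕ) : PT (initial T) := by
  unfold FOLearning.initial validWord mkCtx
  fun_prop

theorem verdict (T : ℕ) : PT (verdict T) := by
  have := foldl (l := fun σ : SearchState => (List.range σ.2.2.2.1.length).reverse)
    (f := fun σ => winningLeaves T σ.2.1 σ.2.2) (g := fun σ => winningStep σ.2.1 σ.2.2)
    (by fun_prop) (by unfold winningLeaves; fun_prop) (by unfold winningStep; fun_prop)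
    (G := sz) .sz fun σ c j _ => by
      have h1 : sz (winningStep σ.2.1 σ.2.2 c j) ≤ sz σ.2.1 := sz_sublist List.filter_sublist
      have h2 := sz_pair σ
      have h3 := sz_pair σ.2
      omega
  exact this.isEmpty.not

end PT

/-! ### The search loop as a program -/

/-- One step of the search with the oracle `O`. Only the first letter of an answer is read; it is
`false` exactly for rejections. -/
noncomputable def searchStep (T : ℕ) (O : Word → Word) (σ : SearchState) : SearchState :=
  advance T σ ((O (prepare σ).2).headD false)

/-- The states of the search on input `y`. -/
noncomputable def searchState (T : ℕ) (O : Word → Word) (y : Word) (i : ℕ) : SearchState :=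
  (searchStep T O)^[i] (initial T y)

theorem searchState_succ (T : ℕ) (O : Word → Word) (y : Word) (i : ℕ) :
    searchState T O y (i + 1) = searchStep T O (searchState T O y i) :=
  Function.iterate_succ_apply' _ _ _

/-- A program that performs the search. Its running time is polynomial in the size of the input,
the number of steps of the search, and the size of the states. -/
theorem exists_search_program (T : ℕ) : ∃ (p : Prog) (d : ℕ), ∀ (O : Word → Word) (G : Word → Prop)
    (y : Word) (N B : ℕ),
    (∀ i < N, (searchState T O y i).1 ≠ [] ∧ G (prepare (searchState T O y i)).2) →
    (searchState T O y N).1 = [] → (∀ i ≤ N, sz (searchState T O y i) ≤ B) →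
    Calc (fun w a => G w ∧ a = O w) p (enc y) (enc (verdict T (searchState T O y N)))
      ((sz y + N + B + 2) ^ d) := by
  obtain ⟨p₁, T₁, ⟨d₁, hT₁⟩, -, h₁⟩ := PT.initial T
  obtain ⟨p₂, T₂, ⟨d₂, hT₂⟩, ⟨d₃, hs₂⟩, h₂⟩ := PT.prepare
  obtain ⟨p₃, T₃, ⟨d₄, hT₃⟩, -, h₃⟩ := PT.advance T
  obtain ⟨p₄, T₄, ⟨d₅, hT₄⟩, -, h₄⟩ := PT.verdict T
  refine ⟨.seq p₁ (.seq (.loop (.head (.reg 0)) (.seq p₂ (.seq (.assign 1 (.tail (.reg 0)))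
    (.seq (.query 1 1) (.seq (.assign 0 (.cons (.head (.reg 0)) (.head (.reg 1)))) p₃))))) p₄),
    (d₁ + d₂ + d₃ + 3 * d₄ + d₅) + 8, ?_⟩
  intro O G y N B hlt hend hsz
  set S := searchState T O y with hS
  -- `X ^ D` bounds the running times of the four subroutines, and the remaining factor of
  -- `X ^ (D + 8)` pays for `N` iterations and the constants
  set X := sz y + N + B + 2 with hX
  set D := d₁ + d₂ + d₃ + 3 * d₄ + d₅ with hD
  have hX2 : 2 ≤ X := by omega
  have hpow : ∀ {m e : ℕ}, m ≤ X → e ≤ D → m ^ e ≤ X ^ D := fun {m e} hm he =>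
    (Nat.pow_le_pow_left hm e).trans (Nat.pow_le_pow_right (by omega) he)
  have hstep : ∀ i < N, Calc (fun w a => G w ∧ a = O w)
      (.seq p₂ (.seq (.assign 1 (.tail (.reg 0))) (.seq (.query 1 1)
        (.seq (.assign 0 (.cons (.head (.reg 0)) (.head (.reg 1)))) p₃))))
      (enc (S i)) (enc (S (i + 1))) (3 * X ^ D + 11) := by
    intro i hi s hs
    have hB := hsz i hi.le
    set w := (prepare (S i)).2 with hw
    set b := (O w).headD false with hb
    refine Exec.mono (Exec.seq (h₂ _ (S i) s hs) fun s₁ hs₁ =>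
      Exec.seq (mid := fun s => s 0 = enc (S i, w) ∧ s 1 = enc w) (Exec.assign ?_) fun s₂ hs₂ =>
      Exec.seq (mid := fun s => s 0 = enc (S i, w) ∧ s 1 = enc (O w))
        ⟨_, _, Run.query hs₂.2 ⟨(hlt i hi).2, rfl⟩, le_rfl, ?_⟩ fun s₃ hs₃ =>
      Exec.seq (mid := fun s => s 0 = enc (S i, b)) (Exec.assign ?_) fun s₄ hs₄ =>
      h₃ _ (S i, b) s₄ hs₄) ?_ fun s' hs' => ?_
    · have : prepare (S i) = (S i, w) := rfl
      rw [this] at hs₁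
      simp [Expr.eval, hs₁, enc_pair]
    · simp [hs₂, enc_word]
    · cases hO : O w with
      | nil => simp [Expr.eval, hs₃, hO, enc_pair, enc_nil, b, enc_false]
      | cons c l => simp [Expr.eval, hs₃, hO, enc_pair, enc_cons, b]
    · have e1 := (hT₂ (S i)).trans (hpow (show sz (S i) + 2 ≤ X by omega) (show d₂ ≤ D by omega))
      have e2 := (hs₂ (S i)).trans (hpow (show sz (S i) + 2 ≤ X by omega) (show d₃ ≤ D by omega))
      have e3 : w.length ≤ X ^ D := by
        refine (length_le_sz w).trans (le_trans ?_ e2)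
        have := sz_pair (prepare (S i))
        simp only [w]
        omega
      have e4 : T₃ (S i, b) ≤ X ^ D := by
        refine (hT₃ _).trans ?_
        have h5 := sz_bool b
        have h6 : sz (S i, b) + 2 ≤ X ^ 3 := by
          have h7 : 2 ^ 2 * X ≤ X ^ 2 * X := Nat.mul_le_mul_right _ (Nat.pow_le_pow_left hX2 2)
          rw [sz_pair]
          simp only
          rw [pow_succ]
          omega
        refine (Nat.pow_le_pow_left h6 _).trans ?_
        rw [← pow_mul]
        exact Nat.pow_le_pow_right (by omega) (by omega)
      simp only [Expr.cost]
      omega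
    · rw [hs', hS, searchState_succ]
      rfl
  intro s hs
  refine Exec.mono (Exec.seq (h₁ _ y s hs) fun s₁ hs₁ => Exec.seq
    (Calc.loop (S := fun i => enc (S i)) (N := N) (T := 3 * X ^ D + 11)
      (fun i hi => ⟨?_, hstep i hi⟩) ?_ s₁ ?_) fun s₂ hs₂ => h₄ _ (S N) s₂ hs₂) ?_ fun _ h => h
  · have := (hlt i hi).1
    rcases h : S i with ⟨l, c⟩
    rw [h] at this
    rcases l with - | ⟨b, l⟩
    · exact absurd rfl this
    · exact ⟨_, _, _, rfl⟩
  · rcases h : S N with ⟨l, c⟩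
    rw [h] at hend
    simp only at hend
    subst hend
    exact ⟨enc c, rfl⟩
  · exact hs₁
  · have e1 := (hT₁ y).trans (hpow (show sz y + 2 ≤ X by omega) (show d₁ ≤ D by omega))
    have e2 := (hT₄ (S N)).trans (hpow (show sz (S N) + 2 ≤ X by
      have := hsz N le_rfl
      omega) (show d₅ ≤ D by omega))
    have e3 : 1 ≤ X ^ D := Nat.one_le_pow _ _ (by omega)
    have e4 : N * (3 * X ^ D + 11 + 3) ≤ X * (17 * X ^ D) := Nat.mul_le_mul (by omega) (by omega)
    have e5 : X ^ (D + 8) = X ^ 7 * (X * X ^ D) := by ring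
    have e6 : 2 ^ 7 * (X * X ^ D) ≤ X ^ 7 * (X * X ^ D) :=
      Nat.mul_le_mul_right _ (Nat.pow_le_pow_left hX2 7)
    have e7 : 1 * X ^ D ≤ X * X ^ D := Nat.mul_le_mul_right _ (by omega)
    have e8 : X * (17 * X ^ D) = 17 * (X * X ^ D) := by ring
    rw [e5]
    omega

section

open FirstOrder FirstOrder.Language

/-! ### Ehrenfeucht–Fraïssé games -/

/-- Duplicator wins the `r`-round game on two copies of `G` from the position in which the pairs
in `P` have been chosen. -/
def EF {c : ℕ} (G : ColGraph c) : ℕ → Set (Fin G.n × Fin G.n) → Prop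
  | 0, P => ∀ p ∈ P, (∀ a, p.1 ∈ G.col a ↔ p.2 ∈ G.col a) ∧
      ∀ q ∈ P, (p.1 = q.1 ↔ p.2 = q.2) ∧ (G.graph.Adj p.1 q.1 ↔ G.graph.Adj p.2 q.2)
  | r + 1, P => (∀ x, ∃ y, EF G r (insert (x, y) P)) ∧ ∀ y, ∃ x, EF G r (insert (x, y) P)

namespace EF

variable {c : ℕ} {G : ColGraph c}

theorem subset {r : ℕ} {P Q : Set (Fin G.n × Fin G.n)} (h : EF G r Q) (hPQ : P ⊆ Q) :
    EF G r P := by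
  induction r generalizing P Q with
  | zero => exact fun p hp => ⟨(h p (hPQ hp)).1, fun q hq => (h p (hPQ hp)).2 q (hPQ hq)⟩
  | succ r ih =>
    refine ⟨fun x => ?_, fun y => ?_⟩
    · obtain ⟨y, hy⟩ := h.1 x
      exact ⟨y, ih hy (Set.insert_subset_insert hPQ)⟩
    · obtain ⟨x, hx⟩ := h.2 y
      exact ⟨x, ih hx (Set.insert_subset_insert hPQ)⟩

theorem of_succ {r : ℕ} {P : Set (Fin G.n × Fin G.n)} (h : EF G (r + 1) P) : EF G r P := by
  obtain ⟨y, hy⟩ := h.1 ⟨0, G.n_pos⟩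
  exact hy.subset (Set.subset_insert _ _)

theorem of_le {r s : ℕ} {P : Set (Fin G.n × Fin G.n)} (h : EF G s P) (hrs : r ≤ s) :
    EF G r P := by
  induction hrs with
  | refl => exact h
  | step _ ih => exact ih h.of_succ

theorem refl (r : ℕ) {P : Set (Fin G.n × Fin G.n)} (hP : ∀ p ∈ P, p.1 = p.2) : EF G r P := by
  induction r generalizing P with
  | zero =>
    intro p hp
    refine ⟨fun a => by rw [hP p hp], fun q hq => ?_⟩
    rw [hP p hp, hP q hq]
    exact ⟨Iff.rfl, Iff.rfl⟩
  | succ r ih =>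
    refine ⟨fun x => ⟨x, ih ?_⟩, fun x => ⟨x, ih ?_⟩⟩ <;>
    · rintro p (rfl | hp)
      · rfl
      · exact hP p hp

end EF

/-- Truth of a formula in a coloured graph. -/
abbrev ColGraph.Real {c : ℕ} (G : ColGraph c) {α : Type} {n : ℕ}
    (φ : (colLang c).BoundedFormula α n) (v : α → Fin G.n) (xs : Fin n → Fin G.n) : Prop :=
  @BoundedFormula.Realize (colLang c) (Fin G.n) G.str α n φ v xs

section

variable {c : ℕ} {G : ColGraph c} {α : Type} {n : ℕ}

theorem exists_eq_var (t : (colLang c).Term (α ⊕ Fin n)) :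
    ∃ i, t = Term.var i := by
  cases t with
  | var i => exact ⟨i, rfl⟩
  | func f _ => exact Empty.elim f

/-- Formulas of quantifier rank at most `r` do not distinguish positions from which Duplicator wins
the `r`-round game. -/
theorem EF.realize_iff {r : ℕ} {P : Set (Fin G.n × Fin G.n)} (h : EF G r P)
    (φ : (colLang c).BoundedFormula α n) (hq : qrank φ ≤ r) {v v' : α → Fin G.n}
    {xs xs' : Fin n → Fin G.n} (hP : ∀ i, (Sum.elim v xs i, Sum.elim v' xs' i) ∈ P) :
    G.Real φ v xs ↔ G.Real φ v' xs' := by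
  let _ := G.str
  induction φ generalizing r P with
  | falsum => exact Iff.rfl
  | equal t₁ t₂ =>
    obtain ⟨i, rfl⟩ := exists_eq_var t₁
    obtain ⟨j, rfl⟩ := exists_eq_var t₂
    have h0 := h.of_le (Nat.zero_le r)
    exact ((h0 _ (hP i)).2 _ (hP j)).1
  | rel R ts =>
    have h0 := h.of_le (Nat.zero_le r)
    cases R with
    | adj =>
      obtain ⟨i, hi⟩ := exists_eq_var (ts 0)
      obtain ⟨j, hj⟩ := exists_eq_var (ts 1)
      have := ((h0 _ (hP i)).2 _ (hP j)).2
      change G.graph.Adj ((ts 0).realize _) ((ts 1).realize _) ↔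
        G.graph.Adj ((ts 0).realize _) ((ts 1).realize _)
      rw [hi, hj]
      exact this
    | col a =>
      obtain ⟨i, hi⟩ := exists_eq_var (ts 0)
      have := (h0 _ (hP i)).1 a
      change (ts 0).realize _ ∈ G.col a ↔ (ts 0).realize _ ∈ G.col a
      rw [hi]
      exact this
  | imp φ ψ ih₁ ih₂ =>
    simp only [qrank] at hq
    exact imp_congr (ih₁ h (by omega) hP) (ih₂ h (by omega) hP)
  | all φ ih =>
    simp only [qrank] at hq
    obtain ⟨r, rfl⟩ : ∃ s, r = s + 1 := ⟨r - 1, by omega⟩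
    have key : ∀ x y, EF G r (insert (x, y) P) →
        (G.Real φ v (Fin.snoc xs x) ↔ G.Real φ v' (Fin.snoc xs' y)) := by
      intro x y hxy
      refine ih hxy (by omega) fun i => ?_
      rcases i with i | i
      · exact Or.inr (hP (Sum.inl i))
      · refine Fin.lastCases ?_ (fun i => ?_) i
        · simp
        · simpa using Or.inr (hP (Sum.inr i))
    constructor
    · intro hx y
      obtain ⟨x, hxy⟩ := h.2 y
      exact (key x y hxy).1 (hx x)
    · intro hy x
      obtain ⟨y, hxy⟩ := h.1 x
      exact (key x y hxy).2 (hy y)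

/-! ### Distinguishing formulas -/

/-- The two positions satisfy the same formulas of quantifier rank at most `r`. -/
def FOEquiv (G : ColGraph c) (r : ℕ) (v v' : α → Fin G.n) (xs xs' : Fin n → Fin G.n) : Prop :=
  ∀ φ : (colLang c).BoundedFormula α n, qrank φ ≤ r → (G.Real φ v xs ↔ G.Real φ v' xs')

theorem FOEquiv.symm {r : ℕ} {v v' : α → Fin G.n} {xs xs' : Fin n → Fin G.n}
    (h : FOEquiv G r v v' xs xs') : FOEquiv G r v' v xs' xs :=
  fun φ hφ => (h φ hφ).symm

theorem qrank_not (φ : (colLang c).BoundedFormula α n) : qrank φ.not = qrank φ := by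
  change max (qrank φ) 0 = _
  simp

/-- The formula that is true of `v` and false of `v'`. -/
theorem exists_distinguishing {r : ℕ} {v v' : α → Fin G.n} {xs xs' : Fin n → Fin G.n}
    (h : ¬ FOEquiv G r v v' xs xs') :
    ∃ φ : (colLang c).BoundedFormula α n, qrank φ ≤ r ∧ G.Real φ v xs ∧ ¬ G.Real φ v' xs' := by
  simp only [FOEquiv, not_forall] at h
  obtain ⟨φ, hφ, h⟩ := h
  by_cases h1 : G.Real φ v xs
  · exact ⟨φ, hφ, h1, fun h2 => h ⟨fun _ => h2, fun _ => h1⟩⟩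
  · refine ⟨φ.not, by rwa [qrank_not], h1, fun h2 => h2 ?_⟩
    by_contra h3
    exact h ⟨fun h4 => absurd h4 h1, fun h4 => absurd h4 h3⟩

/-- Finitely many formulas have a conjunction of the same quantifier rank. -/
theorem exists_conj (r : ℕ) (l : List ((colLang c).BoundedFormula α n))
    (hl : ∀ φ ∈ l, qrank φ ≤ r) :
    ∃ ψ : (colLang c).BoundedFormula α n, qrank ψ ≤ r ∧
      ∀ v xs, G.Real ψ v xs ↔ ∀ φ ∈ l, G.Real φ v xs := by
  induction l with
  | nil =>
    refine ⟨BoundedFormula.falsum.not, by simp [qrank], fun v xs => ?_⟩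
    simp only [List.not_mem_nil, false_imp_iff, implies_true, iff_true]
    exact fun h => h
  | cons φ l ih =>
    obtain ⟨ψ, hψ, h⟩ := ih fun χ hχ => hl χ (by simp [hχ])
    refine ⟨(φ.imp ψ.not).not, ?_, fun v xs => ?_⟩
    · have := hl φ (by simp)
      simp only [qrank]
      omega
    · simp only [List.mem_cons, forall_eq_or_imp, ← h]
      change ((G.Real φ v xs → G.Real ψ v xs → False) → False) ↔ _
      tauto

theorem FOEquiv.exists_snoc {r : ℕ} {v v' : α → Fin G.n} {xs xs' : Fin n → Fin G.n}
    (h : FOEquiv G (r + 1) v v' xs xs') (x : Fin G.n) :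
    ∃ y, FOEquiv G r v v' (Fin.snoc xs x : Fin (n + 1) → Fin G.n) (Fin.snoc xs' y) := by
  by_contra! hcon
  choose ψ hψ h1 h2 using fun y => exists_distinguishing (hcon y)
  obtain ⟨χ, hχ, h3⟩ := exists_conj (G := G) r ((List.finRange G.n).map ψ) (by
    intro φ hφ
    obtain ⟨y, -, rfl⟩ := List.mem_map.1 hφ
    exact hψ y)
  have h4 := (h χ.not.all (by simp only [qrank]; omega)).2
  have h5 : G.Real χ.not.all v xs := h4 fun y hy => by
    have := (h3 _ _).1 hy (ψ y) (List.mem_map_of_mem (List.mem_finRange y))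
    exact h2 y this
  exact h5 x ((h3 _ _).2 fun φ hφ => by
    obtain ⟨y, -, rfl⟩ := List.mem_map.1 hφ
    exact h1 y)

theorem range_snoc_subset (v v' : α → Fin G.n) (xs xs' : Fin n → Fin G.n) (x y : Fin G.n) :
    insert (x, y) (Set.range fun i => (Sum.elim v xs i, Sum.elim v' xs' i)) ⊆
      Set.range fun i => (Sum.elim v (Fin.snoc xs x : Fin (n + 1) → Fin G.n) i,
        Sum.elim v' (Fin.snoc xs' y : Fin (n + 1) → Fin G.n) i) := by
  rintro p (rfl | ⟨i | i, rfl⟩)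
  · exact ⟨Sum.inr (Fin.last n), by simp⟩
  · exact ⟨Sum.inl i, rfl⟩
  · exact ⟨Sum.inr i.castSucc, by simp⟩

/-- Duplicator wins the `r`-round game from positions that satisfy the same formulas of quantifier
rank at most `r`. -/
theorem FOEquiv.ef {r : ℕ} {v v' : α → Fin G.n} {xs xs' : Fin n → Fin G.n}
    (h : FOEquiv G r v v' xs xs') :
    EF G r (Set.range fun i => (Sum.elim v xs i, Sum.elim v' xs' i)) := by
  let _ := G.str
  induction r generalizing n with
  | zero =>
    rintro _ ⟨i, rfl⟩
    refine ⟨fun a => ?_, ?_⟩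
    · exact h (BoundedFormula.rel (ColRel.col a : (colLang c).Relations 1) ![Term.var i]) le_rfl
    · rintro _ ⟨j, rfl⟩
      exact ⟨h (BoundedFormula.equal (Term.var i) (Term.var j)) le_rfl,
        h (BoundedFormula.rel (ColRel.adj : (colLang c).Relations 2) ![Term.var i, Term.var j])
          le_rfl⟩
  | succ r ih =>
    refine ⟨fun x => ?_, fun y => ?_⟩
    · obtain ⟨y, hy⟩ := h.exists_snoc x
      exact ⟨y, (ih hy).subset (range_snoc_subset ..)⟩
    · obtain ⟨x, hx⟩ := h.symm.exists_snoc y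
      exact ⟨x, (ih hx.symm).subset (range_snoc_subset ..)⟩

/-- If no positive example is equivalent to a negative one, then a single formula separates them. -/
theorem exists_separating {r : ℕ} (pos neg : List (α → Fin G.n))
    (h : ∀ u ∈ pos, ∀ u' ∈ neg, ¬ EF G r (Set.range fun i => (u i, u' i))) :
    ∃ φ : (colLang c).BoundedFormula α 0, qrank φ ≤ r ∧
      (∀ u ∈ pos, G.Real φ u default) ∧ ∀ u ∈ neg, ¬ G.Real φ u default := by
  have h1 : ∀ u u', u ∈ pos → u' ∈ neg → ∃ φ : (colLang c).BoundedFormula α 0, qrank φ ≤ r ∧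
      G.Real φ u default ∧ ¬ G.Real φ u' default := by
    intro u u' hu hu'
    refine exists_distinguishing fun hE => h u hu u' hu' (hE.ef.subset ?_)
    rintro _ ⟨i, rfl⟩
    exact ⟨Sum.inl i, rfl⟩
  have h2 : ∀ u ∈ pos, ∃ φ : (colLang c).BoundedFormula α 0, qrank φ ≤ r ∧
      G.Real φ u default ∧ ∀ u' ∈ neg, ¬ G.Real φ u' default := by
    intro u hu
    choose! ψ hψ using fun u' (hu' : u' ∈ neg) => h1 u u' hu hu'
    obtain ⟨χ, hχ, h3⟩ := exists_conj (G := G) r (neg.map ψ) (by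
      intro φ hφ
      obtain ⟨y, hy, rfl⟩ := List.mem_map.1 hφ
      exact (hψ y hy).1)
    refine ⟨χ, hχ, (h3 _ _).2 fun φ hφ => ?_, fun u' hu' h4 => ?_⟩
    · obtain ⟨y, hy, rfl⟩ := List.mem_map.1 hφ
      exact (hψ y hy).2.1
    · exact (hψ u' hu').2.2 ((h3 _ _).1 h4 _ (List.mem_map_of_mem hu'))
  choose! ψ hψ using h2
  obtain ⟨χ, hχ, h3⟩ := exists_conj (G := G) r (pos.map fun u => (ψ u).not) (by
    intro φ hφ
    obtain ⟨y, hy, rfl⟩ := List.mem_map.1 hφ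
    rw [qrank_not]
    exact (hψ y hy).1)
  refine ⟨χ.not, by rwa [qrank_not], fun u hu h4 => ?_,
    fun u hu h4 => h4 ((h3 _ _).2 fun φ hφ => ?_)⟩
  · exact (h3 _ _).1 h4 _ (List.mem_map_of_mem hu) (hψ u hu).2.1
  · obtain ⟨y, hy, rfl⟩ := List.mem_map.1 hφ
    exact (hψ y hy).2.2 u hu

end

/-! ### Counting types -/

/-- The types of quantifier rank `r` of `j`-tuples in graphs with `c` colours: for `r = 0` the
quantifier-free type, for `r + 1` the set of types of rank `r` of the extensions of the tuple. -/
def RankType (c : ℕ) : ℕ → ℕ → Type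
  | 0, j => (Fin j → Fin j → Prop × Prop) × (Fin c → Fin j → Prop)
  | r + 1, j => Set (RankType c r (j + 1))

/-- The type of quantifier rank `r` of a tuple. -/
def ColGraph.rankType {c : ℕ} (G : ColGraph c) :
    (r : ℕ) → {j : ℕ} → (Fin j → Fin G.n) → RankType c r j
  | 0, _, a => (fun i i' => (a i = a i', G.graph.Adj (a i) (a i')), fun k i => a i ∈ G.col k)
  | r + 1, j, a => Set.range fun x => G.rankType r (Fin.cons x a : Fin (j + 1) → Fin G.n)

/-- The number of types of quantifier rank `r` of `j`-tuples. -/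
def numTypes (c r j : ℕ) : ℕ :=
  (fun m => 2 ^ m)^[r] (((2 * 2) ^ (j + r)) ^ (j + r) * (2 ^ (j + r)) ^ c)

theorem finite_rankType (c r j : ℕ) : Finite (RankType c r j) := by
  induction r generalizing j with
  | zero => unfold RankType; infer_instance
  | succ r ih =>
    have := ih (j + 1)
    unfold RankType
    infer_instance

theorem card_rankType (c r j : ℕ) : Nat.card (RankType c r j) = numTypes c r j := by
  induction r generalizing j with
  | zero => simp [RankType, numTypes]
  | succ r ih =>
    have := finite_rankType c r (j + 1)
    have h := ih (j + 1)
    unfold numTypes at h ⊢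
    rw [Function.iterate_succ_apply', show j + (r + 1) = j + 1 + r by omega, ← h]
    change Nat.card (RankType c r (j + 1) → Prop) = _
    rw [Nat.card_fun]
    simp

theorem EF.of_rankType_eq {c : ℕ} {G : ColGraph c} {r j : ℕ} {a b : Fin j → Fin G.n}
    (h : G.rankType r a = G.rankType r b) : EF G r (Set.range fun i => (a i, b i)) := by
  induction r generalizing j with
  | zero =>
    have h1 := congrArg Prod.fst h
    have h2 := congrArg Prod.snd h
    simp only [ColGraph.rankType] at h1 h2
    rintro _ ⟨i, rfl⟩
    refine ⟨fun k => by simpa using congrFun (congrFun h2 k) i, ?_⟩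
    rintro _ ⟨i', rfl⟩
    simpa using congrFun (congrFun h1 i) i'
  | succ r ih =>
    have hsub : ∀ x y, insert (x, y) (Set.range fun i => (a i, b i)) ⊆
        Set.range fun i => ((Fin.cons x a : Fin (j + 1) → Fin G.n) i,
          (Fin.cons y b : Fin (j + 1) → Fin G.n) i) := by
      rintro x y p (rfl | ⟨i, rfl⟩)
      · exact ⟨0, rfl⟩
      · exact ⟨i.succ, rfl⟩
    refine ⟨fun x => ?_, fun y => ?_⟩
    · have : G.rankType r (Fin.cons x a : Fin (j + 1) → Fin G.n) ∈
          (show Set (RankType c r (j + 1)) from G.rankType (r + 1) b) := by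
        rw [← h]; exact ⟨x, rfl⟩
      obtain ⟨y, hy⟩ := this
      exact ⟨y, (ih hy.symm).subset (hsub x y)⟩
    · have : G.rankType r (Fin.cons y b : Fin (j + 1) → Fin G.n) ∈
          (show Set (RankType c r (j + 1)) from G.rankType (r + 1) a) := by
        rw [h]; exact ⟨y, rfl⟩
      obtain ⟨x, hx⟩ := this
      exact ⟨x, (ih hx).subset (hsub x y)⟩

/-! ### Disjoint copies of a graph -/

/-- The disjoint union of `m` copies of a coloured graph. -/
def ColGraph.copy {c : ℕ} (G : ColGraph c) (m : ℕ) (hm : 0 < m) : ColGraph c where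
  n := m * G.n
  n_pos := Nat.mul_pos hm G.n_pos
  graph :=
    { Adj := fun x y => (finProdFinEquiv.symm x).1 = (finProdFinEquiv.symm y).1 ∧
        G.graph.Adj (finProdFinEquiv.symm x).2 (finProdFinEquiv.symm y).2
      symm := ⟨fun _ _ h => ⟨h.1.symm, h.2.symm⟩⟩
      loopless := ⟨fun _ h => G.graph.loopless.irrefl _ h.2⟩ }
  col := fun a => {x | (finProdFinEquiv.symm x).2 ∈ G.col a}

section

variable {c : ℕ} {G : ColGraph c} {m : ℕ} {hm : 0 < m}

/-- The vertex `x` in the copy number `e`. -/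
def ColGraph.inCopy (G : ColGraph c) (m : ℕ) (hm : 0 < m) (e : Fin m) (x : Fin G.n) :
    Fin (G.copy m hm).n :=
  finProdFinEquiv (e, x)

theorem ColGraph.inCopy_inj {e e' : Fin m} {x y : Fin G.n} :
    G.inCopy m hm e x = G.inCopy m hm e' y ↔ e = e' ∧ x = y := by
  unfold inCopy
  exact finProdFinEquiv.injective.eq_iff.trans Prod.mk_inj

theorem ColGraph.exists_inCopy (z : Fin (G.copy m hm).n) : ∃ e x, z = G.inCopy m hm e x :=
  ⟨(finProdFinEquiv.symm z).1, (finProdFinEquiv.symm z).2,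
    (finProdFinEquiv.apply_symm_apply z).symm⟩

theorem ColGraph.inCopy_adj {e e' : Fin m} {x y : Fin G.n} :
    (G.copy m hm).graph.Adj (G.inCopy m hm e x) (G.inCopy m hm e' y) ↔
      e = e' ∧ G.graph.Adj x y := by
  change (finProdFinEquiv.symm (finProdFinEquiv (e, x))).1 =
    (finProdFinEquiv.symm (finProdFinEquiv (e', y))).1 ∧
      G.graph.Adj (finProdFinEquiv.symm (finProdFinEquiv (e, x))).2
        (finProdFinEquiv.symm (finProdFinEquiv (e', y))).2 ↔ _
  simp only [Equiv.symm_apply_apply]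

theorem ColGraph.inCopy_col {e : Fin m} {x : Fin G.n} {a : Fin c} :
    G.inCopy m hm e x ∈ (G.copy m hm).col a ↔ x ∈ G.col a := by
  change (finProdFinEquiv.symm (finProdFinEquiv (e, x))).2 ∈ G.col a ↔ _
  rw [Equiv.symm_apply_apply]

/-- A vertex `h` adjacent to all others keeps the game on the copies within one copy. -/
theorem EF.of_copy {h : Fin G.n} (hh : ∀ x, x ≠ h → G.graph.Adj h x) {e e' : Fin m} {r : ℕ}
    {P : Set (Fin G.n × Fin G.n)} (hP : (h, h) ∈ P)
    (hE : EF (G.copy m hm) r ((fun p => (G.inCopy m hm e p.1, G.inCopy m hm e' p.2)) '' P)) :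
    EF G r P := by
  induction r generalizing P with
  | zero =>
    intro p hp
    obtain ⟨h1, h2⟩ := hE _ (Set.mem_image_of_mem _ hp)
    refine ⟨fun a => by simpa [ColGraph.inCopy_col] using h1 a, fun q hq => ?_⟩
    simpa [ColGraph.inCopy_adj, ColGraph.inCopy_inj] using h2 _ (Set.mem_image_of_mem _ hq)
  | succ r ih =>
    have h0 : (G.inCopy m hm e h, G.inCopy m hm e' h) ∈
        (fun p : Fin G.n × Fin G.n => (G.inCopy m hm e p.1, G.inCopy m hm e' p.2)) '' P :=
      ⟨_, hP, rfl⟩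
    have key : ∀ x y, EF (G.copy m hm) r (insert (G.inCopy m hm e x, G.inCopy m hm e' y)
        ((fun p => (G.inCopy m hm e p.1, G.inCopy m hm e' p.2)) '' P)) →
          EF G r (insert (x, y) P) := by
      intro x y hxy
      refine ih (Or.inr hP) ?_
      rwa [Set.image_insert_eq]
    refine ⟨fun x => ?_, fun y => ?_⟩
    · obtain ⟨z, hz⟩ := hE.1 (G.inCopy m hm e x)
      have h1 := (hz.of_le (Nat.zero_le r) _ (Or.inr h0)).2 _ (Or.inl rfl)
      obtain ⟨e'', y, rfl⟩ := ColGraph.exists_inCopy z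
      simp only [ColGraph.inCopy_inj, ColGraph.inCopy_adj, true_and] at h1
      obtain rfl : e' = e'' := by
        by_cases hx : x = h
        · exact (h1.1.1 hx.symm).1
        · exact (h1.2.1 (hh x hx)).1
      exact ⟨y, key x y hz⟩
    · obtain ⟨z, hz⟩ := hE.2 (G.inCopy m hm e' y)
      have h1 := (hz.of_le (Nat.zero_le r) _ (Or.inr h0)).2 _ (Or.inl rfl)
      obtain ⟨e'', x, rfl⟩ := ColGraph.exists_inCopy z
      simp only [ColGraph.inCopy_inj, ColGraph.inCopy_adj, true_and] at h1
      obtain rfl : e = e'' := by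
        by_cases hy : y = h
        · exact (h1.1.2 hy.symm).1
        · exact (h1.2.2 (hh y hy)).1
      exact ⟨x, key x y hz⟩

/-- Duplicator's strategy on one copy extends to all copies, by the identity on the other ones. -/
theorem EF.copy {e : Fin m} {r : ℕ} {P : Set (Fin G.n × Fin G.n)} (hE : EF G r P) :
    EF (G.copy m hm) r ((fun p => (G.inCopy m hm e p.1, G.inCopy m hm e p.2)) '' P ∪
      {p | p.1 = p.2 ∧ ∀ x, p.1 ≠ G.inCopy m hm e x}) := by
  induction r generalizing P with
  | zero =>
    rintro p (⟨p, hp, rfl⟩ | ⟨hp, hp'⟩)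
    · refine ⟨fun a => by simpa [ColGraph.inCopy_col] using (hE p hp).1 a, ?_⟩
      rintro q (⟨q, hq, rfl⟩ | ⟨hq, hq'⟩)
      · simpa [ColGraph.inCopy_adj, ColGraph.inCopy_inj] using (hE p hp).2 q hq
      · obtain ⟨e', x, h⟩ := ColGraph.exists_inCopy q.1
        have : e ≠ e' := fun h' => hq' x (by rw [h, h'])
        rw [← hq, h]
        simp [ColGraph.inCopy_adj, ColGraph.inCopy_inj, this]
    · rw [← hp]
      refine ⟨fun a => Iff.rfl, ?_⟩
      obtain ⟨e', x, h⟩ := ColGraph.exists_inCopy p.1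
      have : e' ≠ e := fun h' => hp' x (by rw [h, h'])
      rw [h]
      rintro q (⟨q, hq, rfl⟩ | ⟨hq, hq'⟩)
      · simp [ColGraph.inCopy_adj, ColGraph.inCopy_inj, this]
      · simp [hq]
  | succ r ih =>
    have key : ∀ x y, EF G r (insert (x, y) P) → EF (G.copy m hm) r (insert
        (G.inCopy m hm e x, G.inCopy m hm e y)
        ((fun p => (G.inCopy m hm e p.1, G.inCopy m hm e p.2)) '' P ∪
          {p | p.1 = p.2 ∧ ∀ x, p.1 ≠ G.inCopy m hm e x})) := by
      intro x y hxy
      have := ih hxy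
      rwa [Set.image_insert_eq, Set.insert_union] at this
    have key' : ∀ z, (∀ x, z ≠ G.inCopy m hm e x) → EF (G.copy m hm) r (insert (z, z)
        ((fun p => (G.inCopy m hm e p.1, G.inCopy m hm e p.2)) '' P ∪
          {p | p.1 = p.2 ∧ ∀ x, p.1 ≠ G.inCopy m hm e x})) := by
      intro z hz
      have hmem : (z, z) ∈ (fun p => (G.inCopy m hm e p.1, G.inCopy m hm e p.2)) '' P ∪
          {p | p.1 = p.2 ∧ ∀ x, p.1 ≠ G.inCopy m hm e x} := Or.inr ⟨rfl, hz⟩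
      rw [Set.insert_eq_of_mem hmem]
      exact ih hE.of_succ
    refine ⟨fun z => ?_, fun z => ?_⟩
    · by_cases hz : ∃ x, z = G.inCopy m hm e x
      · obtain ⟨x, rfl⟩ := hz
        obtain ⟨y, hy⟩ := hE.1 x
        exact ⟨_, key x y hy⟩
      · exact ⟨z, key' z (by simpa using hz)⟩
    · by_cases hz : ∃ x, z = G.inCopy m hm e x
      · obtain ⟨y, rfl⟩ := hz
        obtain ⟨x, hx⟩ := hE.2 y
        exact ⟨_, key x y hx⟩
      · exact ⟨z, key' z (by simpa using hz)⟩

end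

/-! ### The queries -/

theorem LearnInstance.err_eq_zero_iff (I : LearnInstance) (hI : 0 < I.pos.length) {m : ℕ}
    (φ : FOFormula I.c I.k m) (w : Fin m → Fin I.G.n) :
    I.err φ w = 0 ↔ (∀ v ∈ I.pos, I.G.Sat φ v w) ∧ ∀ v ∈ I.neg, ¬ I.G.Sat φ v w := by
  classical
  have h : ((I.pos.length + I.neg.length : ℕ) : ℚ) ≠ 0 := by
    exact_mod_cast (by omega : I.pos.length + I.neg.length ≠ 0)
  unfold LearnInstance.err
  rw [div_eq_zero_iff, or_iff_left h, Nat.cast_eq_zero, Finset.card_eq_zero, Finset.union_eq_empty,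
    Finset.filter_eq_empty_iff, Finset.filter_eq_empty_iff]
  simp

section

variable {c : ℕ} (G : ColGraph c) {k : ℕ}

/-- The copies of a tuple in `n` disjoint copies of a graph with `n` vertices. -/
def ColGraph.tupleCopies (u : Fin k → Fin G.n) : List (Fin k → Fin (G.copy G.n G.n_pos).n) :=
  (List.finRange G.n).map fun e i => G.inCopy G.n G.n_pos e (u i)

theorem ColGraph.mem_tupleCopies {u : Fin k → Fin G.n} {v : Fin k → Fin (G.copy G.n G.n_pos).n} :
    v ∈ G.tupleCopies u ↔ ∃ e, v = fun i => G.inCopy G.n G.n_pos e (u i) := by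
  simp [tupleCopies, eq_comm]

theorem ColGraph.nodup_tupleCopies (hk : 0 < k) {l : List (Fin k → Fin G.n)} (hl : l.Nodup) :
    (l.flatMap G.tupleCopies).Nodup := by
  rw [List.nodup_flatMap]
  refine ⟨fun u _ => (List.nodup_finRange _).map fun e e' h => ?_, ?_⟩
  · exact (ColGraph.inCopy_inj.1 (congrFun h ⟨0, hk⟩)).1
  · refine hl.imp fun {u u'} hne v hv hv' => hne ?_
    obtain ⟨e, rfl⟩ := G.mem_tupleCopies.1 hv
    obtain ⟨e', h⟩ := G.mem_tupleCopies.1 hv'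
    funext i
    exact (ColGraph.inCopy_inj.1 (congrFun h i)).2

/-- The input of the learning problem that asks to distinguish the copies of a tuple `u` from the
copies of other tuples. There are as many copies as vertices in the graph, and `l = 0`, so that the
algorithm that writes this input need not know how many parameters the answer has. -/
def copyInstance (hk : 0 < k) (q : ℕ) (u : Fin k → Fin G.n) (us : List (Fin k → Fin G.n))
    (h : (u :: us).Nodup) :
    LearnInstance where
  c := c
  G := G.copy G.n G.n_pos
  k := k
  l := 0
  q := q
  pos := G.tupleCopies u
  neg := us.flatMap G.tupleCopies
  nodup := by simpa using G.nodup_tupleCopies hk h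

variable {G} {hk : 0 < k} {q : ℕ} {u : Fin k → Fin G.n} {us : List (Fin k → Fin G.n)}
  {h : (u :: us).Nodup}
  {L Q : ℕ → ℕ → ℕ → ℕ} {a : Word}

theorem copyInstance_pos_length : 0 < (copyInstance G hk q u us h).pos.length := by
  simp [copyInstance, ColGraph.tupleCopies, G.n_pos]

/-- If the learner rejects, then `u` is indistinguishable from one of the other tuples. All tuples
have a common entry that is adjacent to all other vertices. -/
theorem exists_ef_of_reject {hub : Fin G.n} (hhub : ∀ x, x ≠ hub → G.graph.Adj hub x) {i₀ : Fin k}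
    (hu : u i₀ = hub) (hus : ∀ v ∈ us, v i₀ = hub)
    (ha : (copyInstance G hk q u us h).Correct L Q a) (hrej : a.headD false = false) :
    ∃ v ∈ us, EF G q (Set.range fun i => (u i, v i)) := by
  rcases ha with ⟨φ, w, -, rfl⟩ | ⟨hno, -⟩
  · simp [Val.toWord] at hrej
  by_contra! hcon
  obtain ⟨φ, hφ, h1, h2⟩ := exists_separating (G := G.copy G.n G.n_pos) (r := q)
    ((G.tupleCopies u).map fun v => Sum.elim v (Fin.elim0 : Fin 0 → _))
    ((us.flatMap G.tupleCopies).map fun v => Sum.elim v (Fin.elim0 : Fin 0 → _)) (by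
      intro x hx y hy hE
      obtain ⟨x', hx', rfl⟩ := List.mem_map.1 hx
      obtain ⟨y', hy', rfl⟩ := List.mem_map.1 hy
      obtain ⟨e, rfl⟩ := G.mem_tupleCopies.1 hx'
      obtain ⟨v, hv, hv'⟩ := List.mem_flatMap.1 hy'
      obtain ⟨e', rfl⟩ := G.mem_tupleCopies.1 hv'
      refine hcon v hv (EF.of_copy hhub (e := e) (e' := e') ⟨i₀, Prod.ext hu (hus v hv)⟩
        (hE.subset ?_))
      rintro _ ⟨_, ⟨i, rfl⟩, rfl⟩
      exact ⟨Sum.inl i, rfl⟩)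
  refine hno ⟨φ, Fin.elim0, hφ,
    (LearnInstance.err_eq_zero_iff _ copyInstance_pos_length φ _).2 ?_⟩
  exact ⟨fun v hv => h1 _ (List.mem_map_of_mem hv), fun v hv => h2 _ (List.mem_map_of_mem hv)⟩

theorem exists_free_copy {l m : ℕ} {hm : 0 < m} (w : Fin l → Fin (G.copy m hm).n) (hl : l < m) :
    ∃ e, ∀ i x, w i ≠ G.inCopy m hm e x := by
  by_contra! hcon
  choose i x hx using hcon
  have := Fintype.card_le_of_injective i fun e e' h =>
    (ColGraph.inCopy_inj.1 ((hx e).symm.trans ((congrArg w h).trans (hx e')))).1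
  simp at this
  omega

/-- If the learner does not reject and has fewer parameters than there are copies, then `u` is
distinguishable from all other tuples: one of the copies contains no parameter. -/
theorem not_ef_of_accept (hacc : a.headD false = true)
    (ha : (copyInstance G hk q u us h).Correct L Q a) (hL : L 0 k q < G.n) :
    ∀ v ∈ us, ¬ EF G (Q q k 0) (Set.range fun i => (u i, v i)) := by
  intro v hv hE
  rcases ha with ⟨φ, w, ⟨hφ, herr⟩, -⟩ | ⟨-, rfl⟩
  swap
  · simp [Val.toWord] at hacc
  rw [LearnInstance.err_eq_zero_iff _ copyInstance_pos_length] at herr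
  obtain ⟨e, he⟩ := exists_free_copy (G := G) (hm := G.n_pos) w hL
  have h1 := herr.1 (fun i => G.inCopy G.n G.n_pos e (u i)) (G.mem_tupleCopies.2 ⟨e, rfl⟩)
  refine herr.2 (fun i => G.inCopy G.n G.n_pos e (v i))
    (List.mem_flatMap.2 ⟨v, hv, G.mem_tupleCopies.2 ⟨e, rfl⟩⟩) ?_
  refine ((hE.copy (hm := G.n_pos) (e := e)).realize_iff φ hφ fun i => ?_).1 h1
  rcases i with (i | i) | i
  · exact Or.inl ⟨_, ⟨i, rfl⟩, rfl⟩
  · exact Or.inr ⟨rfl, he i⟩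
  · exact i.elim0

end

end

/-! ### The code of a query -/

theorem dadj_self (T : ℕ) (u : ℕ × Val) : dadj T u u = false := by
  have h : ¬ (u.1 - 1 + 2 = u.1) := by omega
  have h1 : encEq (u.1 - 1 + 2) u.1 = false := by
    rw [Bool.eq_false_iff, ne_eq, encEq_iff, enc_nat_inj]; exact h
  rw [dadj, h1]
  cases encEq u.1 (T + 1) <;>
  · simp only [Bool.and_false, Bool.false_and, Bool.not_true, Bool.false_or, Bool.not_false,
      Bool.and_eq_false_iff, decide_eq_false_iff_not]
    left
    omega

/-- The coloured graph with a given list of vertices. -/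
noncomputable def graphOf (T c : ℕ) (vl : List (ℕ × Val)) (h : 0 < vl.length) : ColGraph c where
  n := vl.length
  n_pos := h
  graph :=
    { Adj := fun i j => vadj T vl[i] vl[j] = true
      symm := ⟨fun i j h => by rwa [vadj, Bool.or_comm]⟩
      loopless := ⟨fun i h => by simp [vadj, dadj_self] at h⟩ }
  col := fun a => {i | vl[i].1 = a}

theorem ofFn_finProdFinEquiv {m n : ℕ} {α : Type} (f : Fin (m * n) → α) :
    List.ofFn f = (List.finRange m).flatMap fun e => (List.finRange n).map fun x =>
      f (finProdFinEquiv (e, x)) := by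
  rw [List.ofFn_mul, List.flatMap_def, List.ofFn_eq_map]
  congr 2
  funext e
  rw [List.ofFn_eq_map]
  congr 1
  funext x
  congr 1
  apply Fin.ext
  simp [finProdFinEquiv, mul_comm, add_comm]

theorem ofFn_copy {c : ℕ} (G : ColGraph c) {m : ℕ} (hm : 0 < m) {α : Type}
    (f : Fin (G.copy m hm).n → α) :
    List.ofFn f = (List.finRange m).flatMap fun e => (List.finRange G.n).map fun x =>
      f (G.inCopy m hm e x) :=
  ofFn_finProdFinEquiv f

theorem flatMap_range {α : Type} (n : ℕ) (f : ℕ → List α) :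
    (List.range n).flatMap f = (List.finRange n).flatMap fun e : Fin n => f e := by
  rw [← List.map_coe_finRange_eq_range, List.flatMap_map]

theorem map_eq_map_finRange {α β : Type} (l : List α) (f : α → β) :
    l.map f = (List.finRange l.length).map fun i => f l[i] := by
  conv_lhs => rw [← List.map_get_finRange l]
  rw [List.map_map]
  rfl

theorem copiesCode_eq (T c : ℕ) (vl : List (ℕ × Val)) (h : 0 < vl.length) :
    copiesCode T c vl = ((graphOf T c vl h).copy vl.length h).code := by
  rw [copiesCode, ColGraph.code, enc_pair]
  congr 1
  · rw [ofFn_copy, enc_list, flatMap_range, List.map_flatMap]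
    congr 2
    funext e
    rw [List.map_map, map_eq_map_finRange]
    congr 1
    funext x
    rw [Function.comp_apply, ofFn_copy, enc_list, flatMap_range, List.map_flatMap]
    congr 2
    funext e'
    rw [List.map_map, map_eq_map_finRange]
    congr 1
    funext x'
    rw [Function.comp_apply]
    change Val.ofBool _ = _
    congr 1
    rw [Bool.eq_iff_iff]
    refine Iff.trans ?_ ((ColGraph.inCopy_adj (G := graphOf T c vl h)).symm.trans
      (@decide_eq_true_iff _ (_)).symm)
    rw [Bool.and_eq_true, encEq_iff, enc_nat_inj, Fin.val_inj]
    rfl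
  · rw [enc_list, ← List.map_coe_finRange_eq_range (n := c), List.ofFn_eq_map, List.map_map,
      List.map_map]
    congr 2
    funext a
    rw [Function.comp_apply, Function.comp_apply, ofFn_copy, enc_list, flatMap_range,
      List.map_flatMap]
    congr 2
    funext e
    rw [List.map_map, map_eq_map_finRange]
    congr 1
    funext x
    rw [Function.comp_apply]
    change Val.ofBool _ = _
    congr 1
    rw [Bool.eq_iff_iff]
    refine Iff.trans ?_ ((ColGraph.inCopy_col (G := graphOf T c vl h)).symm.trans
      (@decide_eq_true_iff _ (_)).symm)
    rw [encEq_iff, enc_nat_inj]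
    rfl

/-- The first `k` entries of a list, as a tuple of vertices. -/
def ColGraph.tuple {c : ℕ} (G : ColGraph c) (k : ℕ) (w : List ℕ) : Fin k → Fin G.n :=
  fun i => ⟨w.getD i 0 % G.n, Nat.mod_lt _ G.n_pos⟩

section

variable {c : ℕ} {G : ColGraph c}

theorem ColGraph.tuple_val {k : ℕ} {w : List ℕ} (hk : w.length = k) (hw : ∀ b ∈ w, b < G.n)
    (i : Fin k) :
    (G.tuple k w i : ℕ) = w[i] := by
  have hi : (i : ℕ) < w.length := by omega
  have := hw _ (List.getElem_mem hi)
  simp [tuple, hi, Nat.mod_eq_of_lt this]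

theorem ColGraph.tuple_inj {k : ℕ} {v w : List ℕ} (hv : v.length = k) (hw : w.length = k)
    (hv' : ∀ b ∈ v, b < G.n) (hw' : ∀ b ∈ w, b < G.n) (h : G.tuple k v = G.tuple k w) : v = w := by
  refine List.ext_getElem (hv.trans hw.symm) fun i h1 h2 => ?_
  have := congrArg Fin.val (congrFun h ⟨i, by omega⟩)
  rwa [tuple_val hv hv', tuple_val hw hw'] at this

theorem copies_code {k : ℕ} {w : List ℕ} (hk : w.length = k) (hw : ∀ b ∈ w, b < G.n) :
    (copies G.n w).map enc = (G.tupleCopies (G.tuple k w)).map tupleCode := by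
  rw [copies, ColGraph.tupleCopies, ← List.map_coe_finRange_eq_range, List.map_map, List.map_map,
    List.map_map]
  congr 1
  funext e
  simp only [Function.comp_apply, tupleCode, enc_list, List.map_map]
  congr 1
  refine List.ext_getElem (by simp [hk]) fun i h1 h2 => ?_
  have h3 := ColGraph.tuple_val hk hw ⟨i, by simpa using h2⟩
  simp only [List.getElem_map, List.getElem_ofFn, Function.comp_apply, enc_nat]
  congr 1
  simp only [Fin.getElem_fin] at h3
  rw [← h3]
  simp [ColGraph.inCopy, finProdFinEquiv, mul_comm, add_comm]

theorem nodup_tuples {k : ℕ} {l : List (List ℕ)} (hl : l.Nodup) (hk : ∀ w ∈ l, w.length = k)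
    (hw : ∀ w ∈ l, ∀ b ∈ w, b < G.n) : (l.map (G.tuple k)).Nodup :=
  List.Nodup.map_on (fun v hv w hw' h =>
    ColGraph.tuple_inj (hk v hv) (hk w hw') (hw v hv) (hw w hw') h) hl

/-- The words that the program asks are codes of instances `copyInstance`. -/
theorem queryWord_eq {x : Ctx} (hn : x.1.length = G.n) (hx : x.2.2.1 = (G.copy G.n G.n_pos).code)
    {k : ℕ} (hk : 0 < k) {w : List ℕ} {vs : List (List ℕ)} (hl : w.length = k)
    (hnd : ((w :: vs).map (G.tuple k)).Nodup)
    (hvs : ∀ v ∈ w :: vs, v.length = k ∧ ∀ b ∈ v, b < G.n) :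
    queryWord x vs w =
      (copyInstance G hk x.2.2.2 (G.tuple k w) (vs.map (G.tuple k)) hnd).code := by
  rw [queryWord, LearnInstance.code, hx, hn, enc_list (copies G.n w),
    copies_code hl (hvs w (by simp)).2]
  have : enc (vs.flatMap (copies G.n)) =
      Val.ofList (((vs.map (G.tuple k)).flatMap G.tupleCopies).map tupleCode) := by
    rw [enc_list, List.map_flatMap, List.map_flatMap, List.flatMap_map]
    congr 1
    rw [List.flatMap_def, List.flatMap_def]
    congr 1
    refine List.map_congr_left fun v hv => ?_
    exact copies_code (hvs v (by simp [hv])).1 (hvs v (by simp [hv])).2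
  rw [this, hl]
  rfl

end

/-! ### The evaluation game is invariant under Ehrenfeucht–Fraïssé equivalence -/

/-- The vertex that represents a subformula of depth `s`. -/
def nodeVertex : ℕ → Val → ℕ × Val
  | 0, v => (bif v.tail.tail.head.boolOf then 0 else 1, v)
  | s + 1, v => (s + 2, v)

theorem nodeVertex_snd (s : ℕ) (v : Val) : (nodeVertex s v).2 = v := by cases s <;> rfl

theorem nodeVertex_fst_le (s : ℕ) (v : Val) : (nodeVertex s v).1 ≤ s + 1 := by
  cases s with
  | zero => simp only [nodeVertex]; cases v.tail.tail.head.boolOf <;> simp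
  | succ s => simp [nodeVertex]

theorem nodeVertex_level (s : ℕ) (v : Val) : (nodeVertex s v).1 - 1 = s := by
  cases s with
  | zero => simp only [nodeVertex]; cases v.tail.tail.head.boolOf <;> simp
  | succ s => simp [nodeVertex]

theorem nodeVertex_mem_nodes (s : ℕ) (v : Val) : nodeVertex s v ∈ nodes s v := by
  cases s <;> simp [nodes, nodeVertex]

/-- The properties of the vertex list of an instance with formula `φ` of depth `T` that the
argument depends on. -/
structure IsVertexList (T c : ℕ) (φ : Val) (vl : List (ℕ × Val)) : Prop where
  pos : 0 < vl.length
  root : vl[0] = nodeVertex T φ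
  eq_root : ∀ i (h : i < vl.length), vl[i].1 = T + 1 → i = 0
  color_lt : ∀ u ∈ vl, u.1 < c
  child_mem : ∀ s z, s + 1 ≤ T → nodeVertex (s + 1) z ∈ vl → ∀ z' ∈ z.toList, nodeVertex s z' ∈ vl
  child_root : ∀ s, T = s + 1 → ∀ u ∈ vl, u.1 - 1 = s → u.2 ∈ φ.toList
  var : ∀ u ∈ vl, T + 1 < u.1 → ∃ i j : ℕ, u = varVertex T (enc i) (enc j)
  literal : ∀ u ∈ vl, u.1 ≤ 1 → u = nodeVertex 0 u.2

theorem fst_le_of_mem_nodes {s : ℕ} {v : Val} {u : ℕ × Val} (h : u ∈ nodes s v) : u.1 ≤ s + 1 := by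
  induction s generalizing v with
  | zero =>
    simp only [nodes, List.mem_singleton] at h
    subst h
    exact nodeVertex_fst_le 0 v
  | succ s ih =>
    simp only [nodes, List.mem_cons, List.mem_flatMap] at h
    rcases h with rfl | ⟨z, -, h⟩
    · simp
    · have := ih h
      omega

theorem eq_of_mem_nodes {s : ℕ} {v : Val} {u : ℕ × Val} (h : u ∈ nodes s v) (hs : u.1 - 1 = s) :
    u.2 = v := by
  cases s with
  | zero =>
    simp only [nodes, List.mem_singleton] at h
    rw [h]
  | succ s =>
    simp only [nodes, List.mem_cons, List.mem_flatMap] at h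
    rcases h with rfl | ⟨z, -, h⟩
    · rfl
    · have := fst_le_of_mem_nodes h
      omega

theorem literal_of_mem_nodes {s : ℕ} {v : Val} {u : ℕ × Val} (h : u ∈ nodes s v) (hs : u.1 ≤ 1) :
    u = nodeVertex 0 u.2 := by
  induction s generalizing v with
  | zero =>
    simp only [nodes, List.mem_singleton] at h
    rw [h]
    rfl
  | succ s ih =>
    simp only [nodes, List.mem_cons, List.mem_flatMap] at h
    rcases h with rfl | ⟨z, -, h⟩
    · simp at hs
    · exact ih h

theorem child_mem_nodes {s t : ℕ} {v z z' : Val} (h : nodeVertex (s + 1) z ∈ nodes t v)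
    (hz : z' ∈ z.toList) : nodeVertex s z' ∈ nodes t v := by
  induction t generalizing v with
  | zero =>
    have := fst_le_of_mem_nodes h
    simp [nodeVertex] at this
  | succ t ih =>
    simp only [nodes, List.mem_cons, List.mem_flatMap] at h ⊢
    rcases h with h | ⟨y, hy, h⟩
    · simp only [nodeVertex, Prod.mk.injEq, Nat.add_right_cancel_iff] at h
      obtain ⟨rfl, rfl⟩ := h
      exact Or.inr ⟨z', hz, nodeVertex_mem_nodes _ _⟩
    · exact Or.inr ⟨y, hy, ih h⟩

theorem natOf_enc (n : ℕ) : (enc n).natOf = n := by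
  simp [Val.natOf, enc_nat, Val.ofNat]

theorem mem_varList {T : ℕ} {bs : List (ℕ × ℕ)} {u : ℕ × Val} :
    u ∈ varList T bs ↔ ∃ i j, i < bs.length ∧ j < (bs.getD i (0, 0)).1 ∧
      u = varVertex T (enc i) (enc j) := by
  simp only [varList, List.mem_flatMap, List.mem_map, List.mem_range]
  constructor
  · rintro ⟨i, hi, j, hj, rfl⟩
    exact ⟨i, j, hi, hj, rfl⟩
  · rintro ⟨i, j, hi, hj, rfl⟩
    exact ⟨i, hi, j, hj, rfl⟩

theorem isVertexList {T : ℕ} (hT : 1 ≤ T) (bs : List (ℕ × ℕ)) (φ : Val) :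
    IsVertexList T (T + 2 + bs.length) φ (vertexList T bs φ) := by
  obtain ⟨T, rfl⟩ : ∃ t, T = t + 1 := ⟨T - 1, by omega⟩
  have hvar : ∀ u ∈ varList (T + 1) bs, T + 1 + 2 ≤ u.1 := by
    intro u hu
    obtain ⟨i, j, -, -, rfl⟩ := mem_varList.1 hu
    simp [varVertex]
  refine ⟨by simp [vertexList, nodes], rfl, ?_, ?_, ?_, ?_, ?_, ?_⟩
  · intro i hi h
    by_contra h0
    obtain ⟨i, rfl⟩ : ∃ j, i = j + 1 := ⟨i - 1, by omega⟩
    simp only [vertexList, nodes, List.cons_append, List.length_cons] at hi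
    have hmem : (vertexList (T + 1) bs φ)[i + 1] ∈
        φ.toList.flatMap (nodes T) ++ varList (T + 1) bs :=
      List.getElem_mem (by omega)
    rcases List.mem_append.1 hmem with hm | hm
    · obtain ⟨z, -, hm⟩ := List.mem_flatMap.1 hm
      have := fst_le_of_mem_nodes hm
      omega
    · have := hvar _ hm
      omega
  · intro u hu
    rcases List.mem_append.1 hu with hm | hm
    · have := fst_le_of_mem_nodes hm
      omega
    · obtain ⟨i, j, hi, -, rfl⟩ := mem_varList.1 hm
      simp only [varVertex, natOf_enc]
      omega
  · intro s z hs h z' hz'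
    rcases List.mem_append.1 h with hm | hm
    · exact List.mem_append_left _ (child_mem_nodes hm hz')
    · have := hvar _ hm
      simp only [nodeVertex] at this
      omega
  · intro s hs u hu hus
    obtain rfl : T = s := by omega
    rcases List.mem_append.1 hu with hm | hm
    · simp only [nodes, List.mem_cons, List.mem_flatMap] at hm
      rcases hm with rfl | ⟨z, hz, hm⟩
      · simp at hus
      · rwa [eq_of_mem_nodes hm hus]
    · have := hvar _ hm
      omega
  · intro u hu h
    rcases List.mem_append.1 hu with hm | hm
    · have := fst_le_of_mem_nodes hm
      omega
    · obtain ⟨i, j, -, -, h⟩ := mem_varList.1 hm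
      exact ⟨i, j, h⟩
  · intro u hu h
    rcases List.mem_append.1 hu with hm | hm
    · exact literal_of_mem_nodes hm h
    · have := hvar _ hm
      omega

theorem dadj_iff {T : ℕ} {u v : ℕ × Val} : dadj T u v = true ↔
    (v.1 = T + 1 ∧ u.1 ≠ T + 1) ∨ (u.1 - 1 + 2 = v.1 ∧ v.1 < T + 1 ∧ u.2 ∈ v.2.toList) ∨
      (T + 1 < u.1 ∧ v.1 < 2 ∧ u.2 = Val.cons v.2.head v.2.tail.head) := by
  simp only [dadj, Bool.or_eq_true, Bool.and_eq_true, encEq_iff, enc_nat_inj, enc_val,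
    decide_eq_true_iff, List.any_eq_true, Bool.not_eq_true', Bool.eq_false_iff, ne_eq]
  constructor
  · rintro (h | ⟨⟨h1, h2⟩, z, hz, rfl⟩ | ⟨⟨h1, h2⟩, h3⟩)
    · exact Or.inl h
    · exact Or.inr (Or.inl ⟨h1, h2, hz⟩)
    · exact Or.inr (Or.inr ⟨h1, h2, h3⟩)
  · rintro (h | ⟨h1, h2, h3⟩ | ⟨h1, h2, h3⟩)
    · exact Or.inl h
    · exact Or.inr (Or.inl ⟨⟨h1, h2⟩, _, h3, rfl⟩)
    · exact Or.inr (Or.inr ⟨⟨h1, h2⟩, h3⟩)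

theorem EF.symm {c : ℕ} {G : ColGraph c} {r : ℕ} {P : Set (Fin G.n × Fin G.n)} (h : EF G r P) :
    EF G r (Prod.swap ⁻¹' P) := by
  induction r generalizing P with
  | zero => exact fun p hp => ⟨fun a => ((h _ hp).1 a).symm,
      fun q hq => ⟨((h _ hp).2 _ hq).1.symm, ((h _ hp).2 _ hq).2.symm⟩⟩
  | succ r ih =>
    have key : ∀ x y, EF G r (insert (x, y) P) → EF G r (insert (y, x) (Prod.swap ⁻¹' P)) := by
      intro x y hxy
      refine (ih hxy).subset ?_
      rintro p (rfl | hp)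
      · exact Or.inl rfl
      · exact Or.inr hp
    exact ⟨fun x => (h.2 x).imp fun y => key y x, fun y => (h.1 y).imp fun x => key y x⟩

/-- Corresponding entries of the two lists are paired by `P`. -/
def Paired {n : ℕ} (P : Set (Fin n × Fin n)) (w w' : List ℕ) : Prop :=
  List.Forall₂ (fun b b' => ∃ p ∈ P, (p.1 : ℕ) = b ∧ (p.2 : ℕ) = b') w w'

section

variable {n : ℕ} {P Q : Set (Fin n × Fin n)} {w w' : List ℕ}

theorem Paired.mono (h : Paired P w w') (hPQ : P ⊆ Q) : Paired Q w w' :=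
  List.Forall₂.imp (fun _ _ ⟨p, hp, h⟩ => ⟨p, hPQ hp, h⟩) h

theorem Paired.symm (h : Paired P w w') : Paired (Prod.swap ⁻¹' P) w' w := by
  refine List.Forall₂.flip (List.Forall₂.imp ?_ h)
  rintro b b' ⟨p, hp, h1, h2⟩
  exact ⟨p.swap, by simpa using hp, h2, h1⟩

theorem Paired.exists_mem (h : Paired P w w') {b : ℕ} (hb : b ∈ w) :
    ∃ p ∈ P, (p.1 : ℕ) = b ∧ (p.2 : ℕ) ∈ w' := by
  induction h with
  | nil => simp at hb
  | cons h _ ih =>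
    rcases List.mem_cons.1 hb with rfl | hb
    · obtain ⟨p, hp, h1, h2⟩ := h
      exact ⟨p, hp, h1, by simp [h2]⟩
    · obtain ⟨p, hp, h1, h2⟩ := ih hb
      exact ⟨p, hp, h1, by simp [h2]⟩

theorem Paired.cons (h : Paired P w w') (x y : Fin n) :
    Paired (insert (x, y) P) (↑x :: w) (↑y :: w') :=
  List.Forall₂.cons ⟨(x, y), Or.inl rfl, rfl, rfl⟩ (h.mono (Set.subset_insert _ _))

end

section

variable {T c : ℕ} {φ : Val} {vl : List (ℕ × Val)} (H : IsVertexList T c φ vl)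

/-- The chosen vertices. -/
def chosen (vl : List (ℕ × Val)) (w : List ℕ) : List (ℕ × Val) :=
  w.map fun b => vl.getD b (0, Val.nil)

theorem chosen_val {w : List ℕ} {v : ℕ × Val} :
    v ∈ chosen vl w ↔ ∃ b ∈ w, vl.getD b (0, Val.nil) = v := by
  simp [chosen]

variable {P : Set (Fin vl.length × Fin vl.length)} {w w' : List ℕ}

theorem IsVertexList.adj_iff {x y : Fin vl.length} :
    (graphOf T c vl H.pos).graph.Adj x y ↔
      dadj T vl[x] vl[y] = true ∨ dadj T vl[y] vl[x] = true := by
  change vadj T _ _ = true ↔ _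
  simp [vadj]

theorem IsVertexList.color_eq {r : ℕ} (hE : EF (graphOf T c vl H.pos) r P) {p} (hp : p ∈ P) :
    (vl[p.1]).1 = (vl[p.2]).1 := by
  have := ((hE.of_le (Nat.zero_le r) p hp).1
    ⟨(vl[p.1]).1, H.color_lt _ (List.getElem_mem _)⟩).1 rfl
  exact this.symm

theorem IsVertexList.adj_root (hT : 1 ≤ T) (x : Fin vl.length) (hx : x ≠ ⟨0, H.pos⟩) :
    (graphOf T c vl H.pos).graph.Adj ⟨0, H.pos⟩ x := by
  refine H.adj_iff.2 (Or.inr (dadj_iff.2 (Or.inl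
    ⟨?_, fun h => hx (Fin.ext (H.eq_root _ x.2 h))⟩)))
  obtain ⟨t, rfl⟩ : ∃ t, T = t + 1 := ⟨T - 1, by omega⟩
  change vl[0].1 = _
  rw [H.root]
  rfl

/-- Duplicator preserves the truth of the variable of a literal, which is adjacent to it. -/
theorem IsVertexList.literal_step (hT : 1 ≤ T) {r : ℕ} (hE : EF (graphOf T c vl H.pos) r P)
    (hw : Paired P w w')
    {x x' : Fin vl.length} (hx : (x, x') ∈ P) {z z' : Val} (hz : vl[x] = nodeVertex 0 z)
    (hz' : vl[x'] = nodeVertex 0 z') (h : varVertex T z.head z.tail.head ∈ chosen vl w) :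
    varVertex T z'.head z'.tail.head ∈ chosen vl w' := by
  obtain ⟨b, hb, hbv⟩ := chosen_val.1 h
  obtain ⟨p, hp, rfl, hpw⟩ := hw.exists_mem hb
  have hbv' : vl[p.1] = varVertex T z.head z.tail.head := by
    rw [← hbv]; simp
  have h1 : (graphOf T c vl H.pos).graph.Adj p.1 x := by
    refine H.adj_iff.2 (Or.inl (dadj_iff.2 (Or.inr (Or.inr ⟨?_, ?_, ?_⟩))))
    · rw [hbv']; simp only [varVertex]; omega
    · rw [hz]; have := nodeVertex_fst_le 0 z; omega
    · rw [hz, hbv', nodeVertex_snd]; rfl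
  have h2 := ((hE.of_le (Nat.zero_le r) p hp).2 _ hx).2.1 h1
  have h3 := H.color_eq hE hp
  have h4 : T + 1 < (vl[p.2]).1 := by
    rw [← h3, hbv']; simp only [varVertex]; omega
  have h5 := nodeVertex_fst_le 0 z'
  obtain ⟨i, j, hij⟩ := H.var _ (List.getElem_mem p.2.2) h4
  refine chosen_val.2 ⟨_, hpw, ?_⟩
  have h6 : vl.getD p.2 (0, Val.nil) = vl[p.2] := by simp
  rw [h6]
  have h7 : (vl[p.2]).2 = Val.cons z'.head z'.tail.head := by
    rcases H.adj_iff.1 h2 with h | h <;> rcases dadj_iff.1 h with h | h | h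
    · rw [hz'] at h; omega
    · rw [hz'] at h; omega
    · rw [hz', nodeVertex_snd] at h; exact h.2.2
    · omega
    · omega
    · omega
  change vl[p.2] = _ at hij
  rw [hij] at h7 ⊢
  simp only [varVertex, Val.cons.injEq] at h7 ⊢
  rw [h7.1, h7.2]

/-- One round of the game follows a step from a subformula to an immediate subformula. -/
theorem IsVertexList.child_step {s : ℕ} (hs : s + 1 ≤ T) (hE : EF (graphOf T c vl H.pos) (s + 1) P)
    {x x' : Fin vl.length} (hx : (x, x') ∈ P) {z z' : Val} (hz : vl[x] = nodeVertex (s + 1) z)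
    (hz' : vl[x'] = nodeVertex (s + 1) z') {y : Val} (hy : y ∈ z.toList) :
    ∃ y' ∈ z'.toList, ∃ j j' : Fin vl.length, vl[j] = nodeVertex s y ∧ vl[j'] = nodeVertex s y' ∧
      EF (graphOf T c vl H.pos) s (insert (j, j') P) := by
  have hmem : nodeVertex s y ∈ vl :=
    H.child_mem s z hs (by rw [← hz]; exact List.getElem_mem _) y hy
  obtain ⟨j, hj, hjy⟩ := List.getElem_of_mem hmem
  obtain ⟨j', hj'⟩ : ∃ j' : Fin vl.length,
      EF (graphOf T c vl H.pos) s (insert ((⟨j, hj⟩ : Fin vl.length), j') P) := hE.1 ⟨j, hj⟩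
  have hcol : (nodeVertex s y).1 = (vl[j']).1 := by
    rw [← hjy]; exact H.color_eq hj' (Or.inl rfl)
  have hlev : (vl[j']).1 - 1 = s := by rw [← hcol, nodeVertex_level]
  have hlt := nodeVertex_fst_le s y
  have hx1 : (vl[x]).1 = s + 2 := by rw [hz]; rfl
  have hx1' : (vl[x']).1 = s + 2 := by rw [hz']; rfl
  have hy' : (vl[j']).2 ∈ z'.toList := by
    by_cases hsT : T = s + 1
    · have : x' = ⟨0, H.pos⟩ := Fin.ext (H.eq_root _ x'.2 (hx1'.trans (by omega)))
      subst this
      have h1 : nodeVertex T φ = nodeVertex (s + 1) z' := H.root.symm.trans hz'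
      rw [hsT] at h1
      have h2 : φ = z' := congrArg Prod.snd h1
      rw [← h2]
      exact H.child_root s hsT _ (List.getElem_mem _) hlev
    · have h1 : (graphOf T c vl H.pos).graph.Adj ⟨j, hj⟩ x := by
        refine H.adj_iff.2 (Or.inl (dadj_iff.2 (Or.inr (Or.inl ⟨?_, ?_, ?_⟩))))
        · change vl[j].1 - 1 + 2 = _
          rw [hjy, nodeVertex_level, hx1]
        · omega
        · change vl[j].2 ∈ _
          rw [hjy, hz, nodeVertex_snd, nodeVertex_snd]
          exact hy
      have h2 : (graphOf T c vl H.pos).graph.Adj j' x' :=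
        ((hj'.of_le (Nat.zero_le s) _ (Or.inl rfl)).2 _ (Or.inr hx)).2.1 h1
      rcases H.adj_iff.1 h2 with h | h <;> rcases dadj_iff.1 h with h | h | h
      · omega
      · rw [hz', nodeVertex_snd] at h
        exact h.2.2
      · omega
      · omega
      · omega
      · omega
  refine ⟨_, hy', ⟨j, hj⟩, j', hjy, ?_, hj'⟩
  cases s with
  | zero => exact H.literal _ (List.getElem_mem _) (by omega)
  | succ s =>
    refine Prod.ext ?_ rfl
    rw [← hcol]
    rfl

/-- Duplicator's strategy preserves the truth values of subformulas. -/
theorem IsVertexList.evalForm_eq (hT : 1 ≤ T) {s : ℕ} (hs : s ≤ T) (pol : Bool)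
    (hE : EF (graphOf T c vl H.pos) s P) (hw : Paired P w w') {x x' : Fin vl.length}
    (hx : (x, x') ∈ P) {z z' : Val} (hz : vl[x] = nodeVertex s z) (hz' : vl[x'] = nodeVertex s z') :
    evalForm T (chosen vl w) s pol z = evalForm T (chosen vl w') s pol z' := by
  have hx' : (x', x) ∈ Prod.swap ⁻¹' P := hx
  induction s generalizing P pol x x' z z' with
  | zero =>
    have h1 : (vl[x]).1 = (vl[x']).1 := H.color_eq hE hx
    rw [hz, hz'] at h1
    have h2 : z.tail.tail.head.boolOf = z'.tail.tail.head.boolOf := by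
      simp only [nodeVertex] at h1
      revert h1
      cases z.tail.tail.head.boolOf <;> cases z'.tail.tail.head.boolOf <;> simp
    have h3 : ∀ (w : List ℕ) (z : Val), ((chosen vl w).any fun u =>
        encEq u (varVertex T z.head z.tail.head)) = true ↔
          varVertex T z.head z.tail.head ∈ chosen vl w := by
      intro w z
      simp only [List.any_eq_true, encEq_iff]
      constructor
      · rintro ⟨u, hu, h⟩
        rw [enc_pair_inj, enc_nat_inj] at h
        have : u = varVertex T z.head z.tail.head := Prod.ext h.1 h.2
        rwa [← this]
      · exact fun h => ⟨_, h, rfl⟩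
    simp only [evalForm, h2]
    congr 1
    rw [Bool.eq_iff_iff, h3, h3]
    exact ⟨H.literal_step hT hE hw hx hz hz', H.literal_step hT hE.symm hw.symm hx' hz' hz⟩
  | succ s ih =>
    have key : ∀ pol, ∀ y ∈ z.toList, ∃ y' ∈ z'.toList,
        evalForm T (chosen vl w) s pol y = evalForm T (chosen vl w') s pol y' := by
      intro pol y hy
      obtain ⟨y', hy', j, j', hj, hj', hE'⟩ := H.child_step hs hE hx hz hz' hy
      exact ⟨y', hy', ih (by omega) pol hE' (hw.mono (Set.subset_insert _ _)) (Or.inl rfl) hj hj'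
        (Or.inl rfl)⟩
    have key' : ∀ pol, ∀ y' ∈ z'.toList, ∃ y ∈ z.toList,
        evalForm T (chosen vl w) s pol y = evalForm T (chosen vl w') s pol y' := by
      intro pol y' hy'
      obtain ⟨y, hy, j', j, hj', hj, hE'⟩ := H.child_step hs hE.symm hx' hz' hz hy'
      refine ⟨y, hy, ih (x := j) (x' := j') (by omega) pol hE'.symm
        (hw.mono fun p hp => Or.inr hp) ?_ hj hj' ?_⟩ <;> exact Or.inl rfl
    cases pol
    · simp only [evalForm]
      rw [Bool.eq_iff_iff, List.any_eq_true, List.any_eq_true]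
      constructor
      · rintro ⟨y, hy, h⟩
        obtain ⟨y', hy', h'⟩ := key true y hy
        exact ⟨y', hy', h' ▸ h⟩
      · rintro ⟨y', hy', h⟩
        obtain ⟨y, hy, h'⟩ := key' true y' hy'
        exact ⟨y, hy, h' ▸ h⟩
    · simp only [evalForm]
      rw [Bool.eq_iff_iff, List.all_eq_true, List.all_eq_true]
      constructor
      · intro h y' hy'
        obtain ⟨y, hy, h'⟩ := key' false y' hy'
        exact h' ▸ h y hy
      · intro h y hy
        obtain ⟨y', hy', h'⟩ := key false y hy
        exact h' ▸ h y' hy'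

/-- The truth value of the game in which the remaining choices are made according to a schedule. -/
def GameHolds (T : ℕ) (vl : List (ℕ × Val)) (φ : Val) : List (ℕ × Bool) → List ℕ → Prop
  | [], w => evalForm T (chosen vl w) T true φ = true
  | (i, true) :: s, w => ∃ b ∈ avail T vl w i, GameHolds T vl φ s (b :: w)
  | (i, false) :: s, w => ∀ b ∈ avail T vl w i, GameHolds T vl φ s (b :: w)

theorem mem_avail {w : List ℕ} {i b : ℕ} : b ∈ avail T vl w i ↔
    b < vl.length ∧ (vl.getD b (0, Val.nil)).1 = T + 2 + i ∧ b ∉ w := by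
  simp only [avail, List.mem_filter, List.mem_range, Bool.and_eq_true, encEq_iff, enc_nat_inj,
    Bool.not_eq_true', List.any_eq_false]
  constructor
  · rintro ⟨h1, h2, h3⟩
    exact ⟨h1, h2, fun h => h3 b h rfl⟩
  · rintro ⟨h1, h2, h3⟩
    exact ⟨h1, h2, fun x hx h => h3 (h ▸ hx)⟩

/-- One round of the game answers the choice of a variable. -/
theorem IsVertexList.avail_step {r i : ℕ} (hE : EF (graphOf T c vl H.pos) (r + 1) P)
    (hw : Paired P w w') {b : ℕ} (hb : b ∈ avail T vl w i) :
    ∃ x y : Fin vl.length, (x : ℕ) = b ∧ (y : ℕ) ∈ avail T vl w' i ∧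
      EF (graphOf T c vl H.pos) r (insert (x, y) P) := by
  obtain ⟨h1, h2, h3⟩ := mem_avail.1 hb
  obtain ⟨y, hy⟩ : ∃ y : Fin vl.length,
      EF (graphOf T c vl H.pos) r (insert ((⟨b, h1⟩ : Fin vl.length), y) P) := hE.1 ⟨b, h1⟩
  refine ⟨⟨b, h1⟩, y, rfl, mem_avail.2 ⟨y.2, ?_, fun hmem => ?_⟩, hy⟩
  · have := H.color_eq hy (Or.inl rfl)
    have h4 : vl.getD b (0, Val.nil) = vl[b] := by simp [h1]
    have h5 : vl.getD y (0, Val.nil) = vl[y] := by simp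
    rw [h5, ← h2, h4]
    exact this.symm
  · obtain ⟨p, hp, hp1, hp2⟩ := hw.symm.exists_mem hmem
    have := ((hy.of_le (Nat.zero_le r) _ (Or.inl rfl)).2 p.swap (Or.inr hp)).1.2 (Fin.ext hp1.symm)
    refine h3 ?_
    have h6 : b = p.2 := congrArg Fin.val this
    rwa [h6]

/-- Equivalent partial choices have the same value in the game. -/
theorem IsVertexList.gameHolds_iff (hT : 1 ≤ T) (s : List (ℕ × Bool))
    (hE : EF (graphOf T c vl H.pos) (T + s.length) P) (hw : Paired P w w')
    (hroot : ((⟨0, H.pos⟩ : Fin vl.length), (⟨0, H.pos⟩ : Fin vl.length)) ∈ P) :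
    GameHolds T vl φ s w ↔ GameHolds T vl φ s w' := by
  induction s generalizing P w w' with
  | nil =>
    simp only [GameHolds]
    rw [H.evalForm_eq hT le_rfl true hE hw hroot H.root H.root]
  | cons a s ih =>
    have hE' : EF (graphOf T c vl H.pos) (T + s.length + 1) P := hE
    have key : ∀ b ∈ avail T vl w a.1, ∃ b' ∈ avail T vl w' a.1,
        (GameHolds T vl φ s (b :: w) ↔ GameHolds T vl φ s (b' :: w')) := by
      intro b hb
      obtain ⟨x, y, rfl, hy, hxy⟩ := H.avail_step hE' hw hb
      exact ⟨y, hy, ih hxy (hw.cons x y) (Or.inr hroot)⟩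
    have key' : ∀ b' ∈ avail T vl w' a.1, ∃ b ∈ avail T vl w a.1,
        (GameHolds T vl φ s (b :: w) ↔ GameHolds T vl φ s (b' :: w')) := by
      intro b hb
      obtain ⟨x, y, rfl, hy, hxy⟩ := H.avail_step hE'.symm hw.symm hb
      exact ⟨y, hy, (ih hxy (hw.symm.cons x y) (Or.inr hroot)).symm⟩
    obtain ⟨i, _ | _⟩ := a
    · simp only [GameHolds]
      constructor
      · intro h b' hb'
        obtain ⟨b, hb, hbb⟩ := key' b' hb'
        exact hbb.1 (h b hb)
      · intro h b hb
        obtain ⟨b', hb', hbb⟩ := key b hb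
        exact hbb.2 (h b' hb')
    · simp only [GameHolds]
      constructor
      · rintro ⟨b, hb, h⟩
        obtain ⟨b', hb', hbb⟩ := key b hb
        exact ⟨b', hb', hbb.1 h⟩
      · rintro ⟨b', hb', h⟩
        obtain ⟨b, hb, hbb⟩ := key' b' hb'
        exact ⟨b, hb, hbb.2 h⟩

end

/-! ### Instances of alternating weighted satisfiability -/

namespace NForm

theorem code_succ {t : ℕ} (φ : NForm (t + 1)) :
    φ.code (t + 1) = Val.ofList (List.map (code t) (show List (NForm t) from φ)) := rfl

theorem code_zero (l : Literal) : code 0 l = Val.cons (enc l.block) (Val.cons (enc l.idx)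
    (Val.cons (enc l.sign) Val.nil)) := rfl

end NForm

theorem boolOf_enc (b : Bool) : (enc b).boolOf = b := by cases b <;> rfl

theorem normForm_code {t : ℕ} (φ : NForm t) : normForm t (φ.code t) = φ.code t := by
  induction t with
  | zero =>
    have h (l : Literal) : normForm 0 (NForm.code 0 l) = NForm.code 0 l := by
      simp only [NForm.code_zero, normForm, Val.head, Val.tail, natOf_enc, boolOf_enc]
      rfl
    exact h φ
  | succ t ih =>
    rw [NForm.code_succ, normForm, Val.toList_ofList, List.map_map]
    congr 1
    exact List.map_congr_left fun ψ _ => ih ψ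

theorem exists_code_eq_normForm (t : ℕ) (v : Val) : ∃ φ : NForm t, φ.code t = normForm t v := by
  induction t generalizing v with
  | zero => exact ⟨(⟨v.head.natOf, v.tail.head.natOf, v.tail.tail.head.boolOf⟩ : Literal), rfl⟩
  | succ t ih =>
    choose f hf using ih
    refine ⟨(v.toList.map f : List (NForm t)), ?_⟩
    change Val.ofList ((v.toList.map f).map (NForm.code t)) = Val.ofList _
    congr 1
    rw [List.map_map]
    exact List.map_congr_left fun z _ => hf z

theorem wfForm_code {bs : List (ℕ × ℕ)} {t : ℕ} (φ : NForm t) :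
    wfForm bs t (φ.code t) = true ↔
      φ.All (fun l => ∃ b, bs[l.block]? = some b ∧ l.idx < b.1) t := by
  induction t with
  | zero =>
    have h (l : Literal) : wfForm bs 0 (NForm.code 0 l) = true ↔
        ∃ b, bs[l.block]? = some b ∧ l.idx < b.1 := by
      simp only [NForm.code_zero, wfForm, Val.head, Val.tail, natOf_enc, decide_eq_true_iff]
      rw [List.getD_eq_getElem?_getD]
      cases bs[l.block]? <;> simp
    exact h φ
  | succ t ih =>
    rw [NForm.code_succ, wfForm, Val.toList_ofList, List.all_map, List.all_eq_true]
    exact forall₂_congr fun ψ _ => ih ψ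

/-- The tree that encodes an instance. -/
def AWInstance.toVal {t : ℕ} (I : AWInstance t) : Val := Val.cons (enc I.blocks) (I.formula.code t)

theorem AWInstance.code_eq {t : ℕ} (I : AWInstance t) : I.code = I.toVal.toWord := rfl

theorem blocksOf_cons (bs : List (ℕ × ℕ)) (v : Val) : blocksOf (Val.cons (enc bs) v) = bs := by
  simp only [blocksOf, Val.head, enc_list, Val.toList_ofList, List.map_map]
  conv_rhs => rw [← List.map_id bs]
  refine List.map_congr_left fun b _ => ?_
  simp only [Function.comp_apply, id]
  exact Prod.ext (natOf_enc _) (natOf_enc _)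

theorem AWInstance.parse_code {t : ℕ} (I : AWInstance t) : Val.parse I.code = I.toVal := by
  rw [I.code_eq, Val.parse_toWord]

theorem AWInstance.blocksOf_toVal {t : ℕ} (I : AWInstance t) : blocksOf I.toVal = I.blocks :=
  blocksOf_cons _ _

theorem validWord_iff {t : ℕ} {y : Word} :
    validWord t y = true ↔ ∃ I : AWInstance t, I.code = y := by
  simp only [validWord, Bool.and_eq_true, encEq_iff, enc_word_inj]
  constructor
  · rintro ⟨h1, h2, h3, h4⟩
    obtain ⟨φ, hφ⟩ := exists_code_eq_normForm t (Val.parse y).tail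
    have h5 : φ.code t = (Val.parse y).tail := hφ.trans h3
    rw [← h5] at h4
    refine ⟨⟨blocksOf (Val.parse y), φ, (wfForm_code φ).1 h4⟩, ?_⟩
    rw [AWInstance.code_eq, AWInstance.toVal]
    simp only [h5]
    rwa [h2]
  · rintro ⟨I, rfl⟩
    rw [I.parse_code, I.blocksOf_toVal]
    exact ⟨rfl, rfl, normForm_code _, (wfForm_code _).2 I.wf⟩

theorem evalForm_code {T : ℕ} {ch : List (ℕ × Val)} {α : ℕ → Finset ℕ}
    (hα : ∀ i j, j ∈ α i ↔ varVertex T (enc i) (enc j) ∈ ch) {t : ℕ} (pol : Bool) (φ : NForm t) :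
    evalForm T ch t pol (φ.code t) = true ↔ φ.Holds α pol t := by
  induction t generalizing pol with
  | zero =>
    have key (l : Literal) : evalForm T ch 0 pol (NForm.code 0 l) = true ↔
        NForm.Holds α pol 0 l := by
      have h : (ch.any fun u => encEq u (varVertex T (enc l.block) (enc l.idx))) = true ↔
          l.idx ∈ α l.block := by
        rw [hα]
        simp only [List.any_eq_true, encEq_iff]
        constructor
        · rintro ⟨u, hu, h⟩
          rw [enc_pair_inj, enc_nat_inj] at h
          have : u = varVertex T (enc l.block) (enc l.idx) := Prod.ext h.1 h.2
          rwa [← this]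
        · exact fun h => ⟨_, h, rfl⟩
      simp only [NForm.code_zero, evalForm, Val.head, Val.tail, boolOf_enc, beq_iff_eq]
      rw [Bool.eq_iff_iff, h]
      cases pol <;> rfl
    exact key φ
  | succ t ih =>
    cases pol
    · rw [NForm.code_succ, evalForm, Val.toList_ofList, List.any_map, List.any_eq_true]
      exact exists_congr fun ψ => and_congr_right fun _ => ih true ψ
    · rw [NForm.code_succ, evalForm, Val.toList_ofList, List.all_map, List.all_eq_true]
      exact forall₂_congr fun ψ _ => ih false ψ

/-! ### Weighted quantifiers as sequences of single choices -/

theorem flag_succ (i : ℕ) : flag (i + 1) = !flag i := by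
  simp [flag, List.replicate_succ', List.foldl_append]

/-- The schedule for the blocks from number `i` on, starting with quantifier `f`. -/
def scheduleFrom : List (ℕ × ℕ) → Bool → ℕ → List (ℕ × Bool)
  | [], _, _ => []
  | (_, k) :: bs, f, i => List.replicate k (i, f) ++ scheduleFrom bs (!f) (i + 1)

theorem schedule_eq (bs : List (ℕ × ℕ)) : schedule bs = scheduleFrom bs true 0 := by
  have key : ∀ rest pre : List (ℕ × ℕ), (List.range' pre.length rest.length).flatMap
      (fun i => List.replicate ((pre ++ rest).getD i (0, 0)).2 (i, flag i)) =
        scheduleFrom rest (flag pre.length) pre.length := by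
    intro rest
    induction rest with
    | nil => intro pre; rfl
    | cons b rest ih =>
      intro pre
      have := ih (pre ++ [b])
      rw [List.length_append, List.length_singleton, flag_succ, List.append_assoc] at this
      rw [List.length_cons, List.range'_succ, List.flatMap_cons, scheduleFrom, ← this]
      simp
  rw [schedule, List.range_eq_range']
  exact key bs []

section

variable {T : ℕ} {bs : List (ℕ × ℕ)} {φ : Val}

/-- The partial choice `w` makes exactly the variables in `α` true. -/
def Represents (T : ℕ) (vl : List (ℕ × Val)) (w : List ℕ) (α : ℕ → Finset ℕ) : Prop :=
  ∀ i j, j ∈ α i ↔ varVertex T (enc i) (enc j) ∈ chosen vl w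

theorem varVertex_inj {i j i' j' : ℕ} :
    varVertex T (enc i) (enc j) = varVertex T (enc i') (enc j') ↔ i = i' ∧ j = j' := by
  simp only [varVertex, natOf_enc, Prod.mk.injEq, Val.cons.injEq, enc_nat_inj]
  omega

theorem varVertex_fst {i j : ℕ} : (varVertex T (enc i) (enc j)).1 = T + 2 + i := by
  simp [varVertex, natOf_enc]

theorem exists_of_color {i b : ℕ} (h : ((vertexList T bs φ).getD b (0, Val.nil)).1 = T + 2 + i) :
    i < bs.length ∧ ∃ j < (bs.getD i (0, 0)).1,
      (vertexList T bs φ).getD b (0, Val.nil) = varVertex T (enc i) (enc j) := by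
  have hb : b < (vertexList T bs φ).length := by
    by_contra hb
    rw [List.getD_eq_default _ _ (by omega)] at h
    simp at h
    omega
  rw [List.getD_eq_getElem _ _ hb] at h ⊢
  have hmem : (vertexList T bs φ)[b] ∈ nodes T φ ++ varList T bs := List.getElem_mem hb
  rcases List.mem_append.1 hmem with hm | hm
  · have := fst_le_of_mem_nodes hm
    omega
  · obtain ⟨i', j, hi, hj, hv⟩ := mem_varList.1 hm
    rw [hv, varVertex_fst] at h
    obtain rfl : i' = i := by omega
    exact ⟨hi, j, hj, hv⟩

theorem nodup_varList : (varList T bs).Nodup := by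
  rw [varList, List.nodup_flatMap]
  refine ⟨fun i _ => List.nodup_range.map fun j j' h => (varVertex_inj.1 h).2, ?_⟩
  refine List.nodup_range.imp fun {i i'} hne v hv hv' => hne ?_
  obtain ⟨j, -, rfl⟩ := List.mem_map.1 hv
  obtain ⟨j', -, h⟩ := List.mem_map.1 hv'
  exact (varVertex_inj.1 h).1.symm

theorem index_unique {i j b b' : ℕ}
    (h : (vertexList T bs φ).getD b (0, Val.nil) = varVertex T (enc i) (enc j))
    (h' : (vertexList T bs φ).getD b' (0, Val.nil) = varVertex T (enc i) (enc j)) : b = b' := by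
  have key : ∀ b, (vertexList T bs φ).getD b (0, Val.nil) = varVertex T (enc i) (enc j) →
      (nodes T φ).length ≤ b ∧ (varList T bs)[b - (nodes T φ).length]? =
        some (varVertex T (enc i) (enc j)) := by
    intro b h
    have hcol : ((vertexList T bs φ).getD b (0, Val.nil)).1 = T + 2 + i := by rw [h, varVertex_fst]
    have hb : (nodes T φ).length ≤ b := by
      by_contra hb
      push Not at hb
      rw [vertexList, List.getD_append _ _ _ _ hb, List.getD_eq_getElem _ _ hb] at hcol
      have := fst_le_of_mem_nodes (List.getElem_mem hb)
      omega
    refine ⟨hb, ?_⟩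
    rw [vertexList, List.getD_append_right _ _ _ _ hb, List.getD_eq_getElem?_getD] at h
    rw [vertexList, List.getD_append_right _ _ _ _ hb, List.getD_eq_getElem?_getD] at hcol
    cases h1 : (varList T bs)[b - (nodes T φ).length]? with
    | none => rw [h1] at hcol; simp at hcol; omega
    | some v => rw [h1] at h; exact congrArg some h
  obtain ⟨h1, h2⟩ := key b h
  obtain ⟨h3, h4⟩ := key b' h'
  obtain ⟨h5, h6⟩ := List.getElem?_eq_some_iff.1 h2
  obtain ⟨h7, h8⟩ := List.getElem?_eq_some_iff.1 h4
  have := (nodup_varList (T := T) (bs := bs)).getElem_inj_iff.1 (h6.trans h8.symm)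
  omega

theorem exists_of_mem_avail {w : List ℕ} {α : ℕ → Finset ℕ} {i b : ℕ}
    (hw : Represents T (vertexList T bs φ) w α) (hb : b ∈ avail T (vertexList T bs φ) w i) :
    ∃ j < (bs.getD i (0, 0)).1, j ∉ α i ∧
      (vertexList T bs φ).getD b (0, Val.nil) = varVertex T (enc i) (enc j) := by
  obtain ⟨-, h2, h3⟩ := mem_avail.1 hb
  obtain ⟨-, j, hj, h⟩ := exists_of_color h2
  refine ⟨j, hj, fun hmem => h3 ?_, h⟩
  obtain ⟨b', hb', h'⟩ := chosen_val.1 ((hw i j).1 hmem)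
  rwa [index_unique h h']

theorem exists_mem_avail {w : List ℕ} {α : ℕ → Finset ℕ} {i j : ℕ}
    (hw : Represents T (vertexList T bs φ) w α) (hi : i < bs.length)
    (hj : j < (bs.getD i (0, 0)).1) (hα : j ∉ α i) :
    ∃ b ∈ avail T (vertexList T bs φ) w i,
      (vertexList T bs φ).getD b (0, Val.nil) = varVertex T (enc i) (enc j) := by
  have hmem : varVertex T (enc i) (enc j) ∈ vertexList T bs φ :=
    List.mem_append_right _ (mem_varList.2 ⟨i, j, hi, hj, rfl⟩)
  obtain ⟨b, hb, h⟩ := List.getElem_of_mem hmem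
  have h' : (vertexList T bs φ).getD b (0, Val.nil) = varVertex T (enc i) (enc j) := by
    rw [List.getD_eq_getElem _ _ hb, h]
  refine ⟨b, mem_avail.2 ⟨hb, by rw [h', varVertex_fst], fun hbw => hα ((hw i j).2 ?_)⟩, h'⟩
  exact chosen_val.2 ⟨b, hbw, h'⟩

theorem Represents.cons {w : List ℕ} {α : ℕ → Finset ℕ} {i j b : ℕ}
    (hw : Represents T (vertexList T bs φ) w α)
    (hb : (vertexList T bs φ).getD b (0, Val.nil) = varVertex T (enc i) (enc j)) :
    Represents T (vertexList T bs φ) (b :: w) (Function.update α i (insert j (α i))) := by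
  intro i' j'
  have : chosen (vertexList T bs φ) (b :: w) =
      varVertex T (enc i) (enc j) :: chosen (vertexList T bs φ) w := by
    simp only [chosen, List.map_cons, hb]
  rw [this, List.mem_cons, varVertex_inj, ← hw]
  by_cases h : i' = i
  · subst h
    simp
  · simp [h]

/-- A weighted existential quantifier as a sequence of choices. -/
theorem gameHolds_replicate_true {i : ℕ} (hi : i < bs.length) {s : List (ℕ × Bool)}
    {R : (ℕ → Finset ℕ) → Prop}
    (hR : ∀ w α, Represents T (vertexList T bs φ) w α → (∀ i' > i, α i' = ∅) →
      (GameHolds T (vertexList T bs φ) φ s w ↔ R α)) (k : ℕ) :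
    ∀ w α, Represents T (vertexList T bs φ) w α → (∀ i' > i, α i' = ∅) →
      α i ⊆ Finset.range (bs.getD i (0, 0)).1 →
      (GameHolds T (vertexList T bs φ) φ (List.replicate k (i, true) ++ s) w ↔
        ∃ S ⊆ Finset.range (bs.getD i (0, 0)).1, α i ⊆ S ∧ S.card = (α i).card + k ∧
          R (Function.update α i S)) := by
  induction k with
  | zero =>
    intro w α hw hα hsub
    rw [List.replicate_zero, List.nil_append, hR w α hw hα]
    constructor
    · exact fun h => ⟨α i, hsub, subset_rfl, rfl, by rwa [Function.update_eq_self]⟩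
    · rintro ⟨S, -, h1, h2, h3⟩
      rwa [← Finset.eq_of_subset_of_card_le h1 (by omega), Function.update_eq_self] at h3
  | succ k ih =>
    intro w α hw hα hsub
    rw [List.replicate_succ, List.cons_append, GameHolds]
    have step : ∀ b j, j < (bs.getD i (0, 0)).1 → j ∉ α i →
        (vertexList T bs φ).getD b (0, Val.nil) = varVertex T (enc i) (enc j) →
        (GameHolds T (vertexList T bs φ) φ (List.replicate k (i, true) ++ s) (b :: w) ↔
          ∃ S ⊆ Finset.range (bs.getD i (0, 0)).1, insert j (α i) ⊆ S ∧
            S.card = (α i).card + (k + 1) ∧ R (Function.update α i S)) := by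
      intro b j hj hjα hbj
      rw [ih _ _ (hw.cons hbj) (fun i' hi' => by
        rw [Function.update_of_ne (by omega)]; exact hα i' hi') (by
        rw [Function.update_self]
        exact Finset.insert_subset (Finset.mem_range.2 hj) hsub)]
      simp only [Function.update_self, Function.update_idem, Finset.card_insert_of_notMem hjα,
        Nat.add_assoc, Nat.add_comm 1 k]
    constructor
    · rintro ⟨b, hb, h⟩
      obtain ⟨j, hj, hjα, hbj⟩ := exists_of_mem_avail hw hb
      obtain ⟨S, h1, h2, h3, h4⟩ := (step b j hj hjα hbj).1 h
      exact ⟨S, h1, (Finset.subset_insert _ _).trans h2, h3, h4⟩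
    · rintro ⟨S, h1, h2, h3, h4⟩
      obtain ⟨j, hjS, hjα⟩ :=
        Finset.exists_mem_notMem_of_card_lt_card (s := α i) (t := S) (by omega)
      have hj := Finset.mem_range.1 (h1 hjS)
      obtain ⟨b, hb, hbj⟩ := exists_mem_avail hw hi hj hjα
      exact ⟨b, hb, (step b j hj hjα hbj).2 ⟨S, h1, Finset.insert_subset hjS h2, h3, h4⟩⟩

/-- A weighted universal quantifier as a sequence of choices. -/
theorem gameHolds_replicate_false {i : ℕ} (hi : i < bs.length) {s : List (ℕ × Bool)}
    {R : (ℕ → Finset ℕ) → Prop}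
    (hR : ∀ w α, Represents T (vertexList T bs φ) w α → (∀ i' > i, α i' = ∅) →
      (GameHolds T (vertexList T bs φ) φ s w ↔ R α)) (k : ℕ) :
    ∀ w α, Represents T (vertexList T bs φ) w α → (∀ i' > i, α i' = ∅) →
      α i ⊆ Finset.range (bs.getD i (0, 0)).1 →
      (GameHolds T (vertexList T bs φ) φ (List.replicate k (i, false) ++ s) w ↔
        ∀ S ⊆ Finset.range (bs.getD i (0, 0)).1, α i ⊆ S → S.card = (α i).card + k →
          R (Function.update α i S)) := by
  induction k with
  | zero =>
    intro w α hw hα hsub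
    rw [List.replicate_zero, List.nil_append, hR w α hw hα]
    constructor
    · intro h S _ h1 h2
      rwa [← Finset.eq_of_subset_of_card_le h1 (by omega), Function.update_eq_self]
    · intro h
      have := h (α i) hsub subset_rfl rfl
      rwa [Function.update_eq_self] at this
  | succ k ih =>
    intro w α hw hα hsub
    rw [List.replicate_succ, List.cons_append, GameHolds]
    have step : ∀ b j, j < (bs.getD i (0, 0)).1 → j ∉ α i →
        (vertexList T bs φ).getD b (0, Val.nil) = varVertex T (enc i) (enc j) →
        (GameHolds T (vertexList T bs φ) φ (List.replicate k (i, false) ++ s) (b :: w) ↔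
          ∀ S ⊆ Finset.range (bs.getD i (0, 0)).1, insert j (α i) ⊆ S →
            S.card = (α i).card + (k + 1) → R (Function.update α i S)) := by
      intro b j hj hjα hbj
      rw [ih _ _ (hw.cons hbj) (fun i' hi' => by
        rw [Function.update_of_ne (by omega)]; exact hα i' hi') (by
        rw [Function.update_self]
        exact Finset.insert_subset (Finset.mem_range.2 hj) hsub)]
      simp only [Function.update_self, Function.update_idem, Finset.card_insert_of_notMem hjα,
        Nat.add_assoc, Nat.add_comm 1 k]
    constructor
    · intro h S h1 h2 h3
      obtain ⟨j, hjS, hjα⟩ :=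
        Finset.exists_mem_notMem_of_card_lt_card (s := α i) (t := S) (by omega)
      have hj := Finset.mem_range.1 (h1 hjS)
      obtain ⟨b, hb, hbj⟩ := exists_mem_avail hw hi hj hjα
      exact (step b j hj hjα hbj).1 (h b hb) S h1 (Finset.insert_subset hjS h2) h3
    · intro h b hb
      obtain ⟨j, hj, hjα, hbj⟩ := exists_of_mem_avail hw hb
      exact (step b j hj hjα hbj).2 fun S h1 h2 h3 =>
        h S h1 ((Finset.subset_insert _ _).trans h2) h3

theorem gameHolds_scheduleFrom {R : (ℕ → Finset ℕ) → Prop}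
    (hR : ∀ w α, Represents T (vertexList T bs φ) w α →
      (GameHolds T (vertexList T bs φ) φ [] w ↔ R α)) (rest : List (ℕ × ℕ)) :
    ∀ (pre : List (ℕ × ℕ)) (f : Bool) (w : List ℕ) (α : ℕ → Finset ℕ), bs = pre ++ rest →
      Represents T (vertexList T bs φ) w α → (∀ i ≥ pre.length, α i = ∅) →
      (GameHolds T (vertexList T bs φ) φ (scheduleFrom rest f pre.length) w ↔
        AltHolds R rest f pre.length α) := by
  induction rest with
  | nil => intro pre f w α _ hw _; exact hR w α hw
  | cons b rest ih =>
    intro pre f w α hbs hw hα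
    obtain ⟨n, k⟩ := b
    have hi : pre.length < bs.length := by simp [hbs]
    have hn : (bs.getD pre.length (0, 0)).1 = n := by simp [hbs]
    have h0 : α pre.length = ∅ := hα _ le_rfl
    have hnext : ∀ f w α, Represents T (vertexList T bs φ) w α → (∀ i' > pre.length, α i' = ∅) →
        (GameHolds T (vertexList T bs φ) φ (scheduleFrom rest f (pre.length + 1)) w ↔
          AltHolds R rest f (pre.length + 1) α) := by
      intro f w α hw hα
      have := ih (pre ++ [(n, k)]) f w α (by simp [hbs]) hw (fun i hi => hα i (by
        simp at hi; omega))
      simpa using this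
    rw [scheduleFrom]
    cases f
    · rw [Bool.not_false, gameHolds_replicate_false hi (hnext true) k w α hw
        (fun i' hi' => hα i' hi'.le) (by simp [h0]), hn, h0, AltHolds]
      simp
    · rw [Bool.not_true, gameHolds_replicate_true hi (hnext false) k w α hw
        (fun i' hi' => hα i' hi'.le) (by simp [h0]), hn, h0, AltHolds]
      simp

end

/-- The game on the vertex list of an instance decides the instance. -/
theorem AWInstance.gameHolds_iff {T : ℕ} (hT : 1 ≤ T) (I : AWInstance T) :
    GameHolds T (vertexList T I.blocks (I.formula.code T)) (I.formula.code T)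
      (schedule I.blocks) [0] ↔ I.Yes := by
  rw [schedule_eq]
  refine gameHolds_scheduleFrom (R := fun α => I.formula.Holds α true T) (fun w α hw => ?_)
    I.blocks [] true [0] (fun _ => ∅) rfl (fun i j => ?_) (fun _ _ => rfl)
  · rw [GameHolds]
    exact evalForm_code hw true I.formula
  · simp only [Finset.notMem_empty, false_iff]
    intro h
    obtain ⟨b, hb, h⟩ := chosen_val.1 h
    obtain rfl : b = 0 := by simpa using hb
    have H := isVertexList hT I.blocks (I.formula.code T)
    rw [List.getD_eq_getElem _ _ H.pos, H.root] at h
    have h1 := congrArg Prod.fst h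
    rw [varVertex_fst] at h1
    have := nodeVertex_fst_le T (I.formula.code T)
    omega

/-! ### Invariants of the search -/

/-- The partial choices of the game with data `x`. -/
inductive IsPosition (T : ℕ) (x : Ctx) : List ℕ → Prop
  | root : IsPosition T x [0]
  | step {w v : List ℕ} : IsPosition T x w → v ∈ children T x w → IsPosition T x v

section

variable {T : ℕ} {x : Ctx} {w v : List ℕ}

theorem mem_children : v ∈ children T x w ↔ w.tail.length < x.2.1.length ∧
    ∃ b ∈ avail T x.1 w (x.2.1.getD w.tail.length (0, true)).1, v = b :: w := by
  unfold children
  by_cases h : w.tail.length < x.2.1.length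
  · rw [decide_eq_true h]
    simp only [cond_true, List.mem_map, h, true_and, eq_comm]
  · rw [decide_eq_false h]
    simp only [cond_false, List.not_mem_nil, h, false_and]

theorem nodup_children : (children T x w).Nodup := by
  unfold children
  cases decide (w.tail.length < x.2.1.length)
  · simp
  · exact (List.nodup_range.filter _).map fun b b' h => (List.cons.inj h).1

theorem length_children_le : (children T x w).length ≤ x.1.length := by
  unfold children
  cases decide (w.tail.length < x.2.1.length)
  · simp
  · rw [cond_true, List.length_map]
    exact (List.length_filter_le _ _).trans List.length_range.le

theorem tail_of_mem_children (h : v ∈ children T x w) : v.tail = w := by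
  obtain ⟨-, b, -, rfl⟩ := mem_children.1 h
  rfl

theorem length_of_mem_children (h : v ∈ children T x w) : v.length = w.length + 1 := by
  obtain ⟨-, b, -, rfl⟩ := mem_children.1 h
  rfl

theorem mem_siblings {done : List (List ℕ)} : v ∈ siblings done w ↔ v ∈ done ∧ v.tail = w.tail := by
  have h : ∀ a b : ℕ, enc a = enc b → a = b := fun _ _ => enc_nat_inj.1
  simp [siblings, encEq_iff, enc_list_inj h]

namespace IsPosition

theorem ne_nil (h : IsPosition T x w) : w ≠ [] := by
  induction h with
  | root => simp
  | step _ hv _ =>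
    obtain ⟨-, b, -, rfl⟩ := mem_children.1 hv
    simp

theorem lt (h : IsPosition T x w) (hx : 0 < x.1.length) : ∀ b ∈ w, b < x.1.length := by
  induction h with
  | root => simpa using hx
  | step _ hv ih =>
    obtain ⟨-, b, hb, rfl⟩ := mem_children.1 hv
    intro b' hb'
    rcases List.mem_cons.1 hb' with rfl | hb'
    · exact (mem_avail.1 hb).1
    · exact ih b' hb'

theorem length_le (h : IsPosition T x w) : w.length ≤ x.2.1.length + 1 := by
  induction h with
  | root => simp
  | step _ hv _ =>
    obtain ⟨h, b, -, rfl⟩ := mem_children.1 hv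
    simp only [List.length_tail, List.length_cons] at h ⊢
    omega

theorem last (h : IsPosition T x w) : w.getD (w.length - 1) 0 = 0 := by
  induction h with
  | root => simp
  | @step w v hw hv ih =>
    obtain ⟨-, b, -, rfl⟩ := mem_children.1 hv
    obtain ⟨b', u, rfl⟩ := List.exists_cons_of_ne_nil hw.ne_nil
    simpa using ih

theorem eq_singleton (h : IsPosition T x w) (hw : w.tail = []) : w = [0] := by
  cases h with
  | root => rfl
  | step h hv =>
    obtain ⟨-, b, -, rfl⟩ := mem_children.1 hv
    exact absurd hw h.ne_nil

theorem mem_children (h : IsPosition T x w) (hw : w.tail ≠ []) : w ∈ children T x w.tail := by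
  cases h with
  | root => simp at hw
  | step h hv => rwa [tail_of_mem_children hv]

end IsPosition

end

/-- Corresponding entries of two tuples of length `k`, given as lists. -/
def ColGraph.pairs {c : ℕ} (G : ColGraph c) (k : ℕ) (w v : List ℕ) : Set (Fin G.n × Fin G.n) :=
  Set.range fun i => (G.tuple k w i, G.tuple k v i)

theorem paired_pairs {c : ℕ} {G : ColGraph c} {k : ℕ} {w v : List ℕ} (hw : w.length = k)
    (hv : v.length = k) (hw' : ∀ b ∈ w, b < G.n) (hv' : ∀ b ∈ v, b < G.n) :
    Paired (G.pairs k w v) w v := by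
  refine List.forall₂_iff_get.2 ⟨hw.trans hv.symm, fun i h1 h2 => ?_⟩
  exact ⟨_, ⟨⟨i, by omega⟩, rfl⟩, ColGraph.tuple_val hw hw' _, ColGraph.tuple_val hv hv' _⟩

/-- What holds throughout the search: accepted partial choices with the same predecessor are
pairwise separated, and every successor of an accepted partial choice is still to be examined or
equivalent to an accepted one. -/
structure SearchInv (L Q : ℕ → ℕ → ℕ → ℕ) {T c : ℕ} {φ : Val} {x : Ctx}
    (H : IsVertexList T c φ x.1) (σ : SearchState) : Prop where
  ctx : σ.2.2 = x
  position : ∀ w ∈ σ.1 ++ σ.2.1, IsPosition T x w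
  nodup : (σ.1 ++ σ.2.1).Nodup
  parent : ∀ w ∈ σ.1 ++ σ.2.1, w.tail ≠ [] → w.tail ∈ σ.2.1
  root : [0] ∈ σ.2.1
  separated : σ.2.1.Pairwise fun w v => v.tail = w.tail → L 0 w.length x.2.2.2 < x.1.length →
    ¬ EF (graphOf T c x.1 H.pos) (Q x.2.2.2 w.length 0)
      ((graphOf T c x.1 H.pos).pairs w.length w v)
  complete : ∀ u ∈ σ.2.1, ∀ w ∈ children T x u, w ∈ σ.1 ∨ ∃ v ∈ σ.2.1, v.tail = u ∧
    EF (graphOf T c x.1 H.pos) x.2.2.2 ((graphOf T c x.1 H.pos).pairs w.length w v)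

section

variable {L Q : ℕ → ℕ → ℕ → ℕ} {T c : ℕ} {φ : Val} {x : Ctx} (H : IsVertexList T c φ x.1)

theorem searchInv_initial : SearchInv L Q H (children T x [0], [[0]], x) := by
  refine ⟨rfl, ?_, ?_, ?_, by simp, by simp, fun u hu w hw => Or.inl ?_⟩
  · intro w hw
    rcases List.mem_append.1 hw with hw | hw
    · exact .step .root hw
    · rw [List.mem_singleton.1 hw]
      exact .root
  · refine List.nodup_append.2 ⟨nodup_children, by simp, fun a ha b hb hab => ?_⟩
    have h1 := length_of_mem_children ha
    rw [hab, List.mem_singleton.1 hb] at h1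
    simp at h1
  · intro w hw hne
    rcases List.mem_append.1 hw with hw | hw
    · simp [tail_of_mem_children hw]
    · rw [List.mem_singleton.1 hw] at hne
      simp at hne
  · rwa [List.mem_singleton.1 hu] at hw

variable {H} {σ : SearchState} {w : List ℕ} {rest : List (List ℕ)}

namespace SearchInv

theorem length_eq_of_tail_eq {w v : List ℕ} (hw : IsPosition T x w) (hv : IsPosition T x v)
    (h : v.tail = w.tail) : v.length = w.length := by
  obtain ⟨b, w, rfl⟩ := List.exists_cons_of_ne_nil hw.ne_nil
  obtain ⟨b', v, rfl⟩ := List.exists_cons_of_ne_nil hv.ne_nil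
  simpa using congrArg List.length h

variable (hσ : SearchInv L Q H (w :: rest, σ.2.1, x))
include hσ

theorem nodup_query : (w :: siblings σ.2.1 w).Nodup := by
  have h := hσ.nodup
  simp only [List.cons_append, List.nodup_cons, List.mem_append, not_or] at h
  exact List.nodup_cons.2 ⟨fun hw => h.1.2 (mem_siblings.1 hw).1,
    (List.nodup_append.1 h.2).2.1.filter _⟩

theorem length_eq {v : List ℕ} (hv : v ∈ w :: siblings σ.2.1 w) : v.length = w.length := by
  rcases List.mem_cons.1 hv with rfl | hv
  · rfl
  · obtain ⟨h1, h2⟩ := mem_siblings.1 hv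
    exact length_eq_of_tail_eq (hσ.position w (by simp)) (hσ.position v (by simp [h1])) h2

theorem lt {v : List ℕ} (hv : v ∈ w :: siblings σ.2.1 w) : ∀ b ∈ v, b < x.1.length := by
  rcases List.mem_cons.1 hv with rfl | hv
  · exact (hσ.position v (by simp)).lt H.pos
  · exact (hσ.position v (by simp [(mem_siblings.1 hv).1])).lt H.pos

theorem length_pos : 0 < w.length := List.length_pos_iff.2 (hσ.position w (by simp)).ne_nil

theorem queryWord_eq (hx : x.2.2.1 = copiesCode T c x.1) :
    queryWord x (siblings σ.2.1 w) w = (copyInstance (graphOf T c x.1 H.pos) hσ.length_pos x.2.2.2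
      ((graphOf T c x.1 H.pos).tuple w.length w)
      ((siblings σ.2.1 w).map ((graphOf T c x.1 H.pos).tuple w.length))
      (nodup_tuples hσ.nodup_query (fun _ => hσ.length_eq) fun _ => hσ.lt)).code :=
  FOLearning.queryWord_eq (G := graphOf T c x.1 H.pos) rfl
    (hx.trans (copiesCode_eq T c x.1 H.pos)) _ rfl _ fun _ hv => ⟨hσ.length_eq hv, hσ.lt hv⟩

theorem param_query_le (hx : x.2.2.1 = copiesCode T c x.1) :
    (FOLearn L Q).param (queryWord x (siblings σ.2.1 w) w) ≤
      x.2.1.length + 1 + x.2.2.2 + (c + 1) := by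
  refine le_trans (Nat.sInf_le (m := LearnInstance.param _)
    ⟨_, (hσ.queryWord_eq hx).symm, rfl⟩) ?_
  have := (hσ.position w (by simp)).length_le
  change w.length + 0 + x.2.2.2 + (c + 1) ≤ _
  omega

/-- All tuples of a query end with the root, which is adjacent to all other vertices. -/
theorem tuple_last {v : List ℕ} (hv : v ∈ w :: siblings σ.2.1 w) :
    (graphOf T c x.1 H.pos).tuple w.length v ⟨w.length - 1, Nat.sub_one_lt_of_lt hσ.length_pos⟩ =
      ⟨0, H.pos⟩ := by
  have hp : IsPosition T x v := by
    rcases List.mem_cons.1 hv with rfl | hv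
    · exact hσ.position v (by simp)
    · exact hσ.position v (by simp [(mem_siblings.1 hv).1])
  refine Fin.ext ?_
  rw [ColGraph.tuple_val (hσ.length_eq hv) (hσ.lt hv)]
  have h1 := hp.last
  have h2 := hσ.length_eq hv
  have h3 := hσ.length_pos
  rw [List.getD_eq_getElem _ _ (by omega)] at h1
  simp only [Fin.getElem_fin, ← h2]
  exact h1

/-- The state after a rejection. -/
theorem reject (hT : 1 ≤ T) (hx : x.2.2.1 = copiesCode T c x.1) {a : Word}
    (ha : a ∈ (FOLearn L Q).sol (queryWord x (siblings σ.2.1 w) w)) (hrej : a.headD false = false) :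
    SearchInv L Q H (rest, σ.2.1, x) := by
  have hlast : ∀ v' ∈ (siblings σ.2.1 w).map ((graphOf T c x.1 H.pos).tuple w.length),
      v' ⟨w.length - 1, Nat.sub_one_lt_of_lt hσ.length_pos⟩ = ⟨0, H.pos⟩ := fun v' hv' => by
    obtain ⟨v, hv, rfl⟩ := List.mem_map.1 hv'
    exact hσ.tuple_last (by simp [hv])
  obtain ⟨v', hv', hE⟩ := exists_ef_of_reject (H.adj_root hT) (hσ.tuple_last (by simp)) hlast
    (ha _ (hσ.queryWord_eq hx).symm) hrej
  obtain ⟨v, hv, rfl⟩ := List.mem_map.1 hv'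
  obtain ⟨hv1, hv2⟩ := mem_siblings.1 hv
  refine ⟨rfl, fun w hw => hσ.position w (by simp at hw ⊢; tauto), (List.nodup_cons.1 hσ.nodup).2,
    fun w hw => hσ.parent w (by simp at hw ⊢; tauto), hσ.root, hσ.separated, fun u hu w' hw' => ?_⟩
  rcases hσ.complete u hu w' hw' with h | h
  · rcases List.mem_cons.1 h with rfl | h
    · exact Or.inr ⟨v, hv1, hv2.trans (tail_of_mem_children hw'), hE⟩
    · exact Or.inl h
  · exact Or.inr h

/-- The state after an acceptance. -/
theorem accept (hx : x.2.2.1 = copiesCode T c x.1) {a : Word}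
    (ha : a ∈ (FOLearn L Q).sol (queryWord x (siblings σ.2.1 w) w)) (hacc : a.headD false = true) :
    SearchInv L Q H (children T x w ++ rest, w :: σ.2.1, x) := by
  have hnd := hσ.nodup
  simp only [List.cons_append, List.nodup_cons, List.mem_append, not_or] at hnd
  have hw := hσ.position w (by simp)
  have hchild : ∀ v ∈ children T x w, v ∉ w :: rest ++ σ.2.1 := fun v hv hmem => by
    have h1 := tail_of_mem_children hv
    exact hnd.1.2 (h1 ▸ hσ.parent v hmem (by rw [h1]; exact hw.ne_nil))
  refine ⟨rfl, fun v hv => ?_, ?_, fun v hv hne => ?_, List.mem_cons_of_mem _ hσ.root, ?_, ?_⟩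
  · simp only [List.mem_append, List.mem_cons] at hv
    rcases hv with (hv | hv) | rfl | hv
    · exact .step hw hv
    · exact hσ.position v (by simp [hv])
    · exact hw
    · exact hσ.position v (by simp [hv])
  · have h1 : (w :: (rest ++ σ.2.1)).Nodup := hσ.nodup
    have h2 : (rest ++ w :: σ.2.1).Nodup := (List.perm_middle.nodup_iff).2 h1
    rw [List.append_assoc]
    refine List.nodup_append.2 ⟨nodup_children, h2, fun v hv v' hv' h => hchild v hv ?_⟩
    rw [h]
    simp at hv' ⊢
    tauto
  · simp only [List.mem_append, List.mem_cons] at hv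
    rcases hv with (hv | hv) | rfl | hv
    · simp [tail_of_mem_children hv]
    · exact List.mem_cons_of_mem _ (hσ.parent v (by simp [hv]) hne)
    · exact List.mem_cons_of_mem _ (hσ.parent v (by simp) hne)
    · exact List.mem_cons_of_mem _ (hσ.parent v (by simp [hv]) hne)
  · refine List.pairwise_cons.2 ⟨fun v hv htail hL => ?_, hσ.separated⟩
    exact not_ef_of_accept hacc (ha _ (hσ.queryWord_eq hx).symm) hL _
      (List.mem_map_of_mem (mem_siblings.2 ⟨hv, htail⟩))
  · intro u hu v hv
    rcases List.mem_cons.1 hu with rfl | hu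
    · exact Or.inl (List.mem_append_left _ hv)
    rcases hσ.complete u hu v hv with h | ⟨v', h1, h2, h3⟩
    · rcases List.mem_cons.1 h with rfl | h
      · refine Or.inr ⟨v, by simp, tail_of_mem_children hv, EF.refl _ ?_⟩
        rintro p ⟨i, rfl⟩
        rfl
      · exact Or.inl (List.mem_append_right _ h)
    · exact Or.inr ⟨v', List.mem_cons_of_mem _ h1, h2, h3⟩

end SearchInv

/-- One step of the search. The second conclusion says that the number of steps plus the number of
partial choices that are still to be examined grows at most by the number of vertices for each
accepted partial choice. -/
theorem SearchInv.searchStep (hT : 1 ≤ T) (hx : x.2.2.1 = copiesCode T c x.1) {O : Word → Word}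
    (hO : (FOLearn L Q).Solves O) {σ : SearchState} (hσ : SearchInv L Q H σ) (hne : σ.1 ≠ []) :
    SearchInv L Q H (searchStep T O σ) ∧
      (searchStep T O σ).1.length + 1 + x.1.length * σ.2.1.length ≤
        σ.1.length + x.1.length * (searchStep T O σ).2.1.length ∧
      (FOLearn L Q).param (prepare σ).2 ≤ x.2.1.length + 1 + x.2.2.2 + (c + 1) := by
  obtain ⟨todo, done, x'⟩ := σ
  obtain rfl : x' = x := hσ.ctx
  obtain ⟨w, rest, rfl⟩ := List.exists_cons_of_ne_nil hne
  have ha := hO (queryWord x' (siblings done w) w)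
  have hσ' : SearchInv L Q H (w :: rest, ((w :: rest, done, x') : SearchState).2.1, x') := hσ
  refine ⟨?_, ?_, hσ'.param_query_le hx⟩
  · cases h : (O (queryWord x' (siblings done w) w)).headD false with
    | false =>
      have := hσ'.reject hT hx ha h
      simpa only [FOLearning.searchStep, prepare, List.headD_cons, h, advance, cond_false,
        List.tail_cons] using this
    | true =>
      have := hσ'.accept hx ha h
      simpa only [FOLearning.searchStep, prepare, List.headD_cons, h, advance, cond_true,
        List.tail_cons] using this
  · cases h : (O (queryWord x' (siblings done w) w)).headD false with
    | false =>
      simp only [FOLearning.searchStep, prepare, List.headD_cons, h, advance, cond_false,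
        List.tail_cons, List.length_cons]
      omega
    | true =>
      have := length_children_le (T := T) (x := x') (w := w)
      simp only [FOLearning.searchStep, prepare, List.headD_cons, h, advance, cond_true,
        List.tail_cons, List.length_cons, List.length_append, Nat.mul_add]
      omega

end

/-! ### Correctness and size of the search -/

/-- The number of accepted partial choices with the same predecessor is bounded by this number for a
graph with `c` colours, queries of quantifier rank `q`, and `K` choices. -/
def branchBound (L Q : ℕ → ℕ → ℕ → ℕ) (c q K : ℕ) : ℕ :=
  ∑ k ∈ Finset.range (K + 2), (numTypes c (Q q k 0) k + L 0 k q)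

/-- A bound for the number of accepted partial choices. -/
def choiceBound (L Q : ℕ → ℕ → ℕ → ℕ) (c q K : ℕ) : ℕ :=
  ∑ j ∈ Finset.range (K + 1), branchBound L Q c q K ^ j

section

variable {L Q : ℕ → ℕ → ℕ → ℕ} {T c : ℕ} {φ : Val} {x : Ctx} {H : IsVertexList T c φ x.1}
  {σ : SearchState}

namespace SearchInv

variable (hσ : SearchInv L Q H σ)
include hσ

theorem position_of_mem {w : List ℕ} (hw : w ∈ σ.2.1) : IsPosition T x w :=
  hσ.position w (List.mem_append_right _ hw)

theorem nodup_done : σ.2.1.Nodup := (List.nodup_append.1 hσ.nodup).2.1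

/-- With more vertices than parameters, accepted successors of the same partial choice have
different types. Otherwise there are at most as many of them as parameters, since there are not more
vertices. -/
theorem length_filter_tail_le (u : List ℕ) :
    (σ.2.1.filter fun v => v.tail = u).length ≤ branchBound L Q c x.2.2.2 x.2.1.length := by
  set l := σ.2.1.filter fun v => v.tail = u with hl
  have hmem : ∀ v ∈ l, v ∈ σ.2.1 ∧ v.tail = u := fun v hv => by simpa [hl] using hv
  have hlen : ∀ v ∈ l, v.length = u.length + 1 := fun v hv => by
    obtain ⟨b, v, rfl⟩ := List.exists_cons_of_ne_nil (hσ.position_of_mem (hmem v hv).1).ne_nil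
    have := (hmem _ hv).2
    simp only [List.tail_cons] at this
    simp [this]
  have hlt : ∀ v ∈ l, ∀ b ∈ v, b < x.1.length := fun v hv =>
    (hσ.position_of_mem (hmem v hv).1).lt H.pos
  have hnd : l.Nodup := hσ.nodup_done.filter _
  rcases l.eq_nil_or_concat with h0 | ⟨l', v₀, h0⟩
  · simp [h0]
  have hv₀ : v₀ ∈ l := by simp [h0]
  have hk : u.length + 1 ∈ Finset.range (x.2.1.length + 2) := by
    have h1 := (hσ.position_of_mem (hmem v₀ hv₀).1).length_le
    have h2 := hlen v₀ hv₀
    rw [Finset.mem_range]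
    omega
  refine le_trans ?_ (Finset.single_le_sum
    (f := fun k => numTypes c (Q x.2.2.2 k 0) k + L 0 k x.2.2.2) (fun _ _ => Nat.zero_le _) hk)
  set k := u.length + 1 with hkdef
  by_cases hL : L 0 k x.2.2.2 < x.1.length
  · have hsep : (l.map fun v => (graphOf T c x.1 H.pos).rankType (Q x.2.2.2 k 0)
        ((graphOf T c x.1 H.pos).tuple k v)).Nodup := by
      refine List.pairwise_map.2 (List.Pairwise.imp_of_mem ?_ (hσ.separated.filter _))
      intro w v hw hv h heq
      have h1 := hlen w hw
      rw [h1] at h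
      exact h ((hmem v hv).2.trans (hmem w hw).2.symm) hL (EF.of_rankType_eq heq)
    have := finite_rankType c (Q x.2.2.2 k 0) k
    have := Fintype.ofFinite (RankType c (Q x.2.2.2 k 0) k)
    have h1 := hsep.length_le_card
    rw [← Nat.card_eq_fintype_card, card_rankType, List.length_map] at h1
    omega
  · have h1 : (l.map fun v => v.headD 0).Nodup := by
      refine List.Nodup.map_on (fun v hv w hw h => ?_) hnd
      obtain ⟨b, v, rfl⟩ := List.exists_cons_of_ne_nil (hσ.position_of_mem (hmem v hv).1).ne_nil
      obtain ⟨b', w, rfl⟩ := List.exists_cons_of_ne_nil (hσ.position_of_mem (hmem w hw).1).ne_nil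
      have h2 := (hmem _ hv).2.trans (hmem _ hw).2.symm
      simp only [List.headD_cons, List.tail_cons] at h h2
      rw [h, h2]
    have h2 : (l.map fun v => v.headD 0) ⊆ List.range x.1.length := by
      intro b hb
      obtain ⟨v, hv, rfl⟩ := List.mem_map.1 hb
      obtain ⟨b, v, rfl⟩ := List.exists_cons_of_ne_nil (hσ.position_of_mem (hmem v hv).1).ne_nil
      exact List.mem_range.2 (hlt _ hv _ (by simp))
    have h3 := (h1.subperm h2).length_le
    simp only [List.length_map, List.length_range] at h3
    omega

theorem length_done_le : σ.2.1.length ≤ choiceBound L Q c x.2.2.2 x.2.1.length := by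
  classical
  set B := branchBound L Q c x.2.2.2 x.2.1.length with hB
  set S := σ.2.1.toFinset with hS
  have hlevel : ∀ j, (S.filter fun w => w.length = j + 1).card ≤ B ^ j := by
    intro j
    induction j with
    | zero =>
      rw [pow_zero, ← Finset.card_singleton ([0] : List ℕ)]
      refine Finset.card_le_card fun w hw => ?_
      simp only [hS, Finset.mem_filter, List.mem_toFinset] at hw
      have := (hσ.position_of_mem hw.1).eq_singleton (List.length_eq_zero_iff.1 (by simp [hw.2]))
      simp [this]
    | succ j ih =>
      rw [pow_succ, mul_comm]
      refine (Finset.card_le_mul_card_image_of_maps_to (f := List.tail)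
        (t := S.filter fun w => w.length = j + 1) ?_ B ?_).trans (Nat.mul_le_mul_left _ ih)
      · intro w hw
        simp only [hS, Finset.mem_filter, List.mem_toFinset] at hw ⊢
        have h1 : w.tail.length = j + 1 := by simp [hw.2]
        exact ⟨hσ.parent w (List.mem_append_right _ hw.1) (List.length_pos_iff.1 (by omega)), h1⟩
      · intro u hu
        simp only [hS, Finset.mem_filter, List.mem_toFinset] at hu
        refine le_trans ?_ (hσ.length_filter_tail_le u)
        rw [← List.toFinset_card_of_nodup (hσ.nodup_done.filter _)]
        refine Finset.card_le_card fun w hw => ?_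
        simp only [hS, Finset.mem_filter, List.mem_toFinset] at hw
        simp [hw.1.1, hw.2]
  rw [← List.toFinset_card_of_nodup hσ.nodup_done]
  refine le_trans (Finset.card_le_card (t := (Finset.range (x.2.1.length + 1)).biUnion fun j =>
    S.filter fun w => w.length = j + 1) fun w hw => ?_) (Finset.card_biUnion_le.trans
      (Finset.sum_le_sum fun j _ => hlevel j))
  have hp := hσ.position_of_mem (List.mem_toFinset.1 hw)
  have h1 := hp.length_le
  have h2 := List.length_pos_iff.2 hp.ne_nil
  refine Finset.mem_biUnion.2 ⟨w.length - 1, Finset.mem_range.2 (by omega), ?_⟩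
  exact Finset.mem_filter.2 ⟨hw, by omega⟩

/-- If nothing is left to be examined, then every successor of an accepted partial choice has the
same value as an accepted successor. -/
theorem exists_equivalent (hT : 1 ≤ T) (hq : x.2.2.2 = T + x.2.1.length) (h0 : σ.1 = [])
    {u w : List ℕ} (hu : u ∈ σ.2.1) (hw : w ∈ children T x u) (m : ℕ) :
    ∃ v ∈ σ.2.1, v.tail = u ∧
      (GameHolds T x.1 φ (x.2.1.drop m) w ↔ GameHolds T x.1 φ (x.2.1.drop m) v) := by
  obtain ⟨v, hv, hvu, hE⟩ := (hσ.complete u hu w hw).resolve_left (by simp [h0])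
  have hwp : IsPosition T x w := .step (hσ.position_of_mem hu) hw
  have hvp := hσ.position_of_mem hv
  have hlen : v.length = w.length :=
    length_eq_of_tail_eq hwp hvp (hvu.trans (tail_of_mem_children hw).symm)
  refine ⟨v, hv, hvu, H.gameHolds_iff hT _ (hE.of_le ?_)
    (paired_pairs rfl hlen (hwp.lt H.pos) (hvp.lt H.pos)) ?_⟩
  · rw [hq, List.length_drop]
    omega
  · have hpos := List.length_pos_iff.2 hwp.ne_nil
    refine ⟨⟨w.length - 1, by omega⟩, Prod.ext (Fin.ext ?_) (Fin.ext ?_)⟩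
    · have := hwp.last
      rw [List.getD_eq_getElem _ _ (by omega)] at this
      exact (ColGraph.tuple_val (G := graphOf T c x.1 H.pos) rfl (hwp.lt H.pos) _).trans this
    · have := hvp.last
      rw [List.getD_eq_getElem _ _ (by omega)] at this
      refine (ColGraph.tuple_val (G := graphOf T c x.1 H.pos) hlen (hvp.lt H.pos) _).trans ?_
      simp only [Fin.getElem_fin, ← hlen]
      exact this

theorem mem_winningLeaves {u : List ℕ} : u ∈ winningLeaves T σ.2.1 x ↔ u ∈ σ.2.1 ∧
    u.length = x.2.1.length + 1 ∧ GameHolds T x.1 φ (x.2.1.drop x.2.1.length) u := by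
  have h1 : (x.1.headD (0, Val.nil)).2 = φ := by
    have h2 := H.root
    have h3 := H.pos
    cases h : x.1 with
    | nil => simp [h] at h3
    | cons a l =>
      simp only [h, List.getElem_cons_zero] at h2
      rw [List.headD_cons, h2, nodeVertex_snd]
  rw [winningLeaves, List.mem_filter, Bool.and_eq_true, encEq_iff, enc_nat_inj, h1,
    List.drop_length, GameHolds, chosen]
  refine and_congr_right fun hu => and_congr_left fun _ => ?_
  have := List.length_pos_iff.2 (hσ.position_of_mem hu).ne_nil
  rw [List.length_tail]
  omega

theorem mem_winningStep (hT : 1 ≤ T) (hq : x.2.2.2 = T + x.2.1.length) (h0 : σ.1 = []) {j : ℕ}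
    (hj : j < x.2.1.length) {win : List (List ℕ)}
    (hwin : ∀ u, u ∈ win ↔ u ∈ σ.2.1 ∧ u.length = j + 1 + 1 ∧
      GameHolds T x.1 φ (x.2.1.drop (j + 1)) u) (u : List ℕ) :
    u ∈ winningStep σ.2.1 x win j ↔ u ∈ σ.2.1 ∧ u.length = j + 1 ∧
      GameHolds T x.1 φ (x.2.1.drop j) u := by
  have hinj : ∀ a b : List ℕ, encEq a b = true ↔ a = b := fun a b => by
    rw [encEq_iff, enc_list_inj fun _ _ : ℕ => enc_nat_inj.1]
  rw [winningStep, List.mem_filter, Bool.and_eq_true, encEq_iff, enc_nat_inj]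
  refine and_congr_right fun hu => and_congr_right fun hlen => ?_
  rw [List.drop_eq_getElem_cons hj, List.getD_eq_getElem _ _ hj]
  have hut : u.tail.length = j := by rw [List.length_tail]; omega
  have hne := (hσ.position_of_mem hu).ne_nil
  -- the accepted partial choices with predecessor `u` are successors in the game
  have hdone : ∀ w ∈ σ.2.1, w.tail = u → w.length = j + 1 + 1 ∧
      ∃ b ∈ avail T x.1 u x.2.1[j].1, w = b :: u := by
    intro w hw hwu
    have h1 := (hσ.position_of_mem hw).mem_children (hwu ▸ hne)
    rw [hwu, mem_children, hut, List.getD_eq_getElem _ _ hj] at h1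
    obtain ⟨-, b, hb, rfl⟩ := h1
    exact ⟨by simp [hlen], b, hb, rfl⟩
  have hchild : ∀ b ∈ avail T x.1 u x.2.1[j].1, ∃ v ∈ σ.2.1, v.tail = u ∧
      (GameHolds T x.1 φ (x.2.1.drop (j + 1)) (b :: u) ↔
        GameHolds T x.1 φ (x.2.1.drop (j + 1)) v) := by
    intro b hb
    refine hσ.exists_equivalent hT hq h0 hu (mem_children.2 ⟨by omega, b, ?_, rfl⟩) _
    rwa [hut, List.getD_eq_getElem _ _ hj]
  rcases hs : x.2.1[j] with ⟨i, _ | _⟩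
  · simp only [cond_false, List.all_eq_true, Bool.or_eq_true, Bool.not_eq_true', List.any_eq_true,
      GameHolds]
    rw [hs] at hdone hchild
    constructor
    · intro h b hb
      obtain ⟨v, hv, hvu, hiff⟩ := hchild b hb
      rcases h v hv with h' | ⟨v', hv', h'⟩
      · exact absurd ((hinj _ _).2 hvu) (by simp [h'])
      · rw [hinj] at h'
        subst h'
        exact hiff.2 ((hwin v).1 hv').2.2
    · intro h w hw
      by_cases hwu : w.tail = u
      · obtain ⟨h1, b, hb, rfl⟩ := hdone w hw hwu
        exact Or.inr ⟨_, (hwin _).2 ⟨hw, h1, h b hb⟩, (hinj _ _).2 rfl⟩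
      · exact Or.inl (Bool.eq_false_iff.2 fun h' => hwu ((hinj _ _).1 h'))
  · simp only [cond_true, List.any_eq_true, GameHolds, hinj]
    rw [hs] at hdone hchild
    constructor
    · rintro ⟨w, hw, hwu⟩
      obtain ⟨h1, -, h2⟩ := (hwin w).1 hw
      obtain ⟨-, b, hb, rfl⟩ := hdone w h1 hwu
      exact ⟨b, hb, h2⟩
    · rintro ⟨b, hb, h⟩
      obtain ⟨v, hv, hvu, hiff⟩ := hchild b hb
      exact ⟨v, (hwin v).2 ⟨hv, (hdone v hv hvu).1, hiff.1 h⟩, hvu⟩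

/-- The final state of the search determines the value of the game. -/
theorem verdict_iff (hT : 1 ≤ T) (hq : x.2.2.2 = T + x.2.1.length) (h0 : σ.1 = []) :
    verdict T σ = true ↔ GameHolds T x.1 φ x.2.1 [0] := by
  have key : ∀ m ≤ x.2.1.length, ∀ win : List (List ℕ), (∀ u, u ∈ win ↔ u ∈ σ.2.1 ∧
      u.length = m + 1 ∧ GameHolds T x.1 φ (x.2.1.drop m) u) →
      ∀ u, u ∈ (List.range m).reverse.foldl (winningStep σ.2.1 x) win ↔ u ∈ σ.2.1 ∧
        u.length = 0 + 1 ∧ GameHolds T x.1 φ x.2.1 u := by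
    intro m
    induction m with
    | zero => intro _ win hwin u; simpa using hwin u
    | succ m ih =>
      intro hm win hwin
      rw [List.range_succ, List.reverse_append, List.reverse_singleton, List.singleton_append,
        List.foldl_cons]
      exact ih (by omega) _ (hσ.mem_winningStep hT hq h0 (by omega) hwin)
  have h := key _ le_rfl _ (fun u => hσ.mem_winningLeaves)
  rw [verdict, hσ.ctx, Bool.not_eq_true', List.isEmpty_eq_false_iff_exists_mem]
  constructor
  · rintro ⟨u, hu⟩
    obtain ⟨h1, h2, h3⟩ := (h u).1 hu
    rwa [(hσ.position_of_mem h1).eq_singleton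
      (List.length_eq_zero_iff.1 (by rw [List.length_tail]; omega))] at h3
  · exact fun h1 => ⟨[0], (h _).2 ⟨hσ.root, rfl, h1⟩⟩

end SearchInv

end

/-! ### The oracle algorithm decides alternating weighted satisfiability -/

theorem SearchInv.sz_le {L Q : ℕ → ℕ → ℕ → ℕ} {T c : ℕ} {φ : Val} {x : Ctx}
    {H : IsVertexList T c φ x.1} {σ : SearchState} (hσ : SearchInv L Q H σ) {Z D : ℕ}
    (hZ : sz x ≤ Z) (hdone : σ.2.1.length ≤ D) (htodo : σ.1.length ≤ x.1.length * D) :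
    sz σ ≤ (Z + D + 2) ^ 9 := by
  set X := Z + D + 2 with hX
  have h1 := sz_pair x
  have h2 := sz_pair x.2
  have h3 := length_le_sz x.1
  have h4 := length_le_sz x.2.1
  have hword : ∀ w ∈ σ.1 ++ σ.2.1, sz w + 1 ≤ X ^ 4 := by
    intro w hw
    have hp := hσ.position w hw
    have h5 : sz w ≤ w.length * (2 * X + 1) + 1 := sz_list_le fun b hb => by
      have := hp.lt H.pos b hb
      rw [sz_nat]
      omega
    have h6 : w.length + 1 ≤ X := by
      have := hp.length_le
      omega
    have h7 : (w.length + 1) * (2 * X + 1) ≤ X * (2 * X + 1) := Nat.mul_le_mul_right _ h6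
    have h8 : X * (2 * X + 1) ≤ X * X ^ 3 := by
      refine Nat.mul_le_mul_left _ ?_
      have : 2 * 2 * X ≤ X * X * X := by gcongr <;> omega
      have h9 : X ^ 3 = X * X * X := by ring
      omega
    have h10 : X ^ 4 = X * X ^ 3 := by ring
    rw [Nat.succ_mul] at h7
    omega
  have hX4 : 1 ≤ X ^ 4 := Nat.one_le_pow _ _ (by omega)
  have hlist : ∀ l : List (List ℕ), (∀ w ∈ l, w ∈ σ.1 ++ σ.2.1) → l.length ≤ X ^ 2 →
      sz l ≤ X ^ 6 + 1 := by
    intro l hl hlen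
    refine (sz_list_le (m := X ^ 4 - 1) fun w hw => ?_).trans ?_
    · have := hword w (hl w hw)
      omega
    · rw [Nat.sub_add_cancel hX4, show X ^ 6 = X ^ 2 * X ^ 4 by ring]
      exact Nat.add_le_add_right (Nat.mul_le_mul_right _ hlen) 1
  have h5 := hlist σ.1 (by simp_all) (htodo.trans (by rw [pow_two]; gcongr <;> omega))
  have h6 := hlist σ.2.1 (by simp_all) (hdone.trans (by
    rw [pow_two]
    exact (by omega : D ≤ X).trans (Nat.le_mul_of_pos_left _ (by omega))))
  have h7 := sz_pair σ
  have h8 := sz_pair σ.2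
  rw [hσ.ctx] at h8
  have h9 : X ≤ X ^ 6 := Nat.le_self_pow (by omega) _
  have h10 : 2 ^ 3 * X ^ 6 ≤ X ^ 3 * X ^ 6 :=
    Nat.mul_le_mul_right _ (Nat.pow_le_pow_left (by omega) 3)
  have h11 : X ^ 9 = X ^ 3 * X ^ 6 := by ring
  have h12 : X = Z + D + 2 := hX
  omega

theorem verdict_of_done_nil {T : ℕ} {todo : List (List ℕ)} {x : Ctx} :
    verdict T (todo, [], x) = false := by
  have h : ∀ l : List ℕ, l.foldl (winningStep [] x) [] = [] := by
    intro l
    induction l with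
    | nil => rfl
    | cons a l ih => exact ih
  simp [verdict, winningLeaves, h]

theorem length_schedule (bs : List (ℕ × ℕ)) : (schedule bs).length = (bs.map Prod.snd).sum := by
  have h : ∀ (bs : List (ℕ × ℕ)) (f : Bool) (i : ℕ),
      (scheduleFrom bs f i).length = (bs.map Prod.snd).sum := by
    intro bs
    induction bs with
    | nil => intro f i; rfl
    | cons b bs ih =>
      intro f i
      simp [scheduleFrom, ih]
  rw [schedule_eq, h]

/-- A bound for the parameter of the queries for an instance with `r` blocks and `K` choices. -/
def queryParamBound (T r K : ℕ) : ℕ := K + 1 + (T + K) + (T + 2 + r + 1)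

/-- The search ends after boundedly many steps with the correct verdict. -/
theorem exists_final_state {L Q : ℕ → ℕ → ℕ → ℕ} {T : ℕ} (hT : 1 ≤ T) {O : Word → Word}
    (hO : (FOLearn L Q).Solves O) (I : AWInstance T) {Z D : ℕ} (hZ : sz (initial T I.code) ≤ Z)
    (hD : choiceBound L Q (T + 2 + I.blocks.length) (T + (schedule I.blocks).length)
      (schedule I.blocks).length ≤ D) :
    ∃ N ≤ Z * D, (∀ i < N, (searchState T O I.code i).1 ≠ [] ∧
        (FOLearn L Q).param (prepare (searchState T O I.code i)).2 ≤
          queryParamBound T I.blocks.length (schedule I.blocks).length) ∧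
      (searchState T O I.code N).1 = [] ∧
      (∀ i ≤ N, sz (searchState T O I.code i) ≤ (Z + D + 2) ^ 9) ∧
      (verdict T (searchState T O I.code N) = true ↔ I.Yes) := by
  set φ := I.formula.code T with hφ
  obtain ⟨x, hx⟩ : ∃ x : Ctx, x = (vertexList T I.blocks φ, schedule I.blocks,
      copiesCode T (T + 2 + I.blocks.length) (vertexList T I.blocks φ),
      T + (schedule I.blocks).length) := ⟨_, rfl⟩
  have hx1 : x.1 = vertexList T I.blocks φ := by rw [hx]
  have hx2 : x.2.1 = schedule I.blocks := by rw [hx]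
  have hx3 : x.2.2.1 = copiesCode T (T + 2 + I.blocks.length) x.1 := by rw [hx]
  have hx4 : x.2.2.2 = T + x.2.1.length := by rw [hx]
  have H : IsVertexList T (T + 2 + I.blocks.length) φ x.1 := hx1 ▸ isVertexList hT I.blocks φ
  have hinit : initial T I.code = (children T x [0], [[0]], x) := by
    have h : mkCtx T (Val.parse I.code) = x := by
      rw [I.parse_code, mkCtx, I.blocksOf_toVal, hx]
      rfl
    rw [initial, validWord_iff.2 ⟨I, rfl⟩, cond_true, h]
  have hsz : sz x ≤ Z := by
    rw [hinit, sz_pair, sz_pair] at hZ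
    simp only at hZ
    omega
  have hn : x.1.length ≤ Z := by
    have h1 := sz_pair x
    have h2 := length_le_sz x.1
    omega
  set S := searchState T O I.code with hS
  have hinv : ∀ i, (∀ j < i, (S j).1 ≠ []) → SearchInv L Q H (S i) ∧
      i + (S i).1.length ≤ x.1.length * (S i).2.1.length := by
    intro i
    induction i with
    | zero =>
      intro _
      have h0 : S 0 = (children T x [0], [[0]], x) := hinit
      rw [h0]
      refine ⟨searchInv_initial H, ?_⟩
      have := length_children_le (T := T) (x := x) (w := [0])
      simpa using this
    | succ i ih =>
      intro hi
      obtain ⟨h1, h2⟩ := ih fun j hj => hi j (by omega)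
      obtain ⟨h3, h4, -⟩ := h1.searchStep hT hx3 hO (hi i (by omega))
      have h5 : S (i + 1) = searchStep T O (S i) := searchState_succ T O I.code i
      rw [h5]
      exact ⟨h3, by omega⟩
  have hdone : ∀ i, (∀ j < i, (S j).1 ≠ []) → (S i).2.1.length ≤ D := fun i hi => by
    have := (hinv i hi).1.length_done_le
    rw [hx4, hx2] at this
    exact this.trans hD
  have hcount : ∀ i, (∀ j < i, (S j).1 ≠ []) → i + (S i).1.length ≤ x.1.length * D := fun i hi =>
    (hinv i hi).2.trans (Nat.mul_le_mul_left _ (hdone i hi))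
  have hex : ∃ N, (S N).1 = [] := by
    by_contra! h
    have := hcount (x.1.length * D + 1) fun j _ => h j
    omega
  classical
  have hlt : ∀ j < Nat.find hex, (S j).1 ≠ [] := fun j hj => Nat.find_min hex hj
  refine ⟨Nat.find hex, ?_, fun i hi => ⟨hlt i hi, ?_⟩, Nat.find_spec hex, fun i hi => ?_, ?_⟩
  · have h1 := hcount _ hlt
    have h2 : x.1.length * D ≤ Z * D := Nat.mul_le_mul_right _ hn
    omega
  · obtain ⟨-, -, h⟩ := (hinv i fun j hj => hlt j (hj.trans hi)).1.searchStep hT hx3 hO (hlt i hi)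
    rw [hx4, hx2] at h
    exact h
  · have hi' : ∀ j < i, (S j).1 ≠ [] := fun j hj => hlt j (by omega)
    have := hcount i hi'
    exact (hinv i hi').1.sz_le hsz (hdone i hi') (by omega)
  · rw [(hinv _ hlt).1.verdict_iff hT hx4 (Nat.find_spec hex), hx1, hx2]
    exact I.gameHolds_iff hT

theorem AWInstance.blocks_eq {T : ℕ} (I : AWInstance T) :
    I.blocks = blocksOf (Val.parse I.code) := by
  rw [I.parse_code, I.blocksOf_toVal]

theorem AWInstance.yes_iff {T : ℕ} (hT : 1 ≤ T) {I J : AWInstance T} (h : I.code = J.code) :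
    I.Yes ↔ J.Yes := by
  rw [← I.gameHolds_iff hT, ← J.gameHolds_iff hT]
  have h1 : I.toVal = J.toVal := by rw [← I.parse_code, h, J.parse_code]
  rw [I.blocks_eq, J.blocks_eq, h, (Val.cons.inj h1).2]

/-- An oracle program that decides alternating weighted satisfiability. The numbers `g` and `D` do
not occur in the program, which needs to compute neither `L` nor `Q`. -/
theorem exists_decision_program (L Q : ℕ → ℕ → ℕ → ℕ) {T : ℕ} (hT : 1 ≤ T) :
    ∃ (p : Prog) (d : ℕ), ∀ O : Word → Word, (FOLearn L Q).Solves O → ∀ (y : Word) (g D : ℕ),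
      (∀ I : AWInstance T, I.code = y →
        queryParamBound T I.blocks.length (schedule I.blocks).length ≤ g ∧
        choiceBound L Q (T + 2 + I.blocks.length) (T + (schedule I.blocks).length)
          (schedule I.blocks).length ≤ D) →
      ∃ b : Bool, (b = true ↔ y ∈ (AWSat T).lang) ∧
        Calc (fun w a => (FOLearn L Q).param w ≤ g ∧ a = O w) p (enc y) (enc b)
          ((sz y + D + 2) ^ d) := by
  obtain ⟨p, d, hp⟩ := exists_search_program T
  obtain ⟨e, he⟩ := (PT.initial T).polyBound
  refine ⟨p, (e + 2) * 9 * d + 2 * d, fun O hO y g D hy => ?_⟩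
  -- the states have size at most `(Z + D + 2) ^ 9`, and there are at most `Z * D` steps
  set Y := sz y + D + 2 with hY
  set Z := (sz y + 2) ^ e with hZdef
  have hZ : sz (initial T y) ≤ Z := he y
  have hZY : Z + D + 2 ≤ Y ^ (e + 2) := by
    have h1 : Z ≤ Y ^ e := Nat.pow_le_pow_left (by omega) e
    have h2 : 1 ≤ Y ^ e := Nat.one_le_pow _ _ (by omega)
    have h3 : Y ^ (e + 2) = Y * (Y * Y ^ e) := by ring
    have h4 : 2 * (Y * Y ^ e) ≤ Y * (Y * Y ^ e) := Nat.mul_le_mul_right _ (by omega)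
    have h5 : Y * 1 ≤ Y * Y ^ e := Nat.mul_le_mul_left _ h2
    have h6 : 1 * Y ^ e ≤ Y * Y ^ e := Nat.mul_le_mul_right _ (by omega)
    omega
  have htime : ∀ N B, N ≤ Z * D → B ≤ (Z + D + 2) ^ 9 →
      (sz y + N + B + 2) ^ d ≤ Y ^ ((e + 2) * 9 * d + 2 * d) := by
    intro N B hN hB
    rw [← Nat.add_mul, pow_mul]
    refine Nat.pow_le_pow_left ?_ d
    set X := Y ^ (e + 2) with hX
    have h1 : B ≤ X ^ 9 := hB.trans (Nat.pow_le_pow_left hZY 9)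
    have h2 : N ≤ X ^ 2 := hN.trans (by rw [pow_two]; exact Nat.mul_le_mul (by omega) (by omega))
    have h3 : Y ≤ X := Nat.le_self_pow (by omega) _
    have h4 : X ^ 2 ≤ X ^ 9 := Nat.pow_le_pow_right (by omega) (by omega)
    have h5 : X ≤ X ^ 9 := Nat.le_self_pow (by omega) _
    have h6 : Y ^ ((e + 2) * 9 + 2) = X ^ 9 * (Y * Y) := by
      rw [hX, ← pow_mul, pow_add, pow_two]
    have h7 : 2 * 2 ≤ Y * Y := Nat.mul_le_mul (by omega) (by omega)
    have h8 : X ^ 9 * (2 * 2) ≤ X ^ 9 * (Y * Y) := Nat.mul_le_mul_left _ h7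
    omega
  by_cases hv : ∃ I : AWInstance T, I.code = y
  · obtain ⟨I, rfl⟩ := hv
    obtain ⟨hg, hD⟩ := hy I rfl
    obtain ⟨N, hN, hlt, hend, hsz, hverdict⟩ := exists_final_state hT hO I hZ hD
    refine ⟨_, hverdict.trans ⟨fun h => ⟨I, rfl, h⟩, ?_⟩,
      (hp O (fun w => (FOLearn L Q).param w ≤ g) I.code N _
        (fun i hi => ⟨(hlt i hi).1, (hlt i hi).2.trans hg⟩) hend hsz).mono (htime N _ hN le_rfl)⟩
    rintro ⟨J, hJ, h⟩
    exact (AWInstance.yes_iff hT hJ).1 h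
  · have h0 : initial T y = ([], [], mkCtx T (Val.parse y)) := by
      rw [initial, Bool.eq_false_iff.2 fun h => hv (validWord_iff.1 h), cond_false]
    refine ⟨_, ?_, (hp O (fun w => (FOLearn L Q).param w ≤ g) y 0 Z (by simp) ?_ ?_).mono
      (htime 0 _ (Nat.zero_le _) ?_)⟩
    · change verdict T (initial T y) = true ↔ _
      rw [h0, verdict_of_done_nil]
      simp only [Bool.false_eq_true, false_iff]
      rintro ⟨J, hJ, -⟩
      exact hv ⟨J, hJ⟩
    · change (initial T y).1 = []
      rw [h0]
    · intro i hi
      obtain rfl : i = 0 := by omega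
      exact hZ
    · exact (by omega : Z ≤ Z + D + 2).trans (Nat.le_self_pow (by omega) _)

/-! ### Outputs are not longer than the running time allows -/

/-- The depth of a tree. -/
def Val.depth : Val → ℕ
  | .nil => 0
  | .cons a b => max a.depth b.depth + 1

theorem Expr.depth_eval_le {s : Store} {m : ℕ} (hs : ∀ i, (s i).depth ≤ m) (e : Expr) :
    (e.eval s).depth ≤ m + e.cost := by
  induction e with
  | reg i => exact (hs i).trans (Nat.le_add_right _ _)
  | nil => simp [eval, Val.depth]
  | cons a b iha ihb =>
    simp only [eval, Val.depth, cost]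
    omega
  | head a ih =>
    simp only [eval, cost]
    cases h : a.eval s with
    | nil => simp [Val.depth]
    | cons u v =>
      rw [h, Val.depth] at ih
      simp only
      omega
  | tail a ih =>
    simp only [eval, cost]
    cases h : a.eval s with
    | nil => simp [Val.depth]
    | cons u v =>
      rw [h, Val.depth] at ih
      simp only
      omega

theorem Run.depth_le {p : Prog} {s s' : Store} {t : ℕ} (h : Run noOracle p s s' t) :
    ∀ {m : ℕ}, (∀ i, (s i).depth ≤ m) → ∀ i, (s' i).depth ≤ m + t := by
  induction h with
  | assign i e s =>
    intro m hs j
    by_cases hj : j = i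
    · subst hj
      rw [Function.update_self]
      have := Expr.depth_eval_le hs e
      omega
    · rw [Function.update_of_ne hj]
      exact (hs j).trans (Nat.le_add_right _ _)
  | seq _ _ ih₁ ih₂ => intro m hs i; have := ih₂ (ih₁ hs) i; omega
  | condTrue _ _ ih => intro m hs i; have := ih hs i; omega
  | condFalse _ _ ih => intro m hs i; have := ih hs i; omega
  | loopDone _ => intro m hs i; have := hs i; omega
  | loopStep _ _ _ ih₁ ih₂ => intro m hs i; have := ih₂ (ih₁ hs) i; omega
  | query _ h => exact h.elim

theorem depth_ofBool_le (b : Bool) : (Val.ofBool b).depth ≤ 1 := by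
  cases b <;> simp [Val.ofBool, Val.depth]

theorem depth_ofWord_le (w : Word) : (Val.ofWord w).depth ≤ w.length + 1 := by
  induction w with
  | nil => simp [Val.ofWord, Val.ofList, Val.depth]
  | cons b w ih =>
    have := depth_ofBool_le b
    simp only [Val.ofWord, List.map_cons, Val.ofList, Val.depth, List.length_cons] at ih ⊢
    omega

theorem length_le_depth_ofWord (w : Word) : w.length ≤ (Val.ofWord w).depth := by
  induction w with
  | nil => simp
  | cons b w ih =>
    simp only [Val.ofWord, List.map_cons, Val.ofList, Val.depth, List.length_cons] at ih ⊢
    omega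

theorem length_output_le {p : Prog} {x y : Word} {s : Store} {t : ℕ}
    (h : Run noOracle p (initStore x) s t) (hs : s 0 = Val.ofWord y) :
    y.length ≤ x.length + 1 + t := by
  refine (length_le_depth_ofWord y).trans (hs ▸ h.depth_le (fun i => ?_) 0)
  by_cases hi : i = 0
  · subst hi
    simpa [initStore] using depth_ofWord_le x
  · simp [initStore, hi, Val.depth]

/-! ### Computability of the bounds -/

section

variable {α : Type} [Primcodable α]

theorem computable_sum {f : α → ℕ → ℕ} {n : α → ℕ} (hf : Computable₂ f) (hn : Computable n) :
    Computable fun a => ∑ i ∈ Finset.range (n a), f a i := by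
  refine (Computable.nat_rec (g := fun _ => 0) (h := fun a z => z.2 + f a z.1) hn
    (Computable.const 0) (Primrec.nat_add.to_comp.comp (Computable.snd.comp Computable.snd)
      (hf.comp Computable.fst (Computable.fst.comp Computable.snd))).to₂).of_eq fun a => ?_
  induction n a with
  | zero => rfl
  | succ m ih =>
    rw [Finset.sum_range_succ, ← ih]

theorem computable_pow {f g : α → ℕ} (hf : Computable f) (hg : Computable g) :
    Computable fun a => f a ^ g a := by
  have h : Primrec₂ fun m n : ℕ => m ^ n :=
    Primrec₂.unpaired'.1 Nat.Primrec.pow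
  exact h.to_comp.comp hf hg

theorem computable_numTypes {c r j : α → ℕ} (hc : Computable c) (hr : Computable r)
    (hj : Computable j) : Computable fun a => numTypes (c a) (r a) (j a) := by
  have hadd : ∀ {f g : α → ℕ}, Computable f → Computable g → Computable fun a => f a + g a :=
    fun hf hg => Primrec.nat_add.to_comp.comp hf hg
  have hmul : ∀ {f g : α → ℕ}, Computable f → Computable g → Computable fun a => f a * g a :=
    fun hf hg => Primrec.nat_mul.to_comp.comp hf hg
  have h : Primrec₂ fun m n : ℕ => (fun k => 2 ^ k)^[m] n := by
    have hp : Primrec₂ fun m n : ℕ => m ^ n := Primrec₂.unpaired'.1 Nat.Primrec.pow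
    exact Primrec.nat_iterate Primrec.fst Primrec.snd
      (hp.comp (Primrec.const 2) Primrec.snd).to₂
  refine h.to_comp.comp hr (hmul (computable_pow (computable_pow (.const _) (hadd hj hr))
    (hadd hj hr)) (computable_pow (computable_pow (.const 2) (hadd hj hr)) hc))

theorem computable_choiceBound {L Q : ℕ → ℕ → ℕ → ℕ}
    (hL : Computable fun v : ℕ × ℕ × ℕ => L v.1 v.2.1 v.2.2)
    (hQ : Computable fun v : ℕ × ℕ × ℕ => Q v.1 v.2.1 v.2.2) {c q K : α → ℕ} (hc : Computable c)
    (hq : Computable q) (hK : Computable K) :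
    Computable fun a => choiceBound L Q (c a) (q a) (K a) := by
  have hbranch : Computable fun a => branchBound L Q (c a) (q a) (K a) := by
    refine computable_sum (Computable₂.mk (f := fun a k => numTypes (c a) (Q (q a) k 0) k +
      L 0 k (q a)) ?_) (Primrec.nat_add.to_comp.comp hK (.const 2))
    have hk : Computable fun z : α × ℕ => z.2 := Computable.snd
    have hq' : Computable fun z : α × ℕ => q z.1 := hq.comp Computable.fst
    exact Primrec.nat_add.to_comp.comp (computable_numTypes (hc.comp Computable.fst)
      (hQ.comp (hq'.pair (hk.pair (.const 0)))) hk)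
      (hL.comp ((Computable.const 0).pair (hk.pair hq')))
  refine computable_sum (Computable₂.mk (f := fun a j => branchBound L Q (c a) (q a) (K a) ^ j) ?_)
    (Primrec.nat_add.to_comp.comp hK (.const 1))
  exact computable_pow (hbranch.comp Computable.fst) Computable.snd

end

/-- A bound for the number of accepted partial choices in terms of the parameter. Summing over all
smaller numbers of blocks and choices makes it monotone although `L` and `Q` need not be. -/
def totalBound (L Q : ℕ → ℕ → ℕ → ℕ) (T m : ℕ) : ℕ :=
  ∑ r ∈ Finset.range (m + 1), ∑ K ∈ Finset.range (m + 1), choiceBound L Q (T + 2 + r) (T + K) K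

theorem choiceBound_le_totalBound (L Q : ℕ → ℕ → ℕ → ℕ) (T : ℕ) {r K m : ℕ} (hr : r ≤ m)
    (hK : K ≤ m) : choiceBound L Q (T + 2 + r) (T + K) K ≤ totalBound L Q T m :=
  (Finset.single_le_sum (f := fun K => choiceBound L Q (T + 2 + r) (T + K) K)
      (fun _ _ => Nat.zero_le _) (Finset.mem_range.2 (Nat.lt_succ_of_le hK))).trans
    (Finset.single_le_sum (f := fun r => ∑ K ∈ Finset.range (m + 1),
      choiceBound L Q (T + 2 + r) (T + K) K) (fun _ _ => Nat.zero_le _)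
      (Finset.mem_range.2 (Nat.lt_succ_of_le hr)))

theorem computable_totalBound {L Q : ℕ → ℕ → ℕ → ℕ}
    (hL : Computable fun v : ℕ × ℕ × ℕ => L v.1 v.2.1 v.2.2)
    (hQ : Computable fun v : ℕ × ℕ × ℕ => Q v.1 v.2.1 v.2.2) (T : ℕ) :
    Computable (totalBound L Q T) := by
  have hadd := fun {α : Type} [Primcodable α] {f g : α → ℕ} (hf : Computable f)
      (hg : Computable g) => Primrec.nat_add.to_comp.comp hf hg
  have h : Computable fun z : (ℕ × ℕ) × ℕ => choiceBound L Q (T + 2 + z.1.2) (T + z.2) z.2 :=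
    computable_choiceBound hL hQ
      (hadd (.const _) (Computable.snd.comp Computable.fst)) (hadd (.const T) Computable.snd)
      Computable.snd
  have h2 : Computable fun z : ℕ × ℕ => ∑ K ∈ Finset.range (z.1 + 1),
      choiceBound L Q (T + 2 + z.2) (T + K) K :=
    computable_sum (Computable₂.mk (f := fun (z : ℕ × ℕ) K =>
      choiceBound L Q (T + 2 + z.2) (T + K) K) h) (hadd Computable.fst (.const 1))
  exact computable_sum (Computable₂.mk (f := fun m r => ∑ K ∈ Finset.range (m + 1),
    choiceBound L Q (T + 2 + r) (T + K) K) h2) (hadd Computable.id (.const 1))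

/-! ### The reduction -/

/-- The code determines the parameter, so that the infimum in `codedParam` is over one value. -/
theorem AWInstance.param_le {T : ℕ} {y : Word} {I : AWInstance T} (hI : I.code = y) :
    I.param ≤ (AWSat T).param y := by
  obtain ⟨J, hJ, hJy⟩ : (AWSat T).param y ∈ {m | ∃ I : AWInstance T, I.code = y ∧ I.param = m} :=
    Nat.sInf_mem ⟨_, I, hI, rfl⟩
  rw [← hJy, AWInstance.param, AWInstance.param, I.blocks_eq, J.blocks_eq, hI, hJ]

/-- The reduction to alternating weighted satisfiability followed by the search. Instances that the
first part writes are not longer than its running time, so that the composition is an fpt algorithm.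
-/
theorem fptTuringReducible_of_fptReducible {L Q : ℕ → ℕ → ℕ → ℕ}
    (hL : Computable fun v : ℕ × ℕ × ℕ => L v.1 v.2.1 v.2.2)
    (hQ : Computable fun v : ℕ × ℕ × ℕ => Q v.1 v.2.1 v.2.2) {T : ℕ} (hT : 1 ≤ T) {A : ParamProblem}
    (hA : FptReducible A (AWSat T)) : FptTuringReducible A (FOLearn L Q) := by
  obtain ⟨R, p₁, f, g, P, hf, hg, hR⟩ := hA
  obtain ⟨p₂, d, hp⟩ := exists_decision_program L Q hT
  have hadd : ∀ {f g : ℕ → ℕ}, Computable f → Computable g → Computable fun a => f a + g a :=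
    fun hf hg => Primrec.nat_add.to_comp.comp hf hg
  have hmul : ∀ {f g : ℕ → ℕ}, Computable f → Computable g → Computable fun a => f a * g a :=
    fun hf hg => Primrec.nat_mul.to_comp.comp hf hg
  refine ⟨.seq p₁ p₂, fun m => (32 * ((f m + 1) * (totalBound L Q T (g m) + 1))) ^ (d + 1),
    fun m => 2 * g m + (2 * T + 4), (Polynomial.X + P + 1) ^ (d + 1), ?_, ?_, fun O hO x => ?_⟩
  · exact computable_pow (hmul (.const 32) (hmul (hadd hf (.const 1))
      (hadd ((computable_totalBound hL hQ T).comp hg) (.const 1)))) (.const _)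
  · exact hadd (hmul (.const 2) hg) (.const _)
  obtain ⟨⟨s, t, hrun, ht, hs⟩, hlang, hparam⟩ := hR x
  set m := A.param x with hm
  set D := totalBound L Q T (g m) with hD
  obtain ⟨b, hb, hcalc⟩ := hp O hO (R x) (2 * g m + (2 * T + 4)) D fun I hI => by
    have h1 := (AWInstance.param_le hI).trans hparam
    rw [AWInstance.param, ← length_schedule] at h1
    refine ⟨?_, choiceBound_le_totalBound L Q T (by omega) (by omega)⟩
    unfold queryParamBound
    omega
  obtain ⟨s', t', hrun', ht', hs'⟩ := hcalc s hs
  refine ⟨s', t + t', (hrun.mono fun _ _ h => h.elim).seq hrun', ?_, ?_⟩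
  · have hlen := length_output_le hrun hs
    have hsz := PT.sz_word (R x)
    -- both parts take at most `(16 * (F * E * W)) ^ (d + 1)` steps
    set F := f m + 1 with hF
    set E := D + 1 with hE
    set W := x.length + P.eval x.length + 1 with hW
    have heval : (Polynomial.X + P + 1 : Polynomial ℕ).eval x.length = W := by simp [hW]
    rw [Polynomial.eval_pow, heval, ← mul_pow]
    have h1 : x.length + f m * P.eval x.length + 1 ≤ F * W := by
      have : F * W = f m * x.length + f m * P.eval x.length + f m + W := by rw [hF, hW]; ring
      omega
    have h2 : F * W ≤ F * E * W := Nat.mul_le_mul_right _ (Nat.le_mul_of_pos_right _ (by omega))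
    have h3 : E ≤ F * E * W := by
      rw [mul_comm F E, mul_assoc]
      exact Nat.le_mul_of_pos_right _ (Nat.mul_pos (by omega) (by omega))
    have h4 : sz (R x) + D + 2 ≤ 16 * (F * E * W) := by omega
    have h5 : t ≤ 16 * (F * E * W) := by omega
    have h6 : 1 ≤ 16 * (F * E * W) := by omega
    have h7 : (sz (R x) + D + 2) ^ d ≤ (16 * (F * E * W)) ^ (d + 1) :=
      (Nat.pow_le_pow_left h4 d).trans (Nat.pow_le_pow_right h6 (by omega))
    have h8 : t ≤ (16 * (F * E * W)) ^ (d + 1) := h5.trans (Nat.le_self_pow (by omega) _)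
    have h9 : 32 * (F * E) * W = 2 * (16 * (F * E * W)) := by ring
    rw [h9, mul_pow]
    have h10 : 2 * (16 * (F * E * W)) ^ (d + 1) ≤ 2 ^ (d + 1) * (16 * (F * E * W)) ^ (d + 1) :=
      Nat.mul_le_mul_right _ (Nat.le_self_pow (by omega) _)
    omega
  · rw [hs', hlang, ← hb]
    cases b <;> simp [enc_false, enc_true]

end FOLearning

theorem theorem1 (L Q : ℕ → ℕ → ℕ → ℕ)
    (hLc : Computable (fun v : ℕ × ℕ × ℕ => L v.1 v.2.1 v.2.2))
    (hQc : Computable (fun v : ℕ × ℕ × ℕ => Q v.1 v.2.1 v.2.2))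
    (hL : ∀ l k q : ℕ, l ≤ L l k q)
    (hQ : ∀ q k l : ℕ, q ≤ Q q k l) :
    FOLearning.TuringHard FOLearning.AWStar (FOLearning.FOLearn L Q) := by
  rintro A ⟨-, T, hT, hA⟩
  exact FOLearning.fptTuringReducible_of_fptReducible hLc hQc hT hA
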